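/- All vector spaces, Lie algebras and tensor products are over $\mathbb C$. Let $\mathfrak g=\mathfrak g(C)$ be the Kac–Moody algebra of a generalized Cartan matrix $C$, with Cartan subalgebra $\mathfrak h$ and positive part $N^+$ (generated by the Chevalley generators $e_i$). Put $\mathfrak g'=[\mathfrak g,\mathfrak g]$, $\mathfrak h'=\mathfrak h\cap\mathfrak g'$, and let $\mathfrak h''$ be any subspace with $\mathfrak h=\mathfrak h'\oplus\mathfrak h''$. Let $A=\mathbb C[t_1^{\pm1},\dots,t_n^{\pm1}]$, $t^m=t_1^{m_1}\cdots t_n^{m_n}$ for $m\in\mathbb Z^n$, and $$\mathfrak g_A=\mathfrak g'\otimes A\oplus\mathfrak h'',\qquad \mathfrak h_A=\mathfrak h'\otimes A\oplus\mathfrak h'',$$ with brackets $[X\otimes a,Y\otimes b]=[X,Y]\otimes ab$, $[h,X\otimes a]=[h,X]\otimes a$, $[h,\tilde h]=0$ for $X,Y\in\mathfrak g'$, $a,b\in A$, $h,\tilde h\in\mathfrak h''$. For a linear map $\chi:\mathfrak h_A\to\mathbb C$ let $M(\chi)$ be the $\mathfrak g_A$-module induced from the one-dimensional $((N^+\otimes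 A)\oplus\mathfrak h_A)$-module on which $N^+\otimes A$ acts by $0$ and $\mathfrak h_A$ acts by $\chi$, and let $V(\chi)$ be the quotient of $M(\chi)$ by the sum of its proper submodules. Write $\chi_h(m)=\chi(h\otimes t^m)$ for $h\in\mathfrak h'$, $m\in\mathbb Z^n$. A function $f:\mathbb Z^n\to\mathbb C$ is exp-polynomial with exponents in $S\subseteq(\mathbb C^*)^n$ if it is a finite sum of terms $c\,m_1^{\ell_1}\cdots m_n^{\ell_n}\lambda_1^{m_1}\cdots\lambda_n^{m_n}$ with $c\in\mathbb C$, $\ell\in\mathbb N^n$, $\lambda\in S$; $\chi$ is called exp-polynomial (with exponents in $S$) if $\chi_h$ is so for every $h\in\mathfrak h'$. If $S$ is not mentioned, $S=(\mathbb C^*)^n$. Let $\psi:\mathfrak h_A\to\mathbb C$ be an exp-polynomial map, and assume that the subalgebra $A_\psi$ of $A$ generated by all $\psi(h\otimes t^m)\,t^m$ ($h\in\mathfrak h'$, $m\in\mathbb Z^n$) is $\mathbb C[t_1^{\pm r_1},\dots,t_n^{\pm r_n}]$ for positive integers $r_1,\dots,r_n$. Let $R=r_1\cdots r_n$, let $\overline\Gamma=\mathbb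 Z/r_1\mathbb Z\oplus\cdots\oplus\mathbb Z/r_n\mathbb Z$ (a group of order $R$), and let $\xi_i$ be a primitive $r_i$-th root of unity. Let $\overline\Gamma$ act on $(\mathbb C^*)^n$ by $k\cdot\lambda=(\xi_1^{k_1}\lambda_1,\dots,\xi_n^{k_n}\lambda_n)$ and let $B$ be a set of representatives of the orbits. For $k\in\overline\Gamma$ and a linear map $\Phi:\mathfrak h_A\to\mathbb C$ define $\xi^k\Phi$ by $(\xi^k\Phi)(h\otimes t^m)=\xi_1^{k_1m_1}\cdots\xi_n^{k_nm_n}\Phi(h\otimes t^m)$ for $h\in\mathfrak h'$ and $\xi^k\Phi=\Phi$ on $\mathfrak h''$. Then there is an exp-polynomial map $\Phi$ with exponents in $B$ such that $\psi=\sum_{k\in\overline\Gamma}\xi^k\Phi$. For every such $\Phi$, each of the $R$ highest weight modules $V(\xi^k\Phi)$, $k\in\overline\Gamma$, is irreducible, and $$V(\psi)\;\cong\;\bigotimes_{k\in\overline\Gamma}V(\xi^k\Phi)\qquad\text{as }\mathfrak g_A\text{-modules.}$$ -/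

import Mathlib

open scoped TensorProduct

noncomputable section

namespace LoopKM

universe u v

/-! ### Kac-Moody algebras -/

/-- Generalized Cartan matrices. -/
structure IsGCM {ι : Type u} (C : Matrix ι ι ℤ) : Prop where
  diag : ∀ i, C i i = 2
  nonpos : ∀ i j, i ≠ j → C i j ≤ 0
  zero_symm : ∀ i j, C i j = 0 → C j i = 0

/-- A (minimal) realization of the `N × N` matrix `C` over `ℂ`: a finite-dimensional space `H`
of dimension `2N - rank C`, linearly independent simple roots in the dual of `H`, and linearly
independent simple coroots in `H`, with `⟨coroot i, root j⟩ = C i j`. -/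
structure Realization {ι : Type u} [Fintype ι] (C : Matrix ι ι ℤ) (H : Type v)
    [AddCommGroup H] [Module ℂ H] where
  root : ι → Module.Dual ℂ H
  coroot : ι → H
  finiteDimensional : FiniteDimensional ℂ H
  linearIndependent_root : LinearIndependent ℂ root
  linearIndependent_coroot : LinearIndependent ℂ coroot
  root_coroot : ∀ i j, root j (coroot i) = (C i j : ℂ)
  finrank_add_rank :
    Module.finrank ℂ H + (C.map (Int.cast : ℤ → ℂ)).rank = 2 * Fintype.card ι

/-- Generators of a Kac-Moody algebra: all elements of `H`, and `e i`, `f i`. -/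
inductive Gen (ι : Type u) (H : Type v) : Type (max u v)
  | h : H → Gen ι H
  | e : ι → Gen ι H
  | f : ι → Gen ι H

section KacMoody

variable {ι : Type u} [Fintype ι] {C : Matrix ι ι ℤ} {H : Type v} [AddCommGroup H] [Module ℂ H]

/-- The generators, in the free Lie algebra. -/
abbrev gen {ι : Type u} {H : Type v} (x : Gen ι H) : FreeLieAlgebra ℂ (Gen ι H) :=
  FreeLieAlgebra.of ℂ x

/-- The defining relations of the auxiliary algebra `g̃(C)`; the first two say that `H` embeds
linearly. -/
inductive Rel {ι : Type u} [Fintype ι] {C : Matrix ι ι ℤ} {H : Type v} [AddCommGroup H]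
    [Module ℂ H] (Z : Realization C H) : FreeLieAlgebra ℂ (Gen ι H) → Prop
  | add (x y : H) : Rel Z (gen (ι := ι) (.h (x + y)) - gen (ι := ι) (.h x) - gen (ι := ι) (.h y))
  | smul (c : ℂ) (x : H) : Rel Z (gen (ι := ι) (.h (c • x)) - c • gen (ι := ι) (.h x))
  | hh (x y : H) : Rel Z ⁅gen (ι := ι) (.h x), gen (ι := ι) (.h y)⁆
  | he (x : H) (i : ι) : Rel Z (⁅gen (ι := ι) (.h x), gen (H := H) (.e i)⁆ - Z.root i x • gen (H := H) (.e i))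
  | hf (x : H) (i : ι) : Rel Z (⁅gen (ι := ι) (.h x), gen (H := H) (.f i)⁆ + Z.root i x • gen (H := H) (.f i))
  | ef_same (i : ι) : Rel Z (⁅gen (H := H) (.e i), gen (H := H) (.f i)⁆ - gen (ι := ι) (.h (Z.coroot i)))
  | ef_ne (i j : ι) (hij : i ≠ j) : Rel Z ⁅gen (H := H) (.e i), gen (H := H) (.f j)⁆

/-- The ideal generated by the defining relations. -/
def relIdeal (Z : Realization C H) : LieIdeal ℂ (FreeLieAlgebra ℂ (Gen ι H)) :=
  LieSubmodule.lieSpan ℂ _ {x | Rel Z x}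

/-- The auxiliary Lie algebra `g̃(C)`. -/
def Aux (Z : Realization C H) := FreeLieAlgebra ℂ (Gen ι H) ⧸ relIdeal Z

instance (Z : Realization C H) : LieRing (Aux Z) :=
  inferInstanceAs (LieRing (FreeLieAlgebra ℂ (Gen ι H) ⧸ relIdeal Z))

instance (Z : Realization C H) : LieAlgebra ℂ (Aux Z) :=
  inferInstanceAs (LieAlgebra ℂ (FreeLieAlgebra ℂ (Gen ι H) ⧸ relIdeal Z))

/-- The image of a generator in `g̃(C)`. -/
def auxGen (Z : Realization C H) (x : Gen ι H) : Aux Z :=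
  LieSubmodule.Quotient.mk (N := relIdeal Z) (gen x)

/-- The Cartan subalgebra of `g̃(C)`, as a subspace. -/
def auxCartan (Z : Realization C H) : Submodule ℂ (Aux Z) :=
  Submodule.span ℂ (Set.range fun x : H => auxGen Z (.h x))

/-- The sum of all ideals of `g̃(C)` that intersect the Cartan subalgebra trivially. -/
def maxIdeal (Z : Realization C H) : LieIdeal ℂ (Aux Z) :=
  sSup {I : LieIdeal ℂ (Aux Z) | I.toSubmodule ⊓ auxCartan Z = ⊥}

/-- The Kac-Moody algebra `g = g(C)`. -/
def KM (Z : Realization C H) := Aux Z ⧸ maxIdeal Z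

instance (Z : Realization C H) : LieRing (KM Z) :=
  inferInstanceAs (LieRing (Aux Z ⧸ maxIdeal Z))

instance (Z : Realization C H) : LieAlgebra ℂ (KM Z) :=
  inferInstanceAs (LieAlgebra ℂ (Aux Z ⧸ maxIdeal Z))

/-- The image of a generator in `g`. -/
def kmGen (Z : Realization C H) (x : Gen ι H) : KM Z :=
  LieSubmodule.Quotient.mk (N := maxIdeal Z) (auxGen Z x)

/-- The Cartan subalgebra `h` of `g`. -/
def cartan (Z : Realization C H) : Submodule ℂ (KM Z) :=
  Submodule.span ℂ (Set.range fun x : H => kmGen Z (.h x))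

/-- `N⁺`, the subalgebra of `g` generated by the `e i`. -/
def nPos (Z : Realization C H) : LieSubalgebra ℂ (KM Z) :=
  LieSubalgebra.lieSpan ℂ (KM Z) (Set.range fun i : ι => kmGen Z (.e i))

/-- `g' = [g, g]`. -/
def derived (Z : Realization C H) : LieIdeal ℂ (KM Z) :=
  ⁅(⊤ : LieIdeal ℂ (KM Z)), (⊤ : LieIdeal ℂ (KM Z))⁆

/-- `h' = h ∩ g'`. -/
def cartan' (Z : Realization C H) : Submodule ℂ (KM Z) :=
  cartan Z ⊓ (derived Z).toSubmodule

/-- `h''` is a complement of `h'` in `h`. -/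
def IsCartanCompl (Z : Realization C H) (H2 : Submodule ℂ (KM Z)) : Prop :=
  cartan' Z ⊓ H2 = ⊥ ∧ cartan' Z ⊔ H2 = cartan Z

end KacMoody

/-! ### Loop Kac-Moody algebras -/

/-- The Laurent polynomials `A = ℂ[t₁^{±1}, …, tₙ^{±1}]`, the group algebra of `ℤⁿ`. -/
def Laurent (n : ℕ) := AddMonoidAlgebra ℂ (Fin n → ℤ)

instance (n : ℕ) : CommRing (Laurent n) :=
  inferInstanceAs (CommRing (AddMonoidAlgebra ℂ (Fin n → ℤ)))

instance (n : ℕ) : Algebra ℂ (Laurent n) :=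
  inferInstanceAs (Algebra ℂ (AddMonoidAlgebra ℂ (Fin n → ℤ)))

/-- The monomial `t^m`. -/
def mono {n : ℕ} (m : Fin n → ℤ) : Laurent n :=
  (AddMonoidAlgebra.single m 1 : AddMonoidAlgebra ℂ (Fin n → ℤ))

/-- The basis of `A` formed by the monomials. -/
def monoBasis (n : ℕ) : Module.Basis (Fin n → ℤ) ℂ (Laurent n) :=
  .ofRepr ((AddMonoidAlgebra.basis (Fin n → ℤ) ℂ).repr : AddMonoidAlgebra ℂ (Fin n → ℤ) ≃ₗ[ℂ] _)

theorem monoBasis_apply {n : ℕ} (m : Fin n → ℤ) : monoBasis n m = mono m :=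
  AddMonoidAlgebra.basis_apply ℂ m

section Loop

variable {ι : Type u} [Fintype ι] {C : Matrix ι ι ℤ} {H : Type v} [AddCommGroup H] [Module ℂ H]

/-- The subspace `S ⊗ A` of `g ⊗ A` (written with `A` on the left). -/
def loopSub {Z : Realization C H} (n : ℕ) (S : Submodule ℂ (KM Z)) :
    Submodule ℂ (Laurent n ⊗[ℂ] KM Z) :=
  LinearMap.range (LinearMap.lTensor (Laurent n) S.subtype)

/-- The map `x ↦ x ⊗ 1` from `g` to `g ⊗ A`. -/
def constMap (Z : Realization C H) (n : ℕ) : KM Z →ₗ[ℂ] Laurent n ⊗[ℂ] KM Z :=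
  TensorProduct.mk ℂ (Laurent n) (KM Z) 1

theorem lie_mem_loopSub {Z : Realization C H} {n : ℕ} (x y : Laurent n ⊗[ℂ] KM Z) :
    ⁅x, y⁆ ∈ loopSub n (derived Z).toSubmodule := by
  induction x using TensorProduct.induction_on with
  | zero => rw [zero_lie]; exact Submodule.zero_mem _
  | add a b ha hb => rw [add_lie]; exact Submodule.add_mem _ ha hb
  | tmul a x =>
    induction y using TensorProduct.induction_on with
    | zero => rw [lie_zero]; exact Submodule.zero_mem _
    | add b c hb hc => rw [lie_add]; exact Submodule.add_mem _ hb hc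
    | tmul b y =>
      exact ⟨(a * b) ⊗ₜ[ℂ] (⟨⁅x, y⁆, LieSubmodule.lie_mem_lie (LieSubmodule.mem_top x)
        (LieSubmodule.mem_top y)⟩ : (derived Z).toSubmodule), rfl⟩

/-- The loop Kac-Moody algebra `g_A = g' ⊗ A ⊕ h''`, realized inside `g ⊗ A`. The sum is direct
since `h'' ∩ g' = h'' ∩ h' = 0`. -/
def loopKM (Z : Realization C H) (n : ℕ) (H2 : Submodule ℂ (KM Z)) :
    LieSubalgebra ℂ (Laurent n ⊗[ℂ] KM Z) where
  toSubmodule := loopSub n (derived Z).toSubmodule ⊔ H2.map (constMap Z n)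
  lie_mem' := fun {x y} _ _ => Submodule.mem_sup_left (lie_mem_loopSub x y)

/-- `h_A = h' ⊗ A ⊕ h''` (the external direct sum). -/
abbrev LoopCartan (Z : Realization C H) (n : ℕ) (H2 : Submodule ℂ (KM Z)) :=
  (Laurent n ⊗[ℂ] cartan' Z) × H2

/-- The inclusion of `h_A` in `g ⊗ A`. -/
def loopCartanMap (Z : Realization C H) (n : ℕ) (H2 : Submodule ℂ (KM Z)) :
    LoopCartan Z n H2 →ₗ[ℂ] Laurent n ⊗[ℂ] KM Z :=
  (LinearMap.lTensor (Laurent n) (cartan' Z).subtype).coprod (constMap Z n ∘ₗ H2.subtype)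

theorem loopCartanMap_mem (Z : Realization C H) (n : ℕ) (H2 : Submodule ℂ (KM Z))
    (x : LoopCartan Z n H2) : loopCartanMap Z n H2 x ∈ loopKM Z n H2 := by
  obtain ⟨a, b⟩ := x
  rw [loopCartanMap, LinearMap.coprod_apply]
  refine Submodule.add_mem_sup ?_ ⟨b, b.2, rfl⟩
  have h : cartan' Z ≤ (derived Z).toSubmodule := inf_le_right
  refine ⟨LinearMap.lTensor (Laurent n) (Submodule.inclusion h) a, ?_⟩
  rw [← LinearMap.comp_apply, ← LinearMap.lTensor_comp, Submodule.subtype_comp_inclusion]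

/-- The inclusion of `h_A` in `g_A`. -/
def loopCartanIncl (Z : Realization C H) (n : ℕ) (H2 : Submodule ℂ (KM Z))
    (x : LoopCartan Z n H2) : loopKM Z n H2 :=
  ⟨loopCartanMap Z n H2 x, loopCartanMap_mem Z n H2 x⟩

/-- The element `h ⊗ t^m` of `h_A`. -/
def cartanMono {Z : Realization C H} {n : ℕ} {H2 : Submodule ℂ (KM Z)} (h : cartan' Z)
    (m : Fin n → ℤ) : LoopCartan Z n H2 :=
  (mono m ⊗ₜ[ℂ] h, 0)

attribute [local instance] LieRing.ofAssociativeRing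

/-! ### The modules `M(ψ)` and `V(ψ)` -/

variable {Z : Realization C H} {n : ℕ} {H2 : Submodule ℂ (KM Z)}

/-- The universal enveloping algebra of `g_A`. -/
abbrev UEA (Z : Realization C H) (n : ℕ) (H2 : Submodule ℂ (KM Z)) :=
  UniversalEnvelopingAlgebra ℂ (loopKM Z n H2)

/-- The left ideal of `U(g_A)` generated by `N⁺ ⊗ A` and by `x - ψ(x)` for `x ∈ h_A`. -/
def vermaIdeal (ψ : Module.Dual ℂ (LoopCartan Z n H2)) : Submodule (UEA Z n H2) (UEA Z n H2) :=
  Submodule.span (UEA Z n H2)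
    ({u | ∃ x : loopKM Z n H2, (x : Laurent n ⊗[ℂ] KM Z) ∈ loopSub n (nPos Z).toSubmodule ∧
        u = UniversalEnvelopingAlgebra.ι ℂ x} ∪
      {u | ∃ y : LoopCartan Z n H2,
        u = UniversalEnvelopingAlgebra.ι ℂ (loopCartanIncl Z n H2 y) -
          algebraMap ℂ (UEA Z n H2) (ψ y)})

/-- `M(ψ)`, the `U(g_A)`-module induced from the one-dimensional module of
`(N⁺ ⊗ A) ⊕ h_A` given by `ψ`. -/
abbrev Verma (ψ : Module.Dual ℂ (LoopCartan Z n H2)) := UEA Z n H2 ⧸ vermaIdeal ψ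

/-- The sum of all proper submodules of `M(ψ)`. -/
def vermaMax (ψ : Module.Dual ℂ (LoopCartan Z n H2)) : Submodule (UEA Z n H2) (Verma ψ) :=
  sSup {N | N ≠ ⊤}

/-- `V(ψ)`, the irreducible quotient of `M(ψ)`. -/
def V (ψ : Module.Dual ℂ (LoopCartan Z n H2)) := Verma ψ ⧸ vermaMax ψ

instance (ψ : Module.Dual ℂ (LoopCartan Z n H2)) : AddCommGroup (V ψ) :=
  inferInstanceAs (AddCommGroup (Verma ψ ⧸ vermaMax ψ))

instance (ψ : Module.Dual ℂ (LoopCartan Z n H2)) : Module (UEA Z n H2) (V ψ) :=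
  inferInstanceAs (Module (UEA Z n H2) (Verma ψ ⧸ vermaMax ψ))

instance (ψ : Module.Dual ℂ (LoopCartan Z n H2)) : Module ℂ (V ψ) :=
  inferInstanceAs (Module ℂ (Verma ψ ⧸ vermaMax ψ))

instance (ψ : Module.Dual ℂ (LoopCartan Z n H2)) : IsScalarTower ℂ (UEA Z n H2) (V ψ) :=
  inferInstanceAs (IsScalarTower ℂ (UEA Z n H2) (Verma ψ ⧸ vermaMax ψ))

/-- The action of `g_A` on `V(ψ)`. -/
instance (ψ : Module.Dual ℂ (LoopCartan Z n H2)) : LieRingModule (loopKM Z n H2) (V ψ) where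
  bracket x v := UniversalEnvelopingAlgebra.ι ℂ x • v
  add_lie x y v := by
    change UniversalEnvelopingAlgebra.ι ℂ (x + y) • v = _
    rw [map_add, add_smul]
  lie_add x v w := smul_add _ v w
  leibniz_lie x y v := by
    change UniversalEnvelopingAlgebra.ι ℂ x • UniversalEnvelopingAlgebra.ι ℂ y • v =
      UniversalEnvelopingAlgebra.ι ℂ ⁅x, y⁆ • v +
        UniversalEnvelopingAlgebra.ι ℂ y • UniversalEnvelopingAlgebra.ι ℂ x • v
    rw [LieHom.map_lie, LieRing.of_associative_ring_bracket, sub_smul, mul_smul, mul_smul,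
      sub_add_cancel]

instance (ψ : Module.Dual ℂ (LoopCartan Z n H2)) : LieModule ℂ (loopKM Z n H2) (V ψ) where
  smul_lie c x v := by
    change UniversalEnvelopingAlgebra.ι ℂ (c • x) • v = c • UniversalEnvelopingAlgebra.ι ℂ x • v
    rw [map_smul, smul_assoc]
  lie_smul c x v := by
    change UniversalEnvelopingAlgebra.ι ℂ x • c • v = c • UniversalEnvelopingAlgebra.ι ℂ x • v
    rw [← algebraMap_smul (UEA Z n H2) c v, ← algebraMap_smul (UEA Z n H2) c
      (UniversalEnvelopingAlgebra.ι ℂ x • v), smul_smul, smul_smul, Algebra.commutes]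

end Loop

/-! ### Tensor products of families of Lie algebra modules -/

section Tensor

variable {κ : Type*} [Fintype κ] [DecidableEq κ] {L : Type*} [LieRing L] [LieAlgebra ℂ L]
  {M : κ → Type*} [∀ k, AddCommGroup (M k)] [∀ k, Module ℂ (M k)]
  [∀ k, LieRingModule L (M k)] [∀ k, LieModule ℂ L (M k)]

/-- The action of `x` on the `k`-th factor of `⨂ M k`. -/
def factorAct (x : L) (k : κ) : Module.End ℂ (⨂[ℂ] k, M k) :=
  PiTensorProduct.map
    (Function.update (fun _ => LinearMap.id) k (LieModule.toEnd ℂ L (M k) x))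

/-- `x · (⨂ v_k) = ∑_k (… ⊗ x v_k ⊗ …)`. -/
def tensorAct (x : L) : Module.End ℂ (⨂[ℂ] k, M k) := ∑ k, factorAct x k

theorem factorAct_add (x y : L) (k : κ) :
    factorAct (M := M) (x + y) k = factorAct x k + factorAct y k := by
  rw [factorAct, map_add, PiTensorProduct.map_update_add]; rfl

theorem factorAct_smul (c : ℂ) (x : L) (k : κ) :
    factorAct (M := M) (c • x) k = c • factorAct x k := by
  rw [factorAct, map_smul, PiTensorProduct.map_update_smul]; rfl

theorem factorAct_tprod (x : L) (k : κ) (v : ∀ k, M k) :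
    factorAct x k (PiTensorProduct.tprod ℂ v) =
      PiTensorProduct.tprod ℂ (Function.update v k ⁅x, v k⁆) := by
  rw [factorAct, PiTensorProduct.map_tprod]
  congr 1
  funext j
  by_cases h : j = k
  · subst h; simp
  · simp [h]

theorem factorAct_lie (x y : L) (k : κ) :
    factorAct (M := M) ⁅x, y⁆ k = ⁅factorAct (M := M) x k, factorAct (M := M) y k⁆ := by
  refine PiTensorProduct.ext (MultilinearMap.ext fun v => ?_)
  simp only [LinearMap.compMultilinearMap_apply, LieRing.of_associative_ring_bracket,
    LinearMap.sub_apply, Module.End.mul_apply, factorAct_tprod, Function.update_self,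
    Function.update_idem, lie_lie, MultilinearMap.map_update_sub]

theorem factorAct_comm (x y : L) {k l : κ} (h : k ≠ l) :
    ⁅factorAct (M := M) x k, factorAct (M := M) y l⁆ = 0 := by
  refine PiTensorProduct.ext (MultilinearMap.ext fun v => ?_)
  simp only [LinearMap.compMultilinearMap_apply, LieRing.of_associative_ring_bracket,
    LinearMap.sub_apply, Module.End.mul_apply, factorAct_tprod, LinearMap.zero_apply,
    Function.update_of_ne h, Function.update_of_ne h.symm, Function.update_comm h, sub_self]

theorem tensorAct_lie (x y : L) :
    tensorAct (M := M) ⁅x, y⁆ = ⁅tensorAct (M := M) x, tensorAct (M := M) y⁆ := by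
  rw [tensorAct, tensorAct, tensorAct, LieRing.of_associative_ring_bracket, Finset.sum_mul_sum,
    Finset.sum_mul_sum, Finset.sum_comm (f := fun i j => factorAct y i * factorAct x j),
    ← Finset.sum_sub_distrib]
  refine Finset.sum_congr rfl fun k _ => ?_
  rw [← Finset.sum_sub_distrib, Finset.sum_eq_single k, factorAct_lie]
  · rfl
  · intro l _ hl
    exact factorAct_comm x y hl.symm
  · simp

/-- The Lie algebra acts on the tensor product of a finite family of modules by the Leibniz
rule. -/
instance : LieRingModule L (⨂[ℂ] k, M k) where
  bracket x v := tensorAct x v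
  add_lie x y v := by
    change tensorAct (x + y) v = tensorAct x v + tensorAct y v
    simp only [tensorAct, factorAct_add, Finset.sum_add_distrib, LinearMap.add_apply]
  lie_add x v w := map_add _ v w
  leibniz_lie x y v := by
    change tensorAct x (tensorAct y v) = tensorAct ⁅x, y⁆ v + tensorAct y (tensorAct x v)
    rw [tensorAct_lie, LieRing.of_associative_ring_bracket, LinearMap.sub_apply,
      Module.End.mul_apply, Module.End.mul_apply, sub_add_cancel]

instance : LieModule ℂ L (⨂[ℂ] k, M k) where
  smul_lie c x v := by
    change tensorAct (c • x) v = c • tensorAct x v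
    simp only [tensorAct, factorAct_smul, ← Finset.smul_sum, LinearMap.smul_apply]
  lie_smul c x v := map_smul _ c v

end Tensor

/-! ### Exp-polynomial maps and their decomposition -/

/-- `f : ℤⁿ → ℂ` is a finite sum of terms `c · m₁^{k₁} ⋯ mₙ^{kₙ} · a₁^{m₁} ⋯ aₙ^{mₙ}` with `k ∈ ℕⁿ`
and all occurring `a ∈ (ℂ*)ⁿ` lying in `S`. -/
def IsExpPolyOn {n : ℕ} (S : Set (Fin n → ℂˣ)) (f : (Fin n → ℤ) → ℂ) : Prop :=
  ∃ c : ((Fin n → ℕ) × (Fin n → ℂˣ)) →₀ ℂ, (∀ p ∈ c.support, p.2 ∈ S) ∧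
    ∀ m, f m = c.sum fun p z => z * (∏ i, (m i : ℂ) ^ p.1 i) * ∏ i, (p.2 i : ℂ) ^ m i

/-- The action of `k ∈ ℤ/r₁ ⊕ ⋯ ⊕ ℤ/rₙ` on `(ℂ*)ⁿ` by `λ ↦ (ξ₁^{k₁} λ₁, …, ξₙ^{kₙ} λₙ)`. -/
def rotate {n : ℕ} {r : Fin n → ℕ} (ξ : Fin n → ℂˣ) (k : ∀ i, ZMod (r i)) (l : Fin n → ℂˣ) :
    Fin n → ℂˣ :=
  fun i => ξ i ^ (k i).val * l i

/-- `B` contains exactly one point of each orbit of this action. -/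
def IsTransversal {n : ℕ} (r : Fin n → ℕ) (ξ : Fin n → ℂˣ) (B : Set (Fin n → ℂˣ)) : Prop :=
  ∀ l : Fin n → ℂˣ, ∃! b, b ∈ B ∧ ∃ k : ∀ i, ZMod (r i), l = rotate ξ k b

/-- The linear map `t^m ↦ ξ^{k·m} t^m = ξ₁^{k₁m₁} ⋯ ξₙ^{kₙmₙ} t^m` on `A`. -/
def laurentTwist {n : ℕ} {r : Fin n → ℕ} (ξ : Fin n → ℂˣ) (k : ∀ i, ZMod (r i)) :
    Laurent n →ₗ[ℂ] Laurent n :=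
  (monoBasis n).constr ℂ fun m =>
    (∏ i, ((ξ i ^ (k i).val : ℂˣ) : ℂ) ^ m i) • mono m

/-- The subalgebra `ℂ[t₁^{±r₁}, …, tₙ^{±rₙ}]` of `A`. -/
def powerSubalgebra {n : ℕ} (r : Fin n → ℕ) : Subalgebra ℂ (Laurent n) :=
  Algebra.adjoin ℂ
    (Set.range (fun i : Fin n => (mono (Pi.single i (r i : ℤ)) : Laurent n)) ∪
      Set.range (fun i : Fin n => (mono (Pi.single i (-(r i : ℤ))) : Laurent n)))

section Functionals

variable {ι : Type u} [Fintype ι] {C : Matrix ι ι ℤ} {H : Type v} [AddCommGroup H] [Module ℂ H]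
  {Z : Realization C H} {n : ℕ} {H2 : Submodule ℂ (KM Z)}

/-- `ψ_h(m) = ψ(h ⊗ t^m)`. -/
def component (ψ : Module.Dual ℂ (LoopCartan Z n H2)) (h : cartan' Z) (m : Fin n → ℤ) : ℂ :=
  ψ (cartanMono h m)

/-- `ψ` is an exp-polynomial map whose exponentials all lie in `S`. -/
def ExpPolyOn (S : Set (Fin n → ℂˣ)) (ψ : Module.Dual ℂ (LoopCartan Z n H2)) : Prop :=
  ∀ h : cartan' Z, IsExpPolyOn S (component ψ h)

/-- `ψ` is an exp-polynomial map. -/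
def ExpPoly (ψ : Module.Dual ℂ (LoopCartan Z n H2)) : Prop := ExpPolyOn Set.univ ψ

/-- `A_ψ`, the image of `U(h' ⊗ A)` in `A` under the algebra homomorphism that extends
`h ⊗ t^m ↦ ψ(h ⊗ t^m) t^m`; that is, the subalgebra generated by the `ψ(h ⊗ t^m) t^m`. -/
def imageAlgebra (ψ : Module.Dual ℂ (LoopCartan Z n H2)) : Subalgebra ℂ (Laurent n) :=
  Algebra.adjoin ℂ
    (Set.range fun p : cartan' Z × (Fin n → ℤ) => component ψ p.1 p.2 • mono p.2)

/-- `ξ^k Φ`: `(ξ^k Φ)(h ⊗ t^m) = ξ^{k·m} Φ(h ⊗ t^m)`, and `ξ^k Φ = Φ` on `h''`. In terms of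
`Φ_h = ∑ p_{h,λ} exp λ` this is `(ξ^k Φ)_h = ∑ p_{h,λ} exp (k·λ)`. -/
def twist {r : Fin n → ℕ} (ξ : Fin n → ℂˣ) (k : ∀ i, ZMod (r i))
    (Φ : Module.Dual ℂ (LoopCartan Z n H2)) : Module.Dual ℂ (LoopCartan Z n H2) :=
  Φ ∘ₗ LinearMap.prodMap (LinearMap.rTensor (cartan' Z) (laurentTwist ξ k)) LinearMap.id

/-- `Φ` is a summand as in `ψ = ∑_k ξ^k Φ`, with exponentials taken from `B`. -/
def IsDecomposition (r : Fin n → ℕ) [∀ i, NeZero (r i)] (ξ : Fin n → ℂˣ)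
    (B : Set (Fin n → ℂˣ)) (ψ Φ : Module.Dual ℂ (LoopCartan Z n H2)) : Prop :=
  ExpPolyOn B Φ ∧ ψ = ∑ k : (∀ i, ZMod (r i)), twist ξ k Φ

end Functionals

end LoopKM

end

noncomputable section

namespace LoopKM

/-!
A module generated by a highest weight vector `v`, with a functional reading off the coefficient of
`v`, is irreducible as soon as no nonzero submodule lies in the kernel of that functional, and it is
then determined by its weight. Letting generators act on words in the lowering generators shows
that every weight occurs, so `V(ψ)` is irreducible for every `ψ`.

If `ψ` is exp-polynomial, `g' ⊗ I` acts by zero on `V(ψ)` for an ideal `I` of `A` that depends only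
on the restriction of `ψ` to `h' ⊗ A`. For finitely many maps with pairwise disjoint sets of
exponents these ideals are pairwise coprime. By the Chinese remainder theorem `g' ⊗ A` then acts on
the factors of the tensor product of the `V(ψ_k)` one at a time, which makes the tensor product an
irreducible highest weight module of weight `∑ ψ_k`, hence isomorphic to `V(∑ ψ_k)`.

The condition on `A_ψ` forces `ψ` to vanish on `h' ⊗ t^m` unless `r_i ∣ m_i` for all `i`, so
`R ψ = ∑ ξ^k ψ`. In this sum over `k` each exponent may be replaced by the representative in `B`
of its orbit without changing the total.
-/

/-! ### Highest weight modules -/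

section LieSpan

variable {R L M : Type*} [CommRing R] [LieRing L] [LieAlgebra R L] [AddCommGroup M] [Module R M]
  [LieRingModule L M] [LieModule R L M]

theorem lie_eq_zero_of_mem_lieSpan {S : Set L} {m : M} (h : ∀ s ∈ S, ⁅s, m⁆ = 0) {x : L}
    (hx : x ∈ LieSubalgebra.lieSpan R L S) : ⁅x, m⁆ = 0 := by
  induction hx using LieSubalgebra.lieSpan_induction with
  | mem x hx => exact h x hx
  | zero => exact zero_lie m
  | add x y _ _ hx hy => rw [add_lie, hx, hy, add_zero]
  | smul a x _ hx => rw [smul_lie, hx, smul_zero]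
  | lie x y _ _ hx hy => rw [lie_lie, hx, hy, lie_zero, lie_zero, sub_zero]

theorem lie_mem_of_mem_lieSpan {S : Set L} {N : Submodule R M}
    (h : ∀ s ∈ S, ∀ w ∈ N, ⁅s, w⁆ ∈ N) {x : L} (hx : x ∈ LieSubalgebra.lieSpan R L S) :
    ∀ w ∈ N, ⁅x, w⁆ ∈ N := by
  induction hx using LieSubalgebra.lieSpan_induction with
  | mem x hx => exact h x hx
  | zero => intro w _; rw [zero_lie]; exact N.zero_mem
  | add x y _ _ hx hy => intro w hw; rw [add_lie]; exact N.add_mem (hx w hw) (hy w hw)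
  | smul a x _ hx => intro w hw; rw [smul_lie]; exact N.smul_mem a (hx w hw)
  | lie x y _ _ hx hy =>
    intro w hw; rw [lie_lie]; exact N.sub_mem (hx _ (hy w hw)) (hy _ (hx w hw))

end LieSpan

section HighestWeight

variable {K L 𝔥 M : Type*} [Field K] [LieRing L] [LieAlgebra K L] [AddCommGroup 𝔥] [Module K 𝔥]
  [AddCommGroup M] [Module K M] [LieRingModule L M] [LieModule K L M]

open Polynomial in
theorem exists_aeval_eq_zero_of_mem_iSup_eigenspace {D : Module.End K M} {ι : Type*} {μ : ι → K}
    {ν : K} (hν : ∀ i, ν ≠ μ i) {w : M} (hw : w ∈ ⨆ i, D.eigenspace (μ i)) :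
    ∃ q : K[X], q.eval ν ≠ 0 ∧ aeval D q w = 0 := by
  induction hw using Submodule.iSup_induction' with
  | mem i w hw =>
    refine ⟨X - C (μ i), by simpa [sub_eq_zero] using hν i, ?_⟩
    simpa [sub_eq_zero] using Module.End.mem_eigenspace_iff.1 hw
  | zero => exact ⟨1, by simp, map_zero _⟩
  | add w₁ w₂ _ _ h₁ h₂ =>
    obtain ⟨q₁, hq₁, hw₁⟩ := h₁
    obtain ⟨q₂, hq₂, hw₂⟩ := h₂
    refine ⟨q₁ * q₂, by simp [hq₁, hq₂], ?_⟩
    rw [map_add, map_mul, Module.End.mul_apply _ _ w₂, hw₂, ← map_mul, mul_comm, map_mul,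
      Module.End.mul_apply, hw₁, map_zero, map_zero, add_zero]

variable (K L 𝔥) in
/-- A triangular decomposition of a Lie algebra `L`, given by generators: subspaces `lowering` and
`raising` that generate the negative and the positive part, an embedding of a space `𝔥` as the
Cartan subalgebra, and an element `deg` of `𝔥` for which the lowering and the raising generators
have degrees `-1` and `1`. -/
structure TriangularData where
  lowering : Submodule K L
  raising : Submodule K L
  cartan : 𝔥 →ₗ[K] L
  deg : 𝔥
  cartan_injective : Function.Injective cartan
  cartan_lie_cartan : ∀ y z, ⁅cartan y, cartan z⁆ = 0
  cartan_lie_lowering : ∀ y, ∀ f ∈ lowering, ⁅cartan y, f⁆ ∈ lowering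
  cartan_lie_raising : ∀ y, ∀ e ∈ raising, ⁅cartan y, e⁆ ∈ raising
  raising_lie_lowering : ∀ e ∈ raising, ∀ f ∈ lowering, ⁅e, f⁆ ∈ LinearMap.range cartan
  deg_lie_lowering : ∀ f ∈ lowering, ⁅cartan deg, f⁆ = -f
  deg_lie_raising : ∀ e ∈ raising, ⁅cartan deg, e⁆ = e
  span_eq_top : (LieSubalgebra.lieSpan K L (lowering : Set L)).toSubmodule ⊔
    LinearMap.range cartan ⊔ (LieSubalgebra.lieSpan K L (raising : Set L)).toSubmodule = ⊤

/-- `M` is generated by a highest weight vector `v` of weight `ψ`, and the functional `top` picks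
out the coefficient of `v`. In the dual module, `top` is a lowest weight vector. -/
structure IsHighestWeight (τ : TriangularData K L 𝔥) (ψ : Module.Dual K 𝔥) (v : M)
    (top : Module.Dual K M) : Prop where
  top_self : top v = 1
  raising_lie : ∀ e ∈ τ.raising, ⁅e, v⁆ = 0
  cartan_lie : ∀ y, ⁅τ.cartan y, v⁆ = ψ y • v
  top_lowering_lie : ∀ f ∈ τ.lowering, ∀ w, top ⁅f, w⁆ = 0
  top_cartan_lie : ∀ y w, top ⁅τ.cartan y, w⁆ = ψ y * top w
  lieSpan_eq_top : LieSubmodule.lieSpan K L {v} = ⊤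

variable (L) in
/-- No nonzero submodule of `M` lies in the kernel of the functional `top`. On a highest weight
module this amounts to irreducibility. -/
def IsNondegenerate (top : Module.Dual K M) : Prop :=
  ∀ N : LieSubmodule K L M, N.toSubmodule ≤ LinearMap.ker top → N = ⊥

variable {τ : TriangularData K L 𝔥} {ψ : Module.Dual K 𝔥} {v : M} {top : Module.Dual K M}

/-- The smallest subspace that contains `v` and is stable under the lowering operators. -/
def loweringSpan (τ : TriangularData K L 𝔥) (v : M) : Submodule K M :=
  sInf {Q | v ∈ Q ∧ ∀ f ∈ τ.lowering, ∀ w ∈ Q, ⁅f, w⁆ ∈ Q}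

omit [LieModule K L M] in
theorem self_mem_loweringSpan : v ∈ loweringSpan τ v :=
  Submodule.mem_sInf.2 fun _ hQ => hQ.1

omit [LieModule K L M] in
theorem lie_mem_loweringSpan {f : L} (hf : f ∈ τ.lowering) {w : M} (hw : w ∈ loweringSpan τ v) :
    ⁅f, w⁆ ∈ loweringSpan τ v :=
  Submodule.mem_sInf.2 fun Q hQ => hQ.2 f hf w (Submodule.mem_sInf.1 hw Q hQ)

omit [LieModule K L M] in
theorem loweringSpan_le {Q : Submodule K M} (hv : v ∈ Q)
    (hQ : ∀ f ∈ τ.lowering, ∀ w ∈ loweringSpan τ v, w ∈ Q → ⁅f, w⁆ ∈ Q) :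
    loweringSpan τ v ≤ Q := by
  refine le_trans (sInf_le ?_) (inf_le_right (a := loweringSpan τ v))
  exact ⟨⟨self_mem_loweringSpan, hv⟩, fun f hf w hw =>
    ⟨lie_mem_loweringSpan hf hw.1, hQ f hf w hw.1 hw.2⟩⟩

namespace IsHighestWeight

theorem cartan_lie_mem_loweringSpan (h : IsHighestWeight τ ψ v top) (y : 𝔥) :
    ∀ w ∈ loweringSpan τ v, ⁅τ.cartan y, w⁆ ∈ loweringSpan τ v := by
  refine loweringSpan_le
    (Q := (loweringSpan τ v).comap (LieModule.toEnd K L M (τ.cartan y))) ?_ fun f hf w hw hcw => ?_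
  · rw [Submodule.mem_comap, LieModule.toEnd_apply_apply, h.cartan_lie]
    exact Submodule.smul_mem _ _ self_mem_loweringSpan
  · rw [Submodule.mem_comap, LieModule.toEnd_apply_apply, leibniz_lie]
    exact add_mem (lie_mem_loweringSpan (τ.cartan_lie_lowering y f hf) hw)
      (lie_mem_loweringSpan hf hcw)

theorem raising_lie_mem_loweringSpan (h : IsHighestWeight τ ψ v top) {e : L}
    (he : e ∈ τ.raising) : ∀ w ∈ loweringSpan τ v, ⁅e, w⁆ ∈ loweringSpan τ v := by
  refine loweringSpan_le
    (Q := (loweringSpan τ v).comap (LieModule.toEnd K L M e)) ?_ fun f hf w hw hew => ?_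
  · rw [Submodule.mem_comap, LieModule.toEnd_apply_apply, h.raising_lie e he]
    exact Submodule.zero_mem _
  · obtain ⟨y, hy⟩ := τ.raising_lie_lowering e he f hf
    rw [Submodule.mem_comap, LieModule.toEnd_apply_apply, leibniz_lie, ← hy]
    exact add_mem (h.cartan_lie_mem_loweringSpan y w hw) (lie_mem_loweringSpan hf hew)

theorem loweringSpan_eq_top (h : IsHighestWeight τ ψ v top) : loweringSpan τ v = ⊤ := by
  have hlie (x : L) {w : M} (hw : w ∈ loweringSpan τ v) : ⁅x, w⁆ ∈ loweringSpan τ v := by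
    obtain ⟨_, hac, b, hb, rfl⟩ := Submodule.mem_sup.1 (τ.span_eq_top ▸ Submodule.mem_top (x := x))
    obtain ⟨a, ha, _, ⟨y, rfl⟩, rfl⟩ := Submodule.mem_sup.1 hac
    rw [add_lie, add_lie]
    exact add_mem (add_mem
      (lie_mem_of_mem_lieSpan (fun f hf w hw => lie_mem_loweringSpan hf hw) ha w hw)
      (h.cartan_lie_mem_loweringSpan y w hw))
      (lie_mem_of_mem_lieSpan (fun e he => h.raising_lie_mem_loweringSpan he) hb w hw)
  have hle : LieSubmodule.lieSpan K L {v} ≤ { loweringSpan τ v with lie_mem := hlie _ } :=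
    LieSubmodule.lieSpan_le.2 (Set.singleton_subset_iff.2 self_mem_loweringSpan)
  exact eq_top_iff.2 fun w _ => hle (h.lieSpan_eq_top ▸ LieSubmodule.mem_top w)

theorem eq_top_of_lowering_lie_mem (h : IsHighestWeight τ ψ v top) {N : Submodule K M}
    (hv : v ∈ N) (hN : ∀ f ∈ τ.lowering, ∀ w ∈ N, ⁅f, w⁆ ∈ N) : N = ⊤ :=
  eq_top_iff.2 (h.loweringSpan_eq_top ▸ loweringSpan_le hv fun f hf w _ => hN f hf w)

theorem top_lie_eq_zero (h : IsHighestWeight τ ψ v top) {a : L}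
    (ha : a ∈ LieSubalgebra.lieSpan K L (τ.lowering : Set L)) (w : M) : top ⁅a, w⁆ = 0 := by
  have hzero : ⁅a, top⁆ = 0 := lie_eq_zero_of_mem_lieSpan (fun f hf => by
    ext w
    rw [Module.Dual.lie_apply, h.top_lowering_lie f hf, neg_zero, LinearMap.zero_apply]) ha
  simpa using LinearMap.congr_fun hzero w

theorem span_sup_iSup_eigenspace_eq_top (h : IsHighestWeight τ ψ v top) :
    (K ∙ v) ⊔ ⨆ n : ℕ, (LieModule.toEnd K L M (τ.cartan τ.deg)).eigenspace
      (ψ τ.deg - (n + 1)) = ⊤ := by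
  set D := LieModule.toEnd K L M (τ.cartan τ.deg)
  have hlower (f : L) (hf : f ∈ τ.lowering) (μ : K) (w : M) (hw : D w = μ • w) :
      D ⁅f, w⁆ = (μ - 1) • ⁅f, w⁆ := by
    rw [LieModule.toEnd_apply_apply] at hw ⊢
    rw [leibniz_lie, τ.deg_lie_lowering f hf, hw, neg_lie, lie_smul, sub_smul, one_smul,
      neg_add_eq_sub]
  refine h.eq_top_of_lowering_lie_mem
    (Submodule.mem_sup_left (Submodule.mem_span_singleton_self v)) fun f hf => ?_
  suffices (K ∙ v) ⊔ ⨆ n : ℕ, D.eigenspace (ψ τ.deg - (n + 1)) ≤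
      (⨆ n : ℕ, D.eigenspace (ψ τ.deg - (n + 1))).comap (LieModule.toEnd K L M f) from
    fun w hw => Submodule.mem_sup_right (this hw)
  refine sup_le ((Submodule.span_singleton_le_iff_mem _ _).2 ?_) (iSup_le fun n w hw => ?_)
  · refine Submodule.mem_iSup_of_mem 0 (Module.End.mem_eigenspace_iff.2 ?_)
    simpa using hlower f hf _ v (h.cartan_lie τ.deg)
  · refine Submodule.mem_iSup_of_mem (n + 1) (Module.End.mem_eigenspace_iff.2 ?_)
    have := hlower f hf _ w (Module.End.mem_eigenspace_iff.1 hw)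
    rwa [sub_sub, ← Nat.cast_succ] at this

theorem top_eq_zero_of_mem_eigenspace (h : IsHighestWeight τ ψ v top) {μ : K} (hμ : ψ τ.deg ≠ μ)
    {w : M} (hw : w ∈ (LieModule.toEnd K L M (τ.cartan τ.deg)).eigenspace μ) : top w = 0 := by
  have htop := h.top_cartan_lie τ.deg w
  rw [← LieModule.toEnd_apply_apply K, Module.End.mem_eigenspace_iff.1 hw, map_smul, smul_eq_mul]
    at htop
  exact (mul_eq_mul_right_iff.1 htop).resolve_left hμ.symm

section CharZero

variable [CharZero K]

open Polynomial in
theorem top_smul_mem (h : IsHighestWeight τ ψ v top) {N : LieSubmodule K L M} {w : M}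
    (hw : w ∈ N) : top w • v ∈ N := by
  set D := LieModule.toEnd K L M (τ.cartan τ.deg)
  have hne (n : ℕ) : ψ τ.deg ≠ ψ τ.deg - (n + 1) := fun hn =>
    Nat.cast_add_one_ne_zero n (sub_eq_self.1 hn.symm)
  obtain ⟨_, hcv, u, hu, rfl⟩ := Submodule.mem_sup.1
    (h.span_sup_iSup_eigenspace_eq_top ▸ Submodule.mem_top (x := w))
  obtain ⟨c, rfl⟩ := Submodule.mem_span_singleton.1 hcv
  have htop : top u = 0 := (iSup_le fun n w hw => h.top_eq_zero_of_mem_eigenspace (hne n) hw :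
    _ ≤ LinearMap.ker top) hu
  obtain ⟨q, hq, hqu⟩ := exists_aeval_eq_zero_of_mem_iSup_eigenspace hne hu
  have hqw : aeval D q (c • v + u) ∈ N :=
    aeval_apply_smul_mem_of_le_comap (q := N.toSubmodule) hw q D fun _ hm => N.lie_mem hm
  have hqv : aeval D q v = q.eval (ψ τ.deg) • v := by
    have hv : v ≠ 0 := fun hv => by simpa [hv] using h.top_self
    exact Module.End.aeval_apply_of_hasEigenvector
      ⟨Module.End.mem_eigenspace_iff.2 (h.cartan_lie τ.deg), hv⟩
  rw [map_add, hqu, add_zero, map_smul, hqv, smul_comm] at hqw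
  simpa [h.top_self, htop] using (N.toSubmodule.smul_mem_iff hq).1 hqw

theorem le_ker_top (h : IsHighestWeight τ ψ v top) {N : LieSubmodule K L M} (hN : N ≠ ⊤) :
    N.toSubmodule ≤ LinearMap.ker top := fun w hw => by
  by_contra hne
  have hv : v ∈ N := (N.toSubmodule.smul_mem_iff hne).1 (h.top_smul_mem hw)
  exact hN (eq_top_iff.2 (h.lieSpan_eq_top ▸
    LieSubmodule.lieSpan_le.2 (Set.singleton_subset_iff.2 hv)))

theorem isIrreducible (h : IsHighestWeight τ ψ v top) (hnd : IsNondegenerate L top) :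
    LieModule.IsIrreducible K L M := by
  have : Nontrivial M := ⟨v, 0, fun hv => by simpa [hv] using h.top_self⟩
  exact .mk fun N hN => by_contra fun hN' => hN (hnd N (h.le_ker_top hN'))

end CharZero

theorem lie_eq_zero_of_mem_ideal (h : IsHighestWeight τ ψ v top) (hnd : IsNondegenerate L top)
    {J : LieIdeal K L} (hJ : J.toSubmodule ≤
      (LieSubalgebra.lieSpan K L (τ.lowering : Set L)).toSubmodule ⊔
        (LinearMap.ker ψ).map τ.cartan ⊔
        (LieSubalgebra.lieSpan K L (τ.raising : Set L)).toSubmodule)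
    {x : L} (hx : x ∈ J) (w : M) : ⁅x, w⁆ = 0 := by
  have htop : ∀ j ∈ J, ∀ p, top ⁅j, p⁆ = 0 := by
    let P : Submodule K M := ⨅ j : J, LinearMap.ker (top ∘ₗ LieModule.toEnd K L M j)
    have hmem (p : M) : p ∈ P ↔ ∀ j ∈ J, top ⁅j, p⁆ = 0 := by simp [P]
    suffices P = ⊤ from fun j hj p => (hmem p).1 (this ▸ Submodule.mem_top) j hj
    refine h.eq_top_of_lowering_lie_mem ((hmem v).2 fun j hj => ?_)
      fun f hf p hp => (hmem _).2 fun j hj => ?_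
    · obtain ⟨_, hac, b, hb, rfl⟩ := Submodule.mem_sup.1 (hJ hj)
      obtain ⟨a, ha, _, ⟨y, hy, rfl⟩, rfl⟩ := Submodule.mem_sup.1 hac
      rw [add_lie, add_lie, map_add, map_add, h.top_lie_eq_zero ha, h.top_cartan_lie,
        LinearMap.mem_ker.1 hy, lie_eq_zero_of_mem_lieSpan h.raising_lie hb, map_zero, zero_mul,
        add_zero, add_zero]
    · rw [leibniz_lie, map_add, (hmem p).1 hp _ (lie_mem_left K L J j f hj),
        h.top_lowering_lie f hf, add_zero]
  have hbot : ⁅J, (⊤ : LieSubmodule K L M)⁆ = ⊥ := by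
    refine hnd _ ?_
    rw [LieSubmodule.lieIdeal_oper_eq_linear_span', Submodule.span_le]
    rintro _ ⟨j, hj, p, -, rfl⟩
    exact htop j hj p
  exact LieSubmodule.lie_eq_bot_iff .. |>.1 hbot x hx w (LieSubmodule.mem_top w)

theorem eq_bot_of_ideal_stable (h : IsHighestWeight τ ψ v top) (hnd : IsNondegenerate L top)
    {J : LieIdeal K L} (hJ : J.toSubmodule ⊔ LinearMap.range τ.cartan = ⊤) {N : Submodule K M}
    (hN : ∀ x ∈ J, ∀ w ∈ N, ⁅x, w⁆ ∈ N) (htop : N ≤ LinearMap.ker top) : N = ⊥ := by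
  let P : Submodule K M := sSup {Q | (∀ x ∈ J, Q ≤ Q.comap (LieModule.toEnd K L M x)) ∧
    Q ≤ LinearMap.ker top}
  have hPJ : ∀ x ∈ J, P ≤ P.comap (LieModule.toEnd K L M x) := fun x hx =>
    sSup_le fun Q hQ => (hQ.1 x hx).trans (Submodule.comap_mono (le_sSup hQ))
  have hPtop : P ≤ LinearMap.ker top := sSup_le fun Q hQ => hQ.2
  have hPcartan (y : 𝔥) : P ≤ P.comap (LieModule.toEnd K L M (τ.cartan y)) := by
    rw [← Submodule.map_le_iff_le_comap]
    refine le_sup_right.trans (le_sSup ⟨fun x hx => sup_le ?_ ?_, sup_le hPtop ?_⟩ :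
      P ⊔ P.map (LieModule.toEnd K L M (τ.cartan y)) ≤ P)
    · exact (hPJ x hx).trans (Submodule.comap_mono le_sup_left)
    · rintro _ ⟨p, hp, rfl⟩
      rw [Submodule.mem_comap, LieModule.toEnd_apply_apply, LieModule.toEnd_apply_apply,
        leibniz_lie]
      exact Submodule.add_mem_sup (hPJ _ (lie_mem_left K L J x _ hx) hp) ⟨_, hPJ x hx hp, rfl⟩
    · rintro _ ⟨p, hp, rfl⟩
      rw [LinearMap.mem_ker, LieModule.toEnd_apply_apply, h.top_cartan_lie,
        LinearMap.mem_ker.1 (hPtop hp), mul_zero]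
  have hP (x : L) {w : M} (hw : w ∈ P) : ⁅x, w⁆ ∈ P := by
    obtain ⟨j, hj, _, ⟨y, rfl⟩, rfl⟩ := Submodule.mem_sup.1 (hJ ▸ Submodule.mem_top (x := x))
    rw [add_lie]
    exact P.add_mem (hPJ j hj hw) (hPcartan y hw)
  have hbot : ({ P with lie_mem := hP _ } : LieSubmodule K L M) = ⊥ := hnd _ hPtop
  exact eq_bot_iff.2 ((le_sSup ⟨hN, htop⟩ : N ≤ P).trans
    (LieSubmodule.toSubmodule_eq_bot _ |>.2 hbot).le)

end IsHighestWeight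

end HighestWeight

/-! ### Tensor products of highest weight modules -/

section Contraction

variable {R κ : Type*} [CommSemiring R] [Fintype κ] {M : κ → Type*}
  [∀ k, AddCommMonoid (M k)] [∀ k, Module R (M k)]

/-- The product of functionals on the factors, as a functional on the tensor product. -/
def dualProd (φ : ∀ k, Module.Dual R (M k)) : Module.Dual R (⨂[R] k, M k) :=
  PiTensorProduct.dualDistrib (PiTensorProduct.tprod R φ)

theorem dualProd_tprod (φ : ∀ k, Module.Dual R (M k)) (w : ∀ k, M k) :
    dualProd φ (PiTensorProduct.tprod R w) = ∏ k, φ k (w k) :=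
  PiTensorProduct.dualDistrib_apply φ w

theorem eq_zero_of_forall_dualProd_eq_zero {K : Type*} [CommRing K] {M : κ → Type*}
    [∀ k, AddCommGroup (M k)] [∀ k, Module K (M k)] [∀ k, Module.Free K (M k)]
    {w : ⨂[K] k, M k} (h : ∀ φ : ∀ k, Module.Dual K (M k), dualProd φ w = 0) : w = 0 := by
  let b := fun k => Module.Free.chooseBasis K (M k)
  refine (Basis.piTensorProduct b).ext_elem fun p => ?_
  have hcoord : (Basis.piTensorProduct b).coord p = dualProd fun k => (b k).coord (p k) := by
    ext w
    simp only [LinearMap.compMultilinearMap_apply, dualProd_tprod, Module.Basis.coord_apply]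
    exact Basis.piTensorProduct_repr_tprod_apply b w p
  rw [map_zero, Finsupp.zero_apply, ← Module.Basis.coord_apply, hcoord, h]

variable [DecidableEq κ]

theorem exists_linearMap_prod_erase_smul (φ : ∀ k, Module.Dual R (M k)) (k i : κ)
    (w : ∀ k, M k) : ∃ g : M i →ₗ[R] M k, ∀ c,
      (∏ l ∈ Finset.univ.erase k, φ l (Function.update w i c l)) • Function.update w i c k =
        g c := by
  have hprod (s : Finset κ) (hs : i ∉ s) (c : M i) :
      ∏ l ∈ s, φ l (Function.update w i c l) = ∏ l ∈ s, φ l (w l) :=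
    Finset.prod_congr rfl fun l hl => by
      rw [Function.update_of_ne (ne_of_mem_of_not_mem hl hs)]
  obtain rfl | hik := eq_or_ne i k
  · refine ⟨(∏ l ∈ Finset.univ.erase i, φ l (w l)) • LinearMap.id, fun c => ?_⟩
    rw [hprod _ (Finset.notMem_erase i _), Function.update_self]
    rfl
  · refine ⟨(φ i).smulRight ((∏ l ∈ (Finset.univ.erase k).erase i, φ l (w l)) • w k),
      fun c => ?_⟩
    rw [← Finset.mul_prod_erase _ _ (Finset.mem_erase.2 ⟨hik, Finset.mem_univ i⟩),
      hprod _ (Finset.notMem_erase i _), Function.update_self, Function.update_of_ne hik.symm,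
      mul_smul]
    rfl

/-- Contraction of all factors but the `k`-th one with the functionals `φ`. -/
def contract (φ : ∀ k, Module.Dual R (M k)) (k : κ) : (⨂[R] k, M k) →ₗ[R] M k :=
  PiTensorProduct.lift <|
    MultilinearMap.mk' (fun w => (∏ l ∈ Finset.univ.erase k, φ l (w l)) • w k)
      (fun w i a b => by
        obtain ⟨g, hg⟩ := exists_linearMap_prod_erase_smul φ k i w
        rw [hg, hg, hg, map_add])
      (fun w i c a => by
        obtain ⟨g, hg⟩ := exists_linearMap_prod_erase_smul φ k i w
        rw [hg, hg, map_smul])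

theorem contract_tprod (φ : ∀ k, Module.Dual R (M k)) (k : κ) (w : ∀ k, M k) :
    contract φ k (PiTensorProduct.tprod R w) = (∏ l ∈ Finset.univ.erase k, φ l (w l)) • w k :=
  PiTensorProduct.lift.tprod w

theorem dualProd_eq_apply_contract (φ : ∀ k, Module.Dual R (M k)) (k : κ) (w : ⨂[R] k, M k) :
    dualProd φ w = φ k (contract φ k w) := by
  have heq : dualProd φ = φ k ∘ₗ contract φ k := by
    ext w
    simp only [LinearMap.compMultilinearMap_apply, LinearMap.comp_apply, contract_tprod,
      dualProd_tprod, map_smul, smul_eq_mul]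
    exact (Finset.prod_erase_mul _ _ (Finset.mem_univ k)).symm
  rw [heq, LinearMap.comp_apply]

theorem contract_congr {φ χ : ∀ k, Module.Dual R (M k)} {k : κ} (h : ∀ l, l ≠ k → φ l = χ l) :
    contract φ k = contract χ k := by
  ext w
  simp only [LinearMap.compMultilinearMap_apply, contract_tprod]
  congr 1
  exact Finset.prod_congr rfl fun l hl => by rw [h l (Finset.ne_of_mem_erase hl)]

end Contraction

section TensorHighestWeight

variable {κ L 𝔥 : Type*} [Fintype κ] [DecidableEq κ] [LieRing L] [LieAlgebra ℂ L]
  [AddCommGroup 𝔥] [Module ℂ 𝔥] {M : κ → Type*} [∀ k, AddCommGroup (M k)]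
  [∀ k, Module ℂ (M k)] [∀ k, LieRingModule L (M k)] [∀ k, LieModule ℂ L (M k)]

theorem tensor_lie_apply (x : L) (w : ⨂[ℂ] k, M k) : ⁅x, w⁆ = ∑ k, factorAct x k w :=
  LinearMap.sum_apply _ _ _

theorem contract_factorAct (φ : ∀ k, Module.Dual ℂ (M k)) (k : κ) (x : L) (w : ⨂[ℂ] k, M k) :
    contract φ k (factorAct x k w) = ⁅x, contract φ k w⁆ := by
  have heq : contract φ k ∘ₗ factorAct x k = LieModule.toEnd ℂ L (M k) x ∘ₗ contract φ k := by
    ext w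
    simp only [LinearMap.compMultilinearMap_apply, LinearMap.comp_apply, factorAct_tprod,
      contract_tprod, map_smul, Function.update_self, LieModule.toEnd_apply_apply]
    congr 1
    exact Finset.prod_congr rfl fun l hl => by
      rw [Function.update_of_ne (Finset.ne_of_mem_erase hl)]
  exact LinearMap.congr_fun heq w

theorem dualProd_factorAct (φ : ∀ k, Module.Dual ℂ (M k)) (k : κ) (x : L) (w : ⨂[ℂ] k, M k) :
    dualProd φ (factorAct x k w) = φ k ⁅x, contract φ k w⁆ := by
  rw [dualProd_eq_apply_contract φ k, contract_factorAct]

theorem lie_eq_factorAct {x x' : L} {k : κ} (hk : ∀ w : M k, ⁅x', w⁆ = ⁅x, w⁆)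
    (hl : ∀ l, l ≠ k → ∀ w : M l, ⁅x', w⁆ = 0) (w : ⨂[ℂ] k, M k) :
    ⁅x', w⁆ = factorAct x k w := by
  have hself : factorAct (M := M) x' k = factorAct x k := by
    ext w
    simp only [LinearMap.compMultilinearMap_apply, factorAct_tprod, hk]
  have hother (l : κ) (hlk : l ≠ k) : factorAct (M := M) x' l = 0 := by
    ext w
    simp only [LinearMap.compMultilinearMap_apply, factorAct_tprod, hl l hlk,
      LinearMap.zero_apply]
    exact MultilinearMap.map_coord_zero _ l (Function.update_self _ _ _)
  rw [tensor_lie_apply, Finset.sum_eq_single_of_mem k (Finset.mem_univ k) fun l _ hlk => by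
    rw [hother l hlk, LinearMap.zero_apply], hself]

variable (M) in
/-- Elements of the ideal `J` act on one module of the family `M` at a time: up to elements
acting by zero on the other modules, `J` acts on each of them separately. -/
def SeparatesFactors (J : LieIdeal ℂ L) : Prop :=
  ∀ k, ∀ x ∈ J, ∃ x' : L, (∀ w : M k, ⁅x', w⁆ = ⁅x, w⁆) ∧ ∀ l, l ≠ k → ∀ w : M l, ⁅x', w⁆ = 0

variable {τ : TriangularData ℂ L 𝔥} {ψ : κ → Module.Dual ℂ 𝔥} {v : ∀ k, M k}
  {top : ∀ k, Module.Dual ℂ (M k)} {J : LieIdeal ℂ L}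

theorem SeparatesFactors.factorAct_mem (hJ : SeparatesFactors M J)
    (N : LieSubmodule ℂ L (⨂[ℂ] k, M k)) {x : L} (hx : x ∈ J) (k : κ) {w : ⨂[ℂ] k, M k}
    (hw : w ∈ N) : factorAct x k w ∈ N := by
  obtain ⟨x', h₁, h₂⟩ := hJ k x hx
  rw [← lie_eq_factorAct h₁ h₂]
  exact N.lie_mem hw

omit [Fintype κ] in
theorem update_eq_of_forall_notMem_insert {α : κ → Type*} {S : Finset κ} {k : κ}
    {w v : ∀ k, α k} (hw : ∀ l, l ∉ insert k S → w l = v l) :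
    ∀ l, l ∉ S → Function.update w k (v k) l = v l := by
  intro l hl
  obtain rfl | hlk := eq_or_ne l k
  · exact Function.update_self _ _ _
  · rw [Function.update_of_ne hlk]
    exact hw l (by simp [hlk, hl])

theorem tprod_mem_of_tprod_mem (h : ∀ k, IsHighestWeight τ (ψ k) (v k) (top k))
    (hlow : ∀ f ∈ τ.lowering, f ∈ J) (hJ : SeparatesFactors M J)
    {N : LieSubmodule ℂ L (⨂[ℂ] k, M k)} (hv : PiTensorProduct.tprod ℂ v ∈ N) (S : Finset κ) :
    ∀ w : ∀ k, M k, (∀ k, k ∉ S → w k = v k) → PiTensorProduct.tprod ℂ w ∈ N := by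
  induction S using Finset.induction_on with
  | empty =>
    intro w hw
    rwa [show w = v from funext fun k => hw k (Finset.notMem_empty k)]
  | insert k S _ ih =>
    intro w hw
    have htop : N.toSubmodule.comap ((PiTensorProduct.tprod ℂ).toLinearMap w k) = ⊤ := by
      refine (h k).eq_top_of_lowering_lie_mem (ih _ (update_eq_of_forall_notMem_insert hw))
        fun f hf m hm => ?_
      have hmem := hJ.factorAct_mem N (hlow f hf) k
        (show PiTensorProduct.tprod ℂ (Function.update w k m) ∈ N from hm)
      rwa [factorAct_tprod, Function.update_self, Function.update_idem] at hmem
    have hm : w k ∈ N.toSubmodule.comap ((PiTensorProduct.tprod ℂ).toLinearMap w k) :=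
      htop ▸ Submodule.mem_top
    rwa [Submodule.mem_comap, MultilinearMap.toLinearMap_apply, Function.update_eq_self] at hm

theorem isHighestWeight_tensor (h : ∀ k, IsHighestWeight τ (ψ k) (v k) (top k))
    (hlow : ∀ f ∈ τ.lowering, f ∈ J) (hJ : SeparatesFactors M J) :
    IsHighestWeight τ (∑ k, ψ k) (PiTensorProduct.tprod ℂ v) (dualProd top) where
  top_self := by
    rw [dualProd_tprod]
    exact Finset.prod_eq_one fun k _ => (h k).top_self
  raising_lie e he := by
    rw [tensor_lie_apply]
    refine Finset.sum_eq_zero fun k _ => ?_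
    rw [factorAct_tprod]
    refine MultilinearMap.map_coord_zero _ k ?_
    rw [Function.update_self, (h k).raising_lie e he]
  cartan_lie y := by
    rw [tensor_lie_apply, LinearMap.sum_apply, Finset.sum_smul]
    refine Finset.sum_congr rfl fun k _ => ?_
    rw [factorAct_tprod, (h k).cartan_lie, MultilinearMap.map_update_smul,
      Function.update_eq_self]
  top_lowering_lie f hf w := by
    rw [tensor_lie_apply, map_sum]
    refine Finset.sum_eq_zero fun k _ => ?_
    rw [dualProd_factorAct, (h k).top_lowering_lie f hf]
  top_cartan_lie y w := by
    rw [tensor_lie_apply, map_sum, LinearMap.sum_apply, Finset.sum_mul]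
    refine Finset.sum_congr rfl fun k _ => ?_
    rw [dualProd_factorAct, dualProd_eq_apply_contract top k, (h k).top_cartan_lie]
  lieSpan_eq_top := by
    rw [← LieSubmodule.toSubmodule_eq_top, eq_top_iff, ← PiTensorProduct.span_tprod_eq_top,
      Submodule.span_le]
    rintro _ ⟨w, rfl⟩
    exact tprod_mem_of_tprod_mem h hlow hJ
      (LieSubmodule.subset_lieSpan (Set.mem_singleton _)) Finset.univ w
      fun k hk => absurd (Finset.mem_univ k) hk

theorem dualProd_eq_zero_of_le_ker (h : ∀ k, IsHighestWeight τ (ψ k) (v k) (top k))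
    (hnd : ∀ k, IsNondegenerate L (top k))
    (hsup : J.toSubmodule ⊔ LinearMap.range τ.cartan = ⊤) (hJ : SeparatesFactors M J)
    {N : LieSubmodule ℂ L (⨂[ℂ] k, M k)} (hN : N.toSubmodule ≤ LinearMap.ker (dualProd top))
    (S : Finset κ) : ∀ φ : ∀ k, Module.Dual ℂ (M k), (∀ k, k ∉ S → φ k = top k) →
      ∀ w ∈ N, dualProd φ w = 0 := by
  induction S using Finset.induction_on with
  | empty =>
    intro φ hφ w hw
    rw [show φ = top from funext fun k => hφ k (Finset.notMem_empty k)]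
    exact hN hw
  | insert k S _ ih =>
    intro φ hφ w hw
    have hbot : N.toSubmodule.map (contract φ k) = ⊥ := by
      refine (h k).eq_bot_of_ideal_stable (hnd k) hsup ?_ ?_
      · rintro x hx _ ⟨w, hw, rfl⟩
        exact ⟨_, hJ.factorAct_mem N hx k hw, contract_factorAct φ k x w⟩
      · rintro _ ⟨w, hw, rfl⟩
        have hzero := ih _ (update_eq_of_forall_notMem_insert hφ) w hw
        rwa [dualProd_eq_apply_contract _ k, Function.update_self,
          contract_congr (χ := φ) fun l hl => Function.update_of_ne hl _ _] at hzero
    have hmem : contract φ k w ∈ N.toSubmodule.map (contract φ k) := ⟨w, hw, rfl⟩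
    rw [hbot, Submodule.mem_bot] at hmem
    rw [dualProd_eq_apply_contract φ k, hmem, map_zero]

theorem isNondegenerate_tensor (h : ∀ k, IsHighestWeight τ (ψ k) (v k) (top k))
    (hnd : ∀ k, IsNondegenerate L (top k))
    (hsup : J.toSubmodule ⊔ LinearMap.range τ.cartan = ⊤) (hJ : SeparatesFactors M J) :
    IsNondegenerate L (dualProd top) := fun _ hN =>
  (LieSubmodule.eq_bot_iff _).2 fun w hw => eq_zero_of_forall_dualProd_eq_zero fun φ =>
    dualProd_eq_zero_of_le_ker h hnd hsup hJ hN Finset.univ φ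
      (fun k hk => absurd (Finset.mem_univ k) hk) w hw

end TensorHighestWeight

/-! ### Existence of highest weight modules -/

section Triangular

variable {R L : Type*} [CommRing R] [LieRing L] [LieAlgebra R L]

theorem lie_mem_of_mem_span {S T : Set L} {N : Submodule R L} (h : ∀ x ∈ S, ∀ y ∈ T, ⁅x, y⁆ ∈ N)
    {x y : L} (hx : x ∈ Submodule.span R S) (hy : y ∈ Submodule.span R T) : ⁅x, y⁆ ∈ N :=
  LinearMap.BilinMap.apply_apply_mem_of_mem_span _ _ _
    (LieAlgebra.ad R L : L →ₗ[R] Module.End R L) h x y hx hy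

theorem lie_mem_lieSpan {S : Set L} {x : L}
    (h : ∀ s ∈ S, ⁅x, s⁆ ∈ LieSubalgebra.lieSpan R L S) {y : L}
    (hy : y ∈ LieSubalgebra.lieSpan R L S) : ⁅x, y⁆ ∈ LieSubalgebra.lieSpan R L S := by
  induction hy using LieSubalgebra.lieSpan_induction with
  | mem s hs => exact h s hs
  | zero => rw [lie_zero]; exact zero_mem _
  | add a b _ _ ha hb => rw [lie_add]; exact add_mem ha hb
  | smul c a _ ha => rw [lie_smul]; exact LieSubalgebra.smul_mem _ c ha
  | lie a b ha hb iha ihb =>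
    rw [leibniz_lie]
    exact add_mem (LieSubalgebra.lie_mem _ iha hb) (LieSubalgebra.lie_mem _ ha ihb)

variable (R L) in
/-- Generating subspaces of the negative part, the Cartan subalgebra and the positive part whose
brackets obey the rules of a triangular decomposition. Unlike in `TriangularData`, they need not
generate the whole Lie algebra. -/
structure IsTriangular (F H E : Submodule R L) : Prop where
  cartan_lie_cartan : ∀ x ∈ H, ∀ y ∈ H, ⁅x, y⁆ ∈ H
  cartan_lie_neg : ∀ x ∈ H, ∀ f ∈ F, ⁅x, f⁆ ∈ F
  cartan_lie_pos : ∀ x ∈ H, ∀ e ∈ E, ⁅x, e⁆ ∈ E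
  pos_lie_neg : ∀ e ∈ E, ∀ f ∈ F, ⁅e, f⁆ ∈ H

namespace IsTriangular

variable {F H E : Submodule R L}

theorem symm (h : IsTriangular R L F H E) : IsTriangular R L E H F where
  cartan_lie_cartan := h.cartan_lie_cartan
  cartan_lie_neg := h.cartan_lie_pos
  cartan_lie_pos := h.cartan_lie_neg
  pos_lie_neg f hf e he := by rw [← lie_skew]; exact H.neg_mem (h.pos_lie_neg e he f hf)

theorem cartan_lie_mem_lieSpan (h : IsTriangular R L F H E) {x y : L} (hx : x ∈ H)
    (hy : y ∈ LieSubalgebra.lieSpan R L (F : Set L)) :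
    ⁅x, y⁆ ∈ LieSubalgebra.lieSpan R L (F : Set L) :=
  lie_mem_lieSpan (fun f hf => LieSubalgebra.subset_lieSpan (h.cartan_lie_neg x hx f hf)) hy

theorem pos_lie_mem_lieSpan_sup (h : IsTriangular R L F H E) {e y : L} (he : e ∈ E)
    (hy : y ∈ LieSubalgebra.lieSpan R L (F : Set L)) :
    ⁅e, y⁆ ∈ (LieSubalgebra.lieSpan R L (F : Set L)).toSubmodule ⊔ H := by
  have hstab : ∀ z ∈ (LieSubalgebra.lieSpan R L (F : Set L)).toSubmodule ⊔ H,
      ∀ b ∈ LieSubalgebra.lieSpan R L (F : Set L),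
      ⁅z, b⁆ ∈ LieSubalgebra.lieSpan R L (F : Set L) := by
    intro z hz b hb
    obtain ⟨a, ha, x, hx, rfl⟩ := Submodule.mem_sup.1 hz
    rw [add_lie]
    exact add_mem (LieSubalgebra.lie_mem _ ha hb) (h.cartan_lie_mem_lieSpan hx hb)
  induction hy using LieSubalgebra.lieSpan_induction with
  | mem f hf => exact Submodule.mem_sup_right (h.pos_lie_neg e he f hf)
  | zero => rw [lie_zero]; exact zero_mem _
  | add a b _ _ ha hb => rw [lie_add]; exact add_mem ha hb
  | smul c a _ ha => rw [lie_smul]; exact Submodule.smul_mem _ c ha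
  | lie a b ha hb iha ihb =>
    rw [leibniz_lie, ← lie_skew a]
    exact Submodule.mem_sup_left (add_mem (hstab _ iha b hb) (neg_mem (hstab _ ihb a ha)))

theorem neg_lie_mem (h : IsTriangular R L F H E) {f : L} (hf : f ∈ F) {y : L}
    (hy : y ∈ (LieSubalgebra.lieSpan R L (F : Set L)).toSubmodule ⊔ H ⊔
      (LieSubalgebra.lieSpan R L (E : Set L)).toSubmodule) :
    ⁅f, y⁆ ∈ (LieSubalgebra.lieSpan R L (F : Set L)).toSubmodule ⊔ H ⊔
      (LieSubalgebra.lieSpan R L (E : Set L)).toSubmodule := by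
  obtain ⟨z, hz, b, hb, rfl⟩ := Submodule.mem_sup.1 hy
  obtain ⟨a, ha, x, hx, rfl⟩ := Submodule.mem_sup.1 hz
  rw [lie_add, lie_add]
  refine add_mem (Submodule.mem_sup_left (Submodule.mem_sup_left (add_mem ?_ ?_))) ?_
  · exact LieSubalgebra.lie_mem _ (LieSubalgebra.subset_lieSpan hf) ha
  · rw [← lie_skew]
    exact neg_mem (LieSubalgebra.subset_lieSpan (h.cartan_lie_neg x hx f hf))
  · rw [sup_assoc, sup_comm H]
    exact Submodule.mem_sup_right (h.symm.pos_lie_mem_lieSpan_sup hf hb)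

theorem lieSpan_le (h : IsTriangular R L F H E) :
    (LieSubalgebra.lieSpan R L (F ∪ H ∪ E : Set L)).toSubmodule ≤
      (LieSubalgebra.lieSpan R L (F : Set L)).toSubmodule ⊔ H ⊔
        (LieSubalgebra.lieSpan R L (E : Set L)).toSubmodule := by
  set T := (LieSubalgebra.lieSpan R L (F : Set L)).toSubmodule ⊔ H ⊔
    (LieSubalgebra.lieSpan R L (E : Set L)).toSubmodule with hT
  have hFT : (LieSubalgebra.lieSpan R L (F : Set L)).toSubmodule ≤ T :=
    le_sup_left.trans le_sup_left
  have hHT : H ≤ T := le_sup_right.trans le_sup_left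
  have hET : (LieSubalgebra.lieSpan R L (E : Set L)).toSubmodule ≤ T := le_sup_right
  have hT' : T = (LieSubalgebra.lieSpan R L (E : Set L)).toSubmodule ⊔ H ⊔
      (LieSubalgebra.lieSpan R L (F : Set L)).toSubmodule := by
    rw [hT, sup_comm, ← sup_assoc, sup_right_comm]
  have hstab : ∀ s ∈ (F ∪ H ∪ E : Set L), ∀ y ∈ T, ⁅s, y⁆ ∈ T := by
    rintro s ((hs | hs) | hs) y hy
    · exact h.neg_lie_mem hs hy
    · obtain ⟨z, hz, b, hb, rfl⟩ := Submodule.mem_sup.1 hy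
      obtain ⟨a, ha, x, hx, rfl⟩ := Submodule.mem_sup.1 hz
      rw [lie_add, lie_add]
      exact add_mem (add_mem (hFT (h.cartan_lie_mem_lieSpan hs ha))
        (hHT (h.cartan_lie_cartan s hs x hx))) (hET (h.symm.cartan_lie_mem_lieSpan hs hb))
    · exact hT' ▸ h.symm.neg_lie_mem hs (hT' ▸ hy)
  have hmem : (F ∪ H ∪ E : Set L) ⊆ T := Set.union_subset (Set.union_subset
    (fun x hx => hFT (LieSubalgebra.subset_lieSpan hx)) hHT)
    fun x hx => hET (LieSubalgebra.subset_lieSpan hx)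
  intro x (hx : x ∈ LieSubalgebra.lieSpan R L (F ∪ H ∪ E : Set L))
  induction hx using LieSubalgebra.lieSpan_induction with
  | mem s hs => exact hmem hs
  | zero => exact T.zero_mem
  | add a b _ _ ha hb => exact T.add_mem ha hb
  | smul c a _ ha => exact T.smul_mem c ha
  | lie a b ha _ _ hb => exact lie_mem_of_mem_lieSpan hstab ha b hb

end IsTriangular

end Triangular

section Existence

attribute [local instance] LieRing.ofAssociativeRing

theorem exists_lieHom_of_surjective {R S L L₂ : Type*} [CommRing R] [LieRing S] [LieAlgebra R S]
    [LieRing L] [LieAlgebra R L] [LieRing L₂] [LieAlgebra R L₂] (φ : S →ₗ⁅R⁆ L)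
    (hφ : Function.Surjective φ) (ρ : S →ₗ⁅R⁆ L₂) (h : ∀ s, φ s = 0 → ρ s = 0) :
    ∃ σ : L →ₗ⁅R⁆ L₂, ∀ s, σ (φ s) = ρ s := by
  have hρ (s t : S) (hst : φ s = φ t) : ρ s = ρ t := by
    rw [← sub_eq_zero, ← map_sub]
    exact h _ (by rw [map_sub, hst, sub_self])
  have hinv := Function.surjInv_eq hφ
  refine ⟨{ toFun x := ρ (Function.surjInv hφ x), map_add' x y := ?_, map_smul' c x := ?_,
            map_lie' {x y} := ?_ }, fun s => hρ _ _ (hinv _)⟩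
  · rw [← map_add]
    exact hρ _ _ (by rw [map_add, hinv, hinv, hinv])
  · rw [← map_smul]
    exact hρ _ _ (by rw [map_smul, hinv, hinv]; rfl)
  · rw [← LieHom.map_lie]
    exact hρ _ _ (by rw [LieHom.map_lie, hinv, hinv, hinv])

variable {K L 𝔥 : Type*} [Field K] [LieRing L] [LieAlgebra K L] [AddCommGroup 𝔥] [Module K 𝔥]

/-- The span of the eigenvectors of `ad D` whose eigenvalues are positive integers. -/
def positivePart (D : L) : LieSubalgebra K L where
  toSubmodule := Submodule.span K {x | ∃ j : ℕ, ⁅D, x⁆ = ((j : K) + 1) • x}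
  lie_mem' {x y} hx hy := by
    refine lie_mem_of_mem_span ?_ hx hy
    rintro x ⟨j, hj⟩ y ⟨i, hi⟩
    refine Submodule.subset_span ⟨j + i + 1, ?_⟩
    rw [leibniz_lie, hj, hi, smul_lie, lie_smul, ← add_smul]
    push_cast
    ring_nf

theorem mem_positivePart {D x : L} (h : ⁅D, x⁆ = x) : x ∈ positivePart (K := K) D :=
  Submodule.subset_span ⟨0, by rw [h, Nat.cast_zero, zero_add, one_smul]⟩

theorem mem_iSup_eigenspace_of_mem_positivePart [CharZero K] {D E x : L} {c : K} (hc : c ≠ 0)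
    (hE : D = c • E) (hx : x ∈ positivePart (K := K) E) :
    x ∈ ⨆ μ, ⨆ (_ : μ ≠ 0), Module.End.eigenspace (LieAlgebra.ad K L D) μ := by
  refine Submodule.span_le.2 ?_ hx
  rintro x ⟨j, hj⟩
  refine Submodule.mem_iSup_of_mem (c * (j + 1)) (Submodule.mem_iSup_of_mem
    (mul_ne_zero hc j.cast_add_one_ne_zero) (Module.End.mem_eigenspace_iff.2 ?_))
  rw [LieAlgebra.ad_apply, hE, smul_lie, hj, smul_smul]

namespace TriangularData

variable (τ : TriangularData K L 𝔥)

variable {τ} in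
theorem cartan_eq_zero_of_add_eq_zero [CharZero K] {a b : L} {y : 𝔥}
    (ha : a ∈ LieSubalgebra.lieSpan K L (τ.lowering : Set L))
    (hb : b ∈ LieSubalgebra.lieSpan K L (τ.raising : Set L)) (h : a + τ.cartan y + b = 0) :
    τ.cartan y = 0 := by
  have ha' : a ∈ positivePart (K := K) (-τ.cartan τ.deg) :=
    LieSubalgebra.lieSpan_le.2 (fun f hf => mem_positivePart (by
      rw [neg_lie, τ.deg_lie_lowering f hf, neg_neg])) ha
  have hb' : b ∈ positivePart (K := K) (τ.cartan τ.deg) :=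
    LieSubalgebra.lieSpan_le.2 (fun e he => mem_positivePart (τ.deg_lie_raising e he)) hb
  have hind := Module.End.eigenspaces_iSupIndep (LieAlgebra.ad K L (τ.cartan τ.deg)) 0
  refine Submodule.disjoint_def.1 hind _ ?_ ?_
  · rw [Module.End.mem_eigenspace_iff, LieAlgebra.ad_apply, τ.cartan_lie_cartan, zero_smul]
  · have hy : τ.cartan y = -(a + b) := by rw [eq_neg_iff_add_eq_zero, ← h]; abel
    rw [hy]
    exact neg_mem (add_mem
      (mem_iSup_eigenspace_of_mem_positivePart (neg_ne_zero.2 one_ne_zero) (by simp) ha')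
      (mem_iSup_eigenspace_of_mem_positivePart one_ne_zero (one_smul K _).symm hb'))

/-- The free module on the words in a basis of the space of lowering generators: the underlying
space of the tensor algebra of `τ.lowering`, in a form that allows recursion on words. -/
abbrev Words := List (Module.Basis.ofVectorSpaceIndex K τ.lowering) →₀ K

/-- The basis of the space of lowering generators that serves as the alphabet of `τ.Words`. -/
abbrev letter : Module.Basis (Module.Basis.ofVectorSpaceIndex K τ.lowering) K τ.lowering :=
  Module.Basis.ofVectorSpace K τ.lowering

/-- The empty word, which will be the highest weight vector. -/
def emptyWord : τ.Words := Finsupp.single [] 1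

/-- The coefficient of the empty word. -/
def wordTop : Module.Dual K τ.Words := Finsupp.lapply []

/-- The action of the lowering generators on words, by multiplication from the left. -/
def lowerOp : τ.lowering →ₗ[K] Module.End K τ.Words :=
  τ.letter.constr K fun i => Finsupp.lmapDomain K K (List.cons i)

/-- The bracket of the Cartan subalgebra with the lowering generators. -/
def cartanLower : 𝔥 →ₗ[K] τ.lowering →ₗ[K] τ.lowering :=
  LinearMap.mk₂ K (fun y f => ⟨⁅τ.cartan y, (f : L)⁆, τ.cartan_lie_lowering y f f.2⟩)
    (fun _ _ _ => Subtype.ext (by simp)) (fun _ _ _ => Subtype.ext (by simp))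
    (fun _ _ _ => Subtype.ext (by simp)) (fun _ _ _ => Subtype.ext (by simp))

/-- The bracket of the Cartan subalgebra with the raising generators. -/
def cartanRaise : 𝔥 →ₗ[K] τ.raising →ₗ[K] τ.raising :=
  LinearMap.mk₂ K (fun y e => ⟨⁅τ.cartan y, (e : L)⁆, τ.cartan_lie_raising y e e.2⟩)
    (fun _ _ _ => Subtype.ext (by simp)) (fun _ _ _ => Subtype.ext (by simp))
    (fun _ _ _ => Subtype.ext (by simp)) (fun _ _ _ => Subtype.ext (by simp))

/-- The bracket of the raising with the lowering generators, as an element of `𝔥`. -/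
def raiseLower : τ.raising →ₗ[K] τ.lowering →ₗ[K] 𝔥 :=
  LinearMap.mk₂ K (fun e f => (LinearEquiv.ofInjective τ.cartan τ.cartan_injective).symm
      ⟨⁅(e : L), (f : L)⁆, τ.raising_lie_lowering e e.2 f f.2⟩)
    (fun _ _ _ => by rw [← map_add]; congr 1; exact Subtype.ext (by simp))
    (fun _ _ _ => by rw [← map_smul]; congr 1; exact Subtype.ext (by simp))
    (fun _ _ _ => by rw [← map_add]; congr 1; exact Subtype.ext (by simp))
    (fun _ _ _ => by rw [← map_smul]; congr 1; exact Subtype.ext (by simp))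

theorem cartan_raiseLower (e : τ.raising) (f : τ.lowering) :
    τ.cartan (τ.raiseLower e f) = ⁅(e : L), (f : L)⁆ :=
  congrArg Subtype.val
    ((LinearEquiv.ofInjective τ.cartan τ.cartan_injective).apply_symm_apply _)

theorem cartanLower_comm (y z : 𝔥) (f : τ.lowering) :
    τ.cartanLower y (τ.cartanLower z f) = τ.cartanLower z (τ.cartanLower y f) := by
  refine Subtype.ext ?_
  change ⁅τ.cartan y, ⁅τ.cartan z, (f : L)⁆⁆ = ⁅τ.cartan z, ⁅τ.cartan y, (f : L)⁆⁆
  rw [leibniz_lie, τ.cartan_lie_cartan, zero_lie, zero_add]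

theorem raiseLower_cartanRaise (y : 𝔥) (e : τ.raising) (f : τ.lowering) :
    τ.raiseLower (τ.cartanRaise y e) f = -τ.raiseLower e (τ.cartanLower y f) := by
  refine τ.cartan_injective ?_
  rw [map_neg, cartan_raiseLower, cartan_raiseLower]
  change ⁅⁅τ.cartan y, (e : L)⁆, (f : L)⁆ = -⁅(e : L), ⁅τ.cartan y, (f : L)⁆⁆
  rw [lie_lie, ← τ.cartan_raiseLower, τ.cartan_lie_cartan, zero_sub]

theorem lowerOp_letter_single (i) (w) :
    τ.lowerOp (τ.letter i) (Finsupp.single w 1) = Finsupp.single (i :: w) 1 := by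
  rw [lowerOp, Module.Basis.constr_basis, Finsupp.lmapDomain_apply, Finsupp.mapDomain_single]

theorem eq_top_of_lowerOp_mem {N : Submodule K τ.Words} (h₀ : τ.emptyWord ∈ N)
    (h : ∀ f, ∀ t ∈ N, τ.lowerOp f t ∈ N) : N = ⊤ := by
  refine eq_top_iff.2 (Finsupp.basisSingleOne.span_eq.ge.trans (Submodule.span_le.2 ?_))
  rintro _ ⟨w, rfl⟩
  rw [Finsupp.coe_basisSingleOne]
  change Finsupp.single w 1 ∈ N
  induction w with
  | nil => exact h₀
  | cons i w ih => rw [← lowerOp_letter_single]; exact h _ _ ih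

theorem words_hom_ext {N : Type*} [AddCommGroup N] [Module K N] {φ χ : τ.Words →ₗ[K] N}
    (h₀ : φ τ.emptyWord = χ τ.emptyWord)
    (h : ∀ f t, φ t = χ t → φ (τ.lowerOp f t) = χ (τ.lowerOp f t)) : φ = χ :=
  LinearMap.eqLocus_eq_top.1 (τ.eq_top_of_lowerOp_mem (N := LinearMap.eqLocus φ χ) h₀ h)

theorem words_hom_ext₂ {N : Type*} [AddCommGroup N] [Module K N]
    {φ χ : τ.lowering →ₗ[K] τ.Words →ₗ[K] N}
    (h : ∀ i w, φ (τ.letter i) (Finsupp.single w 1) = χ (τ.letter i) (Finsupp.single w 1)) :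
    φ = χ :=
  τ.letter.ext fun i => Finsupp.lhom_ext' fun w => LinearMap.ext_ring (h i w)

theorem wordTop_emptyWord : τ.wordTop τ.emptyWord = 1 := Finsupp.single_eq_same

theorem wordTop_lowerOp (f : τ.lowering) (t : τ.Words) : τ.wordTop (τ.lowerOp f t) = 0 := by
  have : τ.lowerOp.compr₂ τ.wordTop = 0 := τ.words_hom_ext₂ fun i w => by
    rw [LinearMap.compr₂_apply, lowerOp_letter_single]
    exact Finsupp.single_eq_of_ne (List.cons_ne_nil i w).symm
  exact LinearMap.congr_fun₂ this f t

variable (ψ : Module.Dual K 𝔥)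

/-- The action of the Cartan subalgebra on a word: by `ψ` on the empty word, extended by
`y • f w = [y, f] w + f (y • w)`. -/
def cartanWord : List (Module.Basis.ofVectorSpaceIndex K τ.lowering) → 𝔥 →ₗ[K] τ.Words
  | [] => ψ.smulRight τ.emptyWord
  | i :: w => τ.lowerOp (τ.letter i) ∘ₗ cartanWord w +
      LinearMap.applyₗ (Finsupp.single w 1) ∘ₗ τ.lowerOp ∘ₗ τ.cartanLower.flip (τ.letter i)

/-- The action of the Cartan subalgebra on `τ.Words`. -/
def cartanOp : 𝔥 →ₗ[K] Module.End K τ.Words :=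
  (Finsupp.linearCombination K (τ.cartanWord ψ)).flip

/-- The action of the raising generators on a word: zero on the empty word, extended by
`e • f w = [e, f] • w + f (e • w)`. -/
def raiseWord : List (Module.Basis.ofVectorSpaceIndex K τ.lowering) → τ.raising →ₗ[K] τ.Words
  | [] => 0
  | i :: w => τ.lowerOp (τ.letter i) ∘ₗ raiseWord w +
      LinearMap.applyₗ (Finsupp.single w 1) ∘ₗ τ.cartanOp ψ ∘ₗ τ.raiseLower.flip (τ.letter i)

/-- The action of the raising generators on `τ.Words`. -/
def raiseOp : τ.raising →ₗ[K] Module.End K τ.Words :=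
  (Finsupp.linearCombination K (τ.raiseWord ψ)).flip

theorem cartanOp_single (y : 𝔥) (w) :
    τ.cartanOp ψ y (Finsupp.single w 1) = τ.cartanWord ψ w y := by
  rw [cartanOp, LinearMap.flip_apply, Finsupp.linearCombination_single, one_smul]

theorem raiseOp_single (e : τ.raising) (w) :
    τ.raiseOp ψ e (Finsupp.single w 1) = τ.raiseWord ψ w e := by
  rw [raiseOp, LinearMap.flip_apply, Finsupp.linearCombination_single, one_smul]

theorem cartanOp_emptyWord (y : 𝔥) : τ.cartanOp ψ y τ.emptyWord = ψ y • τ.emptyWord :=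
  τ.cartanOp_single ψ y []

theorem raiseOp_emptyWord (e : τ.raising) : τ.raiseOp ψ e τ.emptyWord = 0 :=
  τ.raiseOp_single ψ e []

theorem cartanOp_lowerOp (y : 𝔥) (f : τ.lowering) (t : τ.Words) :
    τ.cartanOp ψ y (τ.lowerOp f t) =
      τ.lowerOp f (τ.cartanOp ψ y t) + τ.lowerOp (τ.cartanLower y f) t := by
  have : τ.lowerOp.compr₂ (τ.cartanOp ψ y) =
      τ.lowerOp.compl₂ (τ.cartanOp ψ y) + τ.lowerOp ∘ₗ τ.cartanLower y :=
    τ.words_hom_ext₂ fun i w => by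
      rw [LinearMap.compr₂_apply, lowerOp_letter_single, cartanOp_single, LinearMap.add_apply,
        LinearMap.add_apply, LinearMap.compl₂_apply, cartanOp_single]
      rfl
  exact LinearMap.congr_fun₂ this f t

theorem raiseOp_lowerOp (e : τ.raising) (f : τ.lowering) (t : τ.Words) :
    τ.raiseOp ψ e (τ.lowerOp f t) =
      τ.lowerOp f (τ.raiseOp ψ e t) + τ.cartanOp ψ (τ.raiseLower e f) t := by
  have : τ.lowerOp.compr₂ (τ.raiseOp ψ e) =
      τ.lowerOp.compl₂ (τ.raiseOp ψ e) + τ.cartanOp ψ ∘ₗ τ.raiseLower e :=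
    τ.words_hom_ext₂ fun i w => by
      rw [LinearMap.compr₂_apply, lowerOp_letter_single, raiseOp_single, LinearMap.add_apply,
        LinearMap.add_apply, LinearMap.compl₂_apply, raiseOp_single]
      rfl
  exact LinearMap.congr_fun₂ this f t

theorem cartanOp_cartanOp (y z : 𝔥) (t : τ.Words) :
    τ.cartanOp ψ y (τ.cartanOp ψ z t) = τ.cartanOp ψ z (τ.cartanOp ψ y t) := by
  have : τ.cartanOp ψ y ∘ₗ τ.cartanOp ψ z = τ.cartanOp ψ z ∘ₗ τ.cartanOp ψ y := by
    refine τ.words_hom_ext ?_ fun f t ih => ?_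
    · simp only [LinearMap.comp_apply, cartanOp_emptyWord, map_smul]
      exact smul_comm _ _ _
    · simp only [LinearMap.comp_apply] at ih ⊢
      simp only [cartanOp_lowerOp, map_add, ih, τ.cartanLower_comm y z]
      abel
  exact LinearMap.congr_fun this t

theorem cartanOp_raiseOp (y : 𝔥) (e : τ.raising) (t : τ.Words) :
    τ.cartanOp ψ y (τ.raiseOp ψ e t) =
      τ.raiseOp ψ e (τ.cartanOp ψ y t) + τ.raiseOp ψ (τ.cartanRaise y e) t := by
  have : τ.cartanOp ψ y ∘ₗ τ.raiseOp ψ e =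
      τ.raiseOp ψ e ∘ₗ τ.cartanOp ψ y + τ.raiseOp ψ (τ.cartanRaise y e) := by
    refine τ.words_hom_ext ?_ fun f t ih => ?_
    · simp only [LinearMap.comp_apply, LinearMap.add_apply, cartanOp_emptyWord, raiseOp_emptyWord,
        map_smul, map_zero, smul_zero, add_zero]
    · simp only [LinearMap.comp_apply, LinearMap.add_apply] at ih ⊢
      simp only [cartanOp_lowerOp, raiseOp_lowerOp, map_add, ih, raiseLower_cartanRaise, map_neg,
        LinearMap.neg_apply, τ.cartanOp_cartanOp ψ y]
      abel
  exact LinearMap.congr_fun this t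

theorem wordTop_cartanOp (y : 𝔥) (t : τ.Words) :
    τ.wordTop (τ.cartanOp ψ y t) = ψ y * τ.wordTop t := by
  have : τ.wordTop ∘ₗ τ.cartanOp ψ y = ψ y • τ.wordTop := by
    refine τ.words_hom_ext ?_ fun f _ _ => ?_
    · rw [LinearMap.comp_apply, cartanOp_emptyWord, map_smul]; rfl
    · rw [LinearMap.comp_apply, cartanOp_lowerOp, map_add, wordTop_lowerOp, wordTop_lowerOp,
        LinearMap.smul_apply, wordTop_lowerOp, smul_zero, add_zero]
  exact LinearMap.congr_fun this t

/-- The lowering generators, paired with their action on words. -/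
def wordLowering : Submodule K (L × Module.End K τ.Words) :=
  LinearMap.range (τ.lowering.subtype.prod τ.lowerOp)

/-- The Cartan subalgebra, paired with its action on words. -/
def wordCartan : Submodule K (L × Module.End K τ.Words) :=
  LinearMap.range (τ.cartan.prod (τ.cartanOp ψ))

/-- The raising generators, paired with their action on words. -/
def wordRaising : Submodule K (L × Module.End K τ.Words) :=
  LinearMap.range (τ.raising.subtype.prod (τ.raiseOp ψ))

theorem isTriangular_word :
    IsTriangular K (L × Module.End K τ.Words) τ.wordLowering (τ.wordCartan ψ)
      (τ.wordRaising ψ) where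
  cartan_lie_cartan := by
    rintro _ ⟨y, rfl⟩ _ ⟨z, rfl⟩
    have : ⁅τ.cartan.prod (τ.cartanOp ψ) y, τ.cartan.prod (τ.cartanOp ψ) z⁆ = 0 :=
      Prod.ext (τ.cartan_lie_cartan y z)
        (sub_eq_zero.2 (LinearMap.ext (τ.cartanOp_cartanOp ψ y z)))
    exact this ▸ zero_mem _
  cartan_lie_neg := by
    rintro _ ⟨y, rfl⟩ _ ⟨f, rfl⟩
    exact ⟨τ.cartanLower y f, Prod.ext rfl (eq_sub_of_add_eq' (LinearMap.ext fun t =>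
      (τ.cartanOp_lowerOp ψ y f t).symm))⟩
  cartan_lie_pos := by
    rintro _ ⟨y, rfl⟩ _ ⟨e, rfl⟩
    exact ⟨τ.cartanRaise y e, Prod.ext rfl (eq_sub_of_add_eq' (LinearMap.ext fun t =>
      (τ.cartanOp_raiseOp ψ y e t).symm))⟩
  pos_lie_neg := by
    rintro _ ⟨e, rfl⟩ _ ⟨f, rfl⟩
    exact ⟨τ.raiseLower e f, Prod.ext (τ.cartan_raiseLower e f)
      (eq_sub_of_add_eq' (LinearMap.ext fun t => (τ.raiseOp_lowerOp ψ e f t).symm))⟩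

theorem fst_mem_of_mem_lieSpan_wordLowering {s : L × Module.End K τ.Words}
    (hs : s ∈ LieSubalgebra.lieSpan K _ (τ.wordLowering : Set _)) :
    s.1 ∈ LieSubalgebra.lieSpan K L (τ.lowering : Set L) ∧ ∀ t, τ.wordTop (s.2 t) = 0 := by
  induction hs using LieSubalgebra.lieSpan_induction with
  | mem _ hs =>
    obtain ⟨f, rfl⟩ := hs
    exact ⟨LieSubalgebra.subset_lieSpan f.2, τ.wordTop_lowerOp f⟩
  | zero => exact ⟨zero_mem _, fun _ => map_zero _⟩
  | add a b _ _ ha hb =>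
    exact ⟨add_mem ha.1 hb.1, fun t => (map_add _ _ _).trans (by rw [ha.2, hb.2, add_zero])⟩
  | smul c a _ ha =>
    exact ⟨Submodule.smul_mem _ c ha.1, fun t =>
      (map_smul τ.wordTop c _).trans (by rw [ha.2, smul_zero])⟩
  | lie a b _ _ ha hb =>
    exact ⟨LieSubalgebra.lie_mem _ ha.1 hb.1, fun t =>
      (map_sub _ _ _).trans (by rw [Module.End.mul_apply, Module.End.mul_apply, ha.2, hb.2,
        sub_zero])⟩

theorem fst_mem_of_mem_lieSpan_wordRaising {s : L × Module.End K τ.Words}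
    (hs : s ∈ LieSubalgebra.lieSpan K _ (τ.wordRaising ψ : Set _)) :
    s.1 ∈ LieSubalgebra.lieSpan K L (τ.raising : Set L) ∧ s.2 τ.emptyWord = 0 := by
  induction hs using LieSubalgebra.lieSpan_induction with
  | mem _ hs =>
    obtain ⟨e, rfl⟩ := hs
    exact ⟨LieSubalgebra.subset_lieSpan e.2, τ.raiseOp_emptyWord ψ e⟩
  | zero => exact ⟨zero_mem _, rfl⟩
  | add a b _ _ ha hb =>
    exact ⟨add_mem ha.1 hb.1, (congrArg₂ _ ha.2 hb.2).trans (add_zero _)⟩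
  | smul c a _ ha =>
    exact ⟨Submodule.smul_mem _ c ha.1, (congrArg (c • ·) ha.2).trans (smul_zero c)⟩
  | lie a b _ _ ha hb =>
    exact ⟨LieSubalgebra.lie_mem _ ha.1 hb.1, by
      rw [LieAlgebra.Prod.bracket_apply, Ring.lie_def, LinearMap.sub_apply, Module.End.mul_apply,
        Module.End.mul_apply, ha.2, hb.2, map_zero, map_zero, sub_zero]⟩

/-- The Lie algebra of pairs generated by the generators of `L` and their actions on words. It
acts on `τ.Words` and surjects onto `L`. -/
def wordAlgebra : LieSubalgebra K (L × Module.End K τ.Words) :=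
  LieSubalgebra.lieSpan K _ (τ.wordLowering ∪ τ.wordCartan ψ ∪ τ.wordRaising ψ : Set _)

theorem wordTop_emptyWord_eq_zero [CharZero K] {s : L × Module.End K τ.Words}
    (hs : s ∈ τ.wordAlgebra ψ) (h : s.1 = 0) : τ.wordTop (s.2 τ.emptyWord) = 0 := by
  obtain ⟨_, hac, b, hb, rfl⟩ := Submodule.mem_sup.1 ((τ.isTriangular_word ψ).lieSpan_le hs)
  obtain ⟨a, ha, _, ⟨y, rfl⟩, rfl⟩ := Submodule.mem_sup.1 hac
  obtain ⟨ha₁, ha₂⟩ := τ.fst_mem_of_mem_lieSpan_wordLowering ha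
  obtain ⟨hb₁, hb₂⟩ := τ.fst_mem_of_mem_lieSpan_wordRaising ψ hb
  have hy : y = 0 := τ.cartan_injective
    ((cartan_eq_zero_of_add_eq_zero ha₁ hb₁ h).trans (map_zero _).symm)
  rw [hy, map_zero, add_zero, Prod.snd_add, LinearMap.add_apply, map_add, ha₂, hb₂, map_zero,
    add_zero]

theorem wordTop_eq_zero_of_fst_eq_zero [CharZero K] {s : L × Module.End K τ.Words}
    (hs : s ∈ τ.wordAlgebra ψ) (h : s.1 = 0) (t : τ.Words) : τ.wordTop (s.2 t) = 0 := by
  let N : Submodule K τ.Words :=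
    ⨅ s : {s // s ∈ τ.wordAlgebra ψ ∧ s.1 = 0}, LinearMap.ker (τ.wordTop ∘ₗ s.1.2)
  have hN : N = ⊤ := by
    refine τ.eq_top_of_lowerOp_mem ?_ fun f t ht => ?_
    · exact Submodule.mem_iInf _ |>.2 fun s => τ.wordTop_emptyWord_eq_zero ψ s.2.1 s.2.2
    · refine Submodule.mem_iInf _ |>.2 fun ⟨s, hs, h⟩ => ?_
      have hlie : ⁅s, τ.lowering.subtype.prod τ.lowerOp f⁆ ∈ τ.wordAlgebra ψ :=
        LieSubalgebra.lie_mem _ hs (LieSubalgebra.subset_lieSpan (.inl (.inl ⟨f, rfl⟩)))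
      have htop := Submodule.mem_iInf _ |>.1 ht
        ⟨_, hlie, (congrArg (⁅·, (f : L)⁆) h).trans (zero_lie _)⟩
      change τ.wordTop (s.2 (τ.lowerOp f t) - τ.lowerOp f (s.2 t)) = 0 at htop
      rwa [map_sub, wordTop_lowerOp, sub_zero] at htop
  exact Submodule.mem_iInf _ |>.1 (hN ▸ Submodule.mem_top : t ∈ N) ⟨s, hs, h⟩

/-- The projection of `τ.wordAlgebra ψ` to `L`. -/
def wordProj : τ.wordAlgebra ψ →ₗ⁅K⁆ L := (LieHom.fst K L _).comp (τ.wordAlgebra ψ).incl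

/-- The representation of `τ.wordAlgebra ψ` on `τ.Words`. -/
def wordRep : τ.wordAlgebra ψ →ₗ⁅K⁆ Module.End K τ.Words :=
  (LieHom.snd K L _).comp (τ.wordAlgebra ψ).incl

theorem wordProj_surjective : Function.Surjective (τ.wordProj ψ) := by
  have hF : LieSubalgebra.lieSpan K L (τ.lowering : Set L) ≤ (τ.wordProj ψ).range :=
    LieSubalgebra.lieSpan_le.2 fun f hf =>
      ⟨⟨_, LieSubalgebra.subset_lieSpan (.inl (.inl ⟨⟨f, hf⟩, rfl⟩))⟩, rfl⟩
  have hE : LieSubalgebra.lieSpan K L (τ.raising : Set L) ≤ (τ.wordProj ψ).range :=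
    LieSubalgebra.lieSpan_le.2 fun e he =>
      ⟨⟨_, LieSubalgebra.subset_lieSpan (.inr ⟨⟨e, he⟩, rfl⟩)⟩, rfl⟩
  have hH : LinearMap.range τ.cartan ≤ (τ.wordProj ψ).range.toSubmodule := by
    rintro _ ⟨y, rfl⟩
    exact ⟨⟨_, LieSubalgebra.subset_lieSpan (.inl (.inr ⟨y, rfl⟩))⟩, rfl⟩
  exact fun x => (sup_le (sup_le hF hH) hE : _ ≤ (τ.wordProj ψ).range.toSubmodule)
    (τ.span_eq_top.ge (Submodule.mem_top (x := x)))

instance : LieRingModule (τ.wordAlgebra ψ) τ.Words := LieRingModule.compLieHom _ (τ.wordRep ψ)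

instance : LieModule K (τ.wordAlgebra ψ) τ.Words := LieModule.compLieHom _ (τ.wordRep ψ)

/-- The submodule of `τ.Words` that the kernel of `τ.wordProj ψ` generates. -/
abbrev wordKer : LieSubmodule K (τ.wordAlgebra ψ) τ.Words := ⁅(τ.wordProj ψ).ker, ⊤⁆

theorem wordKer_le_ker_wordTop [CharZero K] :
    (τ.wordKer ψ).toSubmodule ≤ LinearMap.ker τ.wordTop := by
  rw [wordKer, LieSubmodule.lieIdeal_oper_eq_linear_span', Submodule.span_le]
  rintro _ ⟨s, hs, t, -, rfl⟩
  exact τ.wordTop_eq_zero_of_fst_eq_zero ψ s.2 hs t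

theorem exists_lieHom_quotient_wordKer :
    ∃ σ : L →ₗ⁅K⁆ Module.End K (τ.Words ⧸ τ.wordKer ψ),
      (∀ (f : τ.lowering) t, σ f (LieSubmodule.Quotient.mk t) =
        LieSubmodule.Quotient.mk (τ.lowerOp f t)) ∧
      (∀ y t, σ (τ.cartan y) (LieSubmodule.Quotient.mk t) =
        LieSubmodule.Quotient.mk (τ.cartanOp ψ y t)) ∧
      ∀ (e : τ.raising) t, σ e (LieSubmodule.Quotient.mk t) =
        LieSubmodule.Quotient.mk (τ.raiseOp ψ e t) := by
  obtain ⟨σ, hσ⟩ := exists_lieHom_of_surjective (τ.wordProj ψ) (τ.wordProj_surjective ψ)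
    (LieModule.toEnd K (τ.wordAlgebra ψ) (τ.Words ⧸ τ.wordKer ψ)) fun s hs =>
      LinearMap.ext fun q => by
        obtain ⟨t, rfl⟩ := LieSubmodule.Quotient.surjective_mk' _ q
        exact (LieSubmodule.Quotient.mk_eq_zero _).2 (LieSubmodule.lie_mem_lie
          (show s ∈ (τ.wordProj ψ).ker from hs) (LieSubmodule.mem_top t))
  exact ⟨σ,
    fun f _ => LinearMap.congr_fun
      (hσ ⟨_, LieSubalgebra.subset_lieSpan (.inl (.inl ⟨f, rfl⟩))⟩) _,
    fun y _ => LinearMap.congr_fun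
      (hσ ⟨_, LieSubalgebra.subset_lieSpan (.inl (.inr ⟨y, rfl⟩))⟩) _,
    fun e _ => LinearMap.congr_fun (hσ ⟨_, LieSubalgebra.subset_lieSpan (.inr ⟨e, rfl⟩)⟩) _⟩

theorem exists_isHighestWeight.{u, v} {K : Type u} {L : Type v} {𝔥 : Type*} [Field K] [CharZero K]
    [LieRing L] [LieAlgebra K L] [AddCommGroup 𝔥] [Module K 𝔥] (τ : TriangularData K L 𝔥)
    (ψ : Module.Dual K 𝔥) :
    ∃ (M : Type (max u v)) (_ : AddCommGroup M) (_ : Module K M) (_ : LieRingModule L M)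
      (_ : LieModule K L M) (v : M) (top : Module.Dual K M), IsHighestWeight τ ψ v top := by
  obtain ⟨σ, hF, hH, hE⟩ := τ.exists_lieHom_quotient_wordKer ψ
  let _ : LieRingModule L (τ.Words ⧸ τ.wordKer ψ) := LieRingModule.compLieHom _ σ
  let _ : LieModule K L (τ.Words ⧸ τ.wordKer ψ) := LieModule.compLieHom _ σ
  refine ⟨τ.Words ⧸ τ.wordKer ψ, _, _, _, inferInstance, LieSubmodule.Quotient.mk τ.emptyWord,
    (τ.wordKer ψ).toSubmodule.liftQ τ.wordTop (τ.wordKer_le_ker_wordTop ψ), τ.wordTop_emptyWord,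
    fun e he => ?_, fun y => ?_, fun f hf q => ?_, fun y q => ?_, ?_⟩
  · exact (hE ⟨e, he⟩ _).trans (by rw [raiseOp_emptyWord]; rfl)
  · exact (hH y _).trans (by rw [cartanOp_emptyWord]; rfl)
  · obtain ⟨t, rfl⟩ := LieSubmodule.Quotient.surjective_mk' _ q
    exact (congrArg _ (hF ⟨f, hf⟩ t)).trans (τ.wordTop_lowerOp ⟨f, hf⟩ t)
  · obtain ⟨t, rfl⟩ := LieSubmodule.Quotient.surjective_mk' _ q
    exact (congrArg _ (hH y t)).trans (τ.wordTop_cartanOp ψ y t)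
  · refine eq_top_iff.2 fun q _ => ?_
    obtain ⟨t, rfl⟩ := LieSubmodule.Quotient.surjective_mk' _ q
    set P := LieSubmodule.lieSpan K L
      {(LieSubmodule.Quotient.mk τ.emptyWord : τ.Words ⧸ τ.wordKer ψ)}
    have hP : P.toSubmodule.comap (τ.wordKer ψ).toSubmodule.mkQ = ⊤ :=
      τ.eq_top_of_lowerOp_mem (LieSubmodule.subset_lieSpan rfl) fun f t ht =>
        (Set.mem_of_eq_of_mem (hF f t).symm (P.lie_mem (x := (f : L)) ht) :
          LieSubmodule.Quotient.mk (τ.lowerOp f t) ∈ (P : Set (τ.Words ⧸ τ.wordKer ψ)))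
    exact (hP ▸ Submodule.mem_top : t ∈ Submodule.comap _ _)

end TriangularData

end Existence

/-! ### The triangular decomposition of a Kac-Moody algebra -/

theorem lieSpan_span {R L : Type*} [CommRing R] [LieRing L] [LieAlgebra R L] (S : Set L) :
    LieSubalgebra.lieSpan R L (Submodule.span R S : Set L) = LieSubalgebra.lieSpan R L S :=
  le_antisymm (LieSubalgebra.lieSpan_le.2 LieSubalgebra.submodule_span_le_lieSpan)
    (LieSubalgebra.lieSpan_mono Submodule.subset_span)

section KacMoody

variable {ι H : Type*} [Fintype ι] {C : Matrix ι ι ℤ} [AddCommGroup H] [Module ℂ H]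
  (Z : Realization C H)

/-- The projection of the free Lie algebra onto the Kac-Moody algebra. -/
def kmProj : FreeLieAlgebra ℂ (Gen ι H) →ₗ⁅ℂ⁆ KM Z where
  toFun x := LieSubmodule.Quotient.mk (N := maxIdeal Z)
    (LieSubmodule.Quotient.mk (N := relIdeal Z) x : Aux Z)
  map_add' _ _ := rfl
  map_smul' _ _ := rfl
  map_lie' := rfl

theorem kmProj_of (x : Gen ι H) : kmProj Z (FreeLieAlgebra.of ℂ x) = kmGen Z x := rfl

theorem kmProj_surjective : Function.Surjective (kmProj Z) := by
  intro x
  obtain ⟨y, rfl⟩ := LieSubmodule.Quotient.surjective_mk' (maxIdeal Z) x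
  obtain ⟨z, rfl⟩ := LieSubmodule.Quotient.surjective_mk' (relIdeal Z) y
  exact ⟨z, rfl⟩

theorem kmProj_rel {x : FreeLieAlgebra ℂ (Gen ι H)} (hx : Rel Z x) : kmProj Z x = 0 := by
  have h : (LieSubmodule.Quotient.mk (N := relIdeal Z) x : Aux Z) = 0 :=
    (LieSubmodule.Quotient.mk_eq_zero' (N := relIdeal Z)).2
      (LieSubmodule.subset_lieSpan hx)
  change LieSubmodule.Quotient.mk (N := maxIdeal Z)
    (LieSubmodule.Quotient.mk (N := relIdeal Z) x : Aux Z) = 0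
  rw [h]; rfl

/-- The map from `H` to the Kac-Moody algebra. -/
def kmH : H →ₗ[ℂ] KM Z where
  toFun x := kmGen Z (.h x)
  map_add' x y := by
    have := kmProj_rel Z (Rel.add (Z := Z) x y)
    rw [map_sub, map_sub, sub_sub, sub_eq_zero] at this
    exact this
  map_smul' c x := by
    have := kmProj_rel Z (Rel.smul (Z := Z) c x)
    rw [map_sub, map_smul, sub_eq_zero] at this
    exact this

/-- The generator `e i`. -/
def kmE (i : ι) : KM Z := kmGen Z (.e i)

/-- The generator `f i`. -/
def kmF (i : ι) : KM Z := kmGen Z (.f i)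

theorem kmH_lie_kmH (x y : H) : ⁅kmH Z x, kmH Z y⁆ = 0 := by
  have := kmProj_rel Z (Rel.hh x y)
  rwa [LieHom.map_lie] at this

theorem kmH_lie_kmE (x : H) (i : ι) : ⁅kmH Z x, kmE Z i⁆ = Z.root i x • kmE Z i := by
  have := kmProj_rel Z (Rel.he x i)
  rw [map_sub, LieHom.map_lie, map_smul, sub_eq_zero] at this
  exact this

theorem kmH_lie_kmF (x : H) (i : ι) : ⁅kmH Z x, kmF Z i⁆ = -(Z.root i x • kmF Z i) := by
  have := kmProj_rel Z (Rel.hf x i)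
  rw [map_add, LieHom.map_lie, map_smul] at this
  exact eq_neg_of_add_eq_zero_left this

theorem kmE_lie_kmF_same (i : ι) : ⁅kmE Z i, kmF Z i⁆ = kmH Z (Z.coroot i) := by
  have := kmProj_rel Z (Rel.ef_same i)
  rw [map_sub, LieHom.map_lie, sub_eq_zero] at this
  exact this

theorem kmE_lie_kmF_ne {i j : ι} (hij : i ≠ j) : ⁅kmE Z i, kmF Z j⁆ = 0 := by
  have := kmProj_rel Z (Rel.ef_ne i j hij)
  rwa [LieHom.map_lie] at this

theorem cartan_eq : cartan Z = LinearMap.range (kmH Z) :=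
  Submodule.span_eq (LinearMap.range (kmH Z))

theorem lie_eq_zero_of_mem_cartan {x y : KM Z} (hx : x ∈ cartan Z) (hy : y ∈ cartan Z) :
    ⁅x, y⁆ = 0 := by
  rw [cartan_eq] at hx hy
  obtain ⟨⟨x, rfl⟩, y, rfl⟩ := And.intro hx hy
  exact kmH_lie_kmH Z x y

/-- The negative part of the Kac-Moody algebra. -/
def nNeg : LieSubalgebra ℂ (KM Z) :=
  LieSubalgebra.lieSpan ℂ (KM Z) (Set.range (kmF Z))

theorem eq_top_of_gen_mem {K : LieSubalgebra ℂ (KM Z)} (hh : ∀ x, kmH Z x ∈ K)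
    (he : ∀ i, kmE Z i ∈ K) (hf : ∀ i, kmF Z i ∈ K) : K = ⊤ := by
  rw [eq_top_iff]
  intro x _
  obtain ⟨y, rfl⟩ := kmProj_surjective Z x
  let g : FreeLieAlgebra ℂ (Gen ι H) →ₗ⁅ℂ⁆ K := FreeLieAlgebra.lift ℂ fun x =>
    ⟨kmGen Z x, by cases x with
      | h x => exact hh x
      | e i => exact he i
      | f i => exact hf i⟩
  have hg : K.incl.comp g = kmProj Z := by
    refine FreeLieAlgebra.hom_ext fun x => ?_
    rw [LieHom.comp_apply, FreeLieAlgebra.lift_of_apply, kmProj_of]; rfl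
  rw [← hg]
  exact (g y).2

/-- The span of the generators `f i`. -/
def spanF : Submodule ℂ (KM Z) := Submodule.span ℂ (Set.range (kmF Z))

/-- The span of the generators `e i`. -/
def spanE : Submodule ℂ (KM Z) := Submodule.span ℂ (Set.range (kmE Z))

theorem isTriangular_km : IsTriangular ℂ (KM Z) (spanF Z) (cartan Z) (spanE Z) where
  cartan_lie_cartan _ hx _ hy := lie_mem_of_mem_span (by
    rintro _ ⟨x, rfl⟩ _ ⟨y, rfl⟩
    exact (kmH_lie_kmH Z x y).symm ▸ zero_mem _) hx hy
  cartan_lie_neg _ hx _ hf := lie_mem_of_mem_span (by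
    rintro _ ⟨x, rfl⟩ _ ⟨i, rfl⟩
    exact (kmH_lie_kmF Z x i).symm ▸
      neg_mem (Submodule.smul_mem _ _ (Submodule.subset_span ⟨i, rfl⟩))) hx hf
  cartan_lie_pos _ hx _ he := lie_mem_of_mem_span (by
    rintro _ ⟨x, rfl⟩ _ ⟨i, rfl⟩
    exact (kmH_lie_kmE Z x i).symm ▸
      Submodule.smul_mem _ _ (Submodule.subset_span ⟨i, rfl⟩)) hx he
  pos_lie_neg _ he _ hf := lie_mem_of_mem_span (by
    rintro _ ⟨i, rfl⟩ _ ⟨j, rfl⟩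
    obtain rfl | hij := eq_or_ne i j
    · exact (kmE_lie_kmF_same Z i).symm ▸ Submodule.subset_span ⟨_, rfl⟩
    · exact (kmE_lie_kmF_ne Z hij).symm ▸ zero_mem _) he hf

theorem nNeg_sup_cartan_sup_nPos :
    (nNeg Z).toSubmodule ⊔ cartan Z ⊔ (nPos Z).toSubmodule = ⊤ := by
  have htop : LieSubalgebra.lieSpan ℂ (KM Z) (spanF Z ∪ cartan Z ∪ spanE Z : Set (KM Z)) = ⊤ :=
    eq_top_of_gen_mem Z
      (fun x => LieSubalgebra.subset_lieSpan (.inl (.inr (Submodule.subset_span ⟨x, rfl⟩))))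
      (fun i => LieSubalgebra.subset_lieSpan (.inr (Submodule.subset_span ⟨i, rfl⟩)))
      (fun i => LieSubalgebra.subset_lieSpan (.inl (.inl (Submodule.subset_span ⟨i, rfl⟩))))
  have h := (isTriangular_km Z).lieSpan_le
  rw [htop, spanF, spanE, lieSpan_span, lieSpan_span] at h
  exact top_le_iff.1 h

theorem exists_root_eq_one : ∃ x : H, ∀ i, Z.root i x = 1 := by
  have := Z.finiteDimensional
  obtain ⟨g, hg⟩ := Module.exists_dual_forall_apply_eq_one
    (linearIndepOn_univ_iff.2 Z.linearIndependent_root)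
  exact ⟨(Module.evalEquiv ℂ H).symm g, fun i => by
    rw [Module.apply_evalEquiv_symm_apply, hg i (Set.mem_univ i)]⟩

/-- An element of `H` on which all simple roots take the value `1`. -/
def rhoCheck : H := (exists_root_eq_one Z).choose

theorem root_rhoCheck (i : ι) : Z.root i (rhoCheck Z) = 1 := (exists_root_eq_one Z).choose_spec i

theorem rhoCheck_lie_kmE (i : ι) : ⁅kmH Z (rhoCheck Z), kmE Z i⁆ = kmE Z i := by
  rw [kmH_lie_kmE, root_rhoCheck, one_smul]

theorem rhoCheck_lie_kmF (i : ι) : ⁅kmH Z (rhoCheck Z), kmF Z i⁆ = -kmF Z i := by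
  rw [kmH_lie_kmF, root_rhoCheck, one_smul]

theorem lie_mem_derived (x y : KM Z) : ⁅x, y⁆ ∈ (derived Z).toSubmodule :=
  LieSubmodule.lie_mem_lie (LieSubmodule.mem_top x) (LieSubmodule.mem_top y)

theorem kmE_mem_derived (i : ι) : kmE Z i ∈ (derived Z).toSubmodule := by
  rw [← rhoCheck_lie_kmE]; exact lie_mem_derived Z _ _

theorem kmF_mem_derived (i : ι) : kmF Z i ∈ (derived Z).toSubmodule := by
  rw [← neg_neg (kmF Z i), ← rhoCheck_lie_kmF]; exact Submodule.neg_mem _ (lie_mem_derived Z _ _)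

theorem nPos_le_derived : (nPos Z).toSubmodule ≤ (derived Z).toSubmodule := by
  refine (LieSubalgebra.lieSpan_le (K := (derived Z).toLieSubalgebra)).2 ?_
  rintro _ ⟨i, rfl⟩
  exact kmE_mem_derived Z i

theorem nNeg_le_derived : (nNeg Z).toSubmodule ≤ (derived Z).toSubmodule := by
  refine (LieSubalgebra.lieSpan_le (K := (derived Z).toLieSubalgebra)).2 ?_
  rintro _ ⟨i, rfl⟩
  exact kmF_mem_derived Z i

theorem exists_add_eq_of_mem_derived {x : KM Z} (hx : x ∈ (derived Z).toSubmodule) :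
    ∃ a ∈ nNeg Z, ∃ h : cartan' Z, ∃ b ∈ nPos Z, x = a + h + b := by
  have hx' : x ∈ (nNeg Z).toSubmodule ⊔ cartan Z ⊔ (nPos Z).toSubmodule :=
    nNeg_sup_cartan_sup_nPos Z ▸ Submodule.mem_top
  obtain ⟨y, hy, b, hb, rfl⟩ := Submodule.mem_sup.1 hx'
  obtain ⟨a, ha, h, hh, rfl⟩ := Submodule.mem_sup.1 hy
  refine ⟨a, ha, ⟨h, hh, ?_⟩, b, hb, rfl⟩
  have : h = (a + h + b) - a - b := by abel
  rw [this]
  exact Submodule.sub_mem _ (Submodule.sub_mem _ hx (nNeg_le_derived Z ha)) (nPos_le_derived Z hb)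

end KacMoody

/-! ### The triangular decomposition of `g_A` -/

section LoopAlgebra

variable {ι : Type*} [Fintype ι] {C : Matrix ι ι ℤ} {H : Type*} [AddCommGroup H] [Module ℂ H]
  {Z : Realization C H} {n : ℕ} {H2 : Submodule ℂ (KM Z)}

theorem mono_mul (m k : Fin n → ℤ) : (mono m * mono k : Laurent n) = mono (m + k) := by
  refine (AddMonoidAlgebra.single_mul_single (R := ℂ) m k 1 1).trans ?_
  rw [mul_one]; rfl

theorem mono_zero : (mono 0 : Laurent n) = 1 := rfl

theorem tmul_lie_tmul (a b : Laurent n) (x y : KM Z) :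
    ⁅a ⊗ₜ[ℂ] x, b ⊗ₜ[ℂ] y⁆ = (a * b) ⊗ₜ[ℂ] ⁅x, y⁆ := rfl

theorem loopSub_eq_span (S : Submodule ℂ (KM Z)) :
    loopSub n S = Submodule.span ℂ {t | ∃ a, ∃ s ∈ S, a ⊗ₜ[ℂ] s = t} := by
  simp only [loopSub, LinearMap.lTensor, TensorProduct.range_map_eq_span_tmul, LinearMap.id_apply,
    Submodule.subtype_apply, Subtype.exists, exists_prop]

theorem tmul_mem_loopSub (a : Laurent n) {S : Submodule ℂ (KM Z)} {s : KM Z} (hs : s ∈ S) :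
    a ⊗ₜ[ℂ] s ∈ loopSub n S := ⟨a ⊗ₜ[ℂ] ⟨s, hs⟩, rfl⟩

theorem loopSub_le {S : Submodule ℂ (KM Z)} {N : Submodule ℂ (Laurent n ⊗[ℂ] KM Z)}
    (h : ∀ a : Laurent n, ∀ s ∈ S, a ⊗ₜ[ℂ] s ∈ N) : loopSub n S ≤ N := by
  rw [loopSub_eq_span, Submodule.span_le]
  rintro _ ⟨a, s, hs, rfl⟩
  exact h a s hs

theorem loopSub_mono {S T : Submodule ℂ (KM Z)} (h : S ≤ T) : loopSub n S ≤ loopSub n T :=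
  loopSub_le fun a _ hs => tmul_mem_loopSub a (h hs)

theorem loopSub_bot : loopSub n (⊥ : Submodule ℂ (KM Z)) = ⊥ :=
  le_bot_iff.1 (loopSub_le fun a s hs => by
    rw [(Submodule.mem_bot ℂ).1 hs, TensorProduct.tmul_zero]; exact zero_mem _)

theorem lie_mem_loopSub_of_lie_mem {S T U : Submodule ℂ (KM Z)}
    (h : ∀ x ∈ S, ∀ y ∈ T, ⁅x, y⁆ ∈ U) {x y : Laurent n ⊗[ℂ] KM Z} (hx : x ∈ loopSub n S)
    (hy : y ∈ loopSub n T) : ⁅x, y⁆ ∈ loopSub n U := by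
  rw [loopSub_eq_span] at hx hy
  refine lie_mem_of_mem_span ?_ hx hy
  rintro _ ⟨a, x, hx, rfl⟩ _ ⟨b, y, hy, rfl⟩
  exact tmul_mem_loopSub (a * b) (h x hx y hy)

theorem loopSub_eigenspace_le (x : KM Z) (c : ℂ) :
    loopSub n ((LieAlgebra.ad ℂ (KM Z) x).eigenspace c) ≤
      (LieAlgebra.ad ℂ (Laurent n ⊗[ℂ] KM Z) (1 ⊗ₜ[ℂ] x)).eigenspace c :=
  loopSub_le fun a s hs => by
    rw [Module.End.mem_eigenspace_iff, LieAlgebra.ad_apply] at hs ⊢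
    rw [tmul_lie_tmul, one_mul, hs, TensorProduct.tmul_smul]

theorem loopSub_lieSpan_le {S : Set (KM Z)} {K : LieSubalgebra ℂ (Laurent n ⊗[ℂ] KM Z)}
    (h : ∀ a : Laurent n, ∀ s ∈ S, a ⊗ₜ[ℂ] s ∈ K) :
    loopSub n (LieSubalgebra.lieSpan ℂ (KM Z) S).toSubmodule ≤ K.toSubmodule := by
  refine loopSub_le fun a s hs => ?_
  change a ⊗ₜ[ℂ] s ∈ K
  induction hs using LieSubalgebra.lieSpan_induction generalizing a with
  | mem s hs => exact h a s hs
  | zero => rw [TensorProduct.tmul_zero]; exact K.zero_mem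
  | add x y _ _ hx hy => rw [TensorProduct.tmul_add]; exact K.add_mem (hx a) (hy a)
  | smul c x _ hx => rw [TensorProduct.tmul_smul]; exact K.smul_mem c (hx a)
  | lie x y _ _ hx hy =>
    rw [← mul_one a, ← tmul_lie_tmul]
    exact K.lie_mem (hx a) (hy 1)

theorem loopSub_derived_le : loopSub n (derived Z).toSubmodule ≤ (loopKM Z n H2).toSubmodule :=
  le_sup_left

/-- The subspace `(S ⊗ A) ∩ g_A` of `g_A`. -/
def loopPart (n : ℕ) (H2 S : Submodule ℂ (KM Z)) : Submodule ℂ (loopKM Z n H2) :=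
  (loopSub n S).comap (loopKM Z n H2).toSubmodule.subtype

theorem loopSub_lieSpan_le_map_lieSpan {S : Submodule ℂ (KM Z)} (hS : S ≤ (derived Z).toSubmodule) :
    loopSub n (LieSubalgebra.lieSpan ℂ (KM Z) (S : Set (KM Z))).toSubmodule ≤
      (LieSubalgebra.lieSpan ℂ (loopKM Z n H2)
        (loopPart n H2 S : Set (loopKM Z n H2))).toSubmodule.map
          (loopKM Z n H2).toSubmodule.subtype :=
  loopSub_lieSpan_le (K := (LieSubalgebra.lieSpan ℂ (loopKM Z n H2)
      (loopPart n H2 S : Set (loopKM Z n H2))).map (loopKM Z n H2).incl) fun a s hs =>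
    ⟨⟨a ⊗ₜ[ℂ] s, loopSub_derived_le (tmul_mem_loopSub a (hS hs))⟩,
      LieSubalgebra.subset_lieSpan (tmul_mem_loopSub a hs), rfl⟩

end LoopAlgebra

section LoopCartan

variable {ι : Type*} [Fintype ι] {C : Matrix ι ι ℤ} {H : Type*} [AddCommGroup H] [Module ℂ H]
  {Z : Realization C H} {n : ℕ} {H2 : Submodule ℂ (KM Z)}

theorem loopCartanMap_apply (a : Laurent n ⊗[ℂ] cartan' Z) (b : H2) :
    loopCartanMap Z n H2 (a, b) =
      LinearMap.lTensor (Laurent n) (cartan' Z).subtype a + 1 ⊗ₜ[ℂ] (b : KM Z) := by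
  rw [loopCartanMap, LinearMap.coprod_apply]; rfl

theorem loopCartanMap_tmul_zero (a : Laurent n) (h : cartan' Z) :
    loopCartanMap Z n H2 (a ⊗ₜ[ℂ] h, 0) = a ⊗ₜ[ℂ] (h : KM Z) := by
  rw [loopCartanMap_apply, Submodule.coe_zero, TensorProduct.tmul_zero, add_zero,
    LinearMap.lTensor_tmul, Submodule.subtype_apply]

theorem loopCartanMap_zero_right (b : H2) :
    loopCartanMap Z n H2 (0, b) = 1 ⊗ₜ[ℂ] (b : KM Z) := by
  rw [loopCartanMap_apply, map_zero, zero_add]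

theorem loopSub_cartan'_le_range :
    loopSub n (cartan' Z) ≤ LinearMap.range (loopCartanMap Z n H2) :=
  loopSub_le fun a h hh => ⟨(a ⊗ₜ[ℂ] ⟨h, hh⟩, 0), loopCartanMap_tmul_zero a _⟩

theorem loopCartanMap_mem_loopSub (hH2 : IsCartanCompl Z H2) (y : LoopCartan Z n H2) :
    loopCartanMap Z n H2 y ∈ loopSub n (cartan Z) := by
  obtain ⟨a, b⟩ := y
  rw [loopCartanMap_apply]
  exact add_mem (loopSub_mono (inf_le_left : cartan' Z ≤ cartan Z) ⟨a, rfl⟩)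
    (tmul_mem_loopSub _ (hH2.2 ▸ Submodule.mem_sup_right b.2))

theorem exists_loopCartanMap_eq_one_tmul (hH2 : IsCartanCompl Z H2) {x : KM Z}
    (hx : x ∈ cartan Z) : ∃ d : LoopCartan Z n H2, loopCartanMap Z n H2 d = 1 ⊗ₜ[ℂ] x := by
  rw [← hH2.2] at hx
  obtain ⟨h, hh, b, hb, rfl⟩ := Submodule.mem_sup.1 hx
  refine ⟨(1 ⊗ₜ[ℂ] ⟨h, hh⟩, ⟨b, hb⟩), ?_⟩
  rw [loopCartanMap_apply, LinearMap.lTensor_tmul, TensorProduct.tmul_add]; rfl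

theorem exists_cartan'_projection (hH2 : IsCartanCompl Z H2) :
    ∃ p : KM Z →ₗ[ℂ] cartan' Z, p ∘ₗ (cartan' Z).subtype = LinearMap.id ∧ ∀ b ∈ H2, p b = 0 := by
  obtain ⟨W, hW, hc⟩ := (disjoint_iff.2 hH2.1).symm.exists_isCompl
  exact ⟨(cartan' Z).projectionOnto W hc.symm,
    LinearMap.ext fun x => Submodule.projectionOnto_apply_left hc.symm x,
    fun b hb => Submodule.projectionOnto_apply_right hc.symm ⟨b, hW hb⟩⟩

theorem loopCartanMap_injective (hH2 : IsCartanCompl Z H2) :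
    Function.Injective (loopCartanMap Z n H2) := by
  obtain ⟨p, hp, hp2⟩ := exists_cartan'_projection hH2
  rw [injective_iff_map_eq_zero]
  rintro ⟨a, b⟩ hab
  have ha : a = 0 := by
    have h := congrArg (LinearMap.lTensor (Laurent n) p) hab
    rwa [loopCartanMap_apply, map_add, ← LinearMap.comp_apply, ← LinearMap.lTensor_comp, hp,
      LinearMap.lTensor_id, LinearMap.id_apply, LinearMap.lTensor_tmul, hp2 b b.2,
      TensorProduct.tmul_zero, add_zero, map_zero] at h
  subst ha
  have : Module.Free ℂ (Laurent n) := .of_basis (monoBasis n)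
  have : Nontrivial (Laurent n) := (monoBasis n).repr.symm.injective.nontrivial
  rw [loopCartanMap_zero_right, Module.FaithfullyFlat.one_tmul_eq_zero_iff] at hab
  rw [Submodule.coe_eq_zero.1 hab, Prod.mk_zero_zero]

/-- The inclusion of `h_A` in `g_A` as a linear map. -/
def loopCartanLin (Z : Realization C H) (n : ℕ) (H2 : Submodule ℂ (KM Z)) :
    LoopCartan Z n H2 →ₗ[ℂ] loopKM Z n H2 :=
  (loopCartanMap Z n H2).codRestrict (loopKM Z n H2).toSubmodule (loopCartanMap_mem Z n H2)

end LoopCartan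

section LoopTriangular

variable {ι : Type*} [Fintype ι] {C : Matrix ι ι ℤ} {H : Type*} [AddCommGroup H] [Module ℂ H]
  {Z : Realization C H} {n : ℕ} {H2 : Submodule ℂ (KM Z)}

theorem spanF_le_eigenspace :
    spanF Z ≤ (LieAlgebra.ad ℂ (KM Z) (kmH Z (rhoCheck Z))).eigenspace (-1) :=
  Submodule.span_le.2 (by
    rintro _ ⟨i, rfl⟩
    rw [SetLike.mem_coe, Module.End.mem_eigenspace_iff, LieAlgebra.ad_apply, rhoCheck_lie_kmF,
      neg_one_smul])

theorem spanE_le_eigenspace :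
    spanE Z ≤ (LieAlgebra.ad ℂ (KM Z) (kmH Z (rhoCheck Z))).eigenspace 1 :=
  Submodule.span_le.2 (by
    rintro _ ⟨i, rfl⟩
    rw [SetLike.mem_coe, Module.End.mem_eigenspace_iff, LieAlgebra.ad_apply, rhoCheck_lie_kmE,
      one_smul])

theorem spanE_lie_spanF_mem_cartan' {e f : KM Z} (he : e ∈ spanE Z) (hf : f ∈ spanF Z) :
    ⁅e, f⁆ ∈ cartan' Z :=
  ⟨(isTriangular_km Z).pos_lie_neg e he f hf, lie_mem_derived Z e f⟩

theorem spanF_le_derived : spanF Z ≤ (derived Z).toSubmodule :=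
  Submodule.span_le.2 (Set.range_subset_iff.2 (kmF_mem_derived Z))

theorem spanE_le_derived : spanE Z ≤ (derived Z).toSubmodule :=
  Submodule.span_le.2 (Set.range_subset_iff.2 (kmE_mem_derived Z))

theorem tmul_mem_map_triangular {P : Submodule ℂ (LoopCartan Z n H2)} {a : Laurent n}
    (ha : ∀ h : cartan' Z, (a ⊗ₜ[ℂ] h, 0) ∈ P) {x : KM Z} (hx : x ∈ (derived Z).toSubmodule) :
    a ⊗ₜ[ℂ] x ∈
      ((LieSubalgebra.lieSpan ℂ _ (loopPart n H2 (spanF Z) : Set (loopKM Z n H2))).toSubmodule ⊔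
        P.map (loopCartanLin Z n H2) ⊔
        (LieSubalgebra.lieSpan ℂ _
          (loopPart n H2 (spanE Z) : Set (loopKM Z n H2))).toSubmodule).map
        (loopKM Z n H2).toSubmodule.subtype := by
  obtain ⟨y, hy, h, w, hw, rfl⟩ := exists_add_eq_of_mem_derived Z hx
  rw [nNeg, ← lieSpan_span] at hy
  rw [nPos, ← lieSpan_span] at hw
  rw [Submodule.map_sup, Submodule.map_sup, TensorProduct.tmul_add, TensorProduct.tmul_add]
  exact Submodule.add_mem_sup (Submodule.add_mem_sup
    (loopSub_lieSpan_le_map_lieSpan spanF_le_derived (tmul_mem_loopSub a hy))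
    ⟨_, ⟨_, ha h, rfl⟩, loopCartanMap_tmul_zero a h⟩)
    (loopSub_lieSpan_le_map_lieSpan spanE_le_derived (tmul_mem_loopSub a hw))

theorem loopKM_span_eq_top :
    (LieSubalgebra.lieSpan ℂ _ (loopPart n H2 (spanF Z) : Set (loopKM Z n H2))).toSubmodule ⊔
      LinearMap.range (loopCartanLin Z n H2) ⊔
      (LieSubalgebra.lieSpan ℂ _ (loopPart n H2 (spanE Z) : Set (loopKM Z n H2))).toSubmodule
      = ⊤ := by
  rw [← Submodule.map_top (loopCartanLin Z n H2), ← top_le_iff]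
  refine (Submodule.map_le_map_iff_of_injective
    (loopKM Z n H2).toSubmodule.injective_subtype _ _).1 ?_
  rw [Submodule.map_subtype_top]
  refine sup_le (loopSub_le fun a s hs => tmul_mem_map_triangular (fun _ => Submodule.mem_top) hs)
    (Submodule.map_le_iff_le_comap.2 fun b hb => ⟨loopCartanLin Z n H2 (0, ⟨b, hb⟩), ?_, ?_⟩)
  · exact Submodule.mem_sup_left (Submodule.mem_sup_right ⟨_, Submodule.mem_top, rfl⟩)
  · exact loopCartanMap_zero_right _

theorem loopCartanLin_lie_loopCartanLin (hH2 : IsCartanCompl Z H2) (y z : LoopCartan Z n H2) :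
    ⁅loopCartanLin Z n H2 y, loopCartanLin Z n H2 z⁆ = 0 := by
  have h : ⁅loopCartanMap Z n H2 y, loopCartanMap Z n H2 z⁆ ∈ loopSub n ⊥ :=
    lie_mem_loopSub_of_lie_mem
      (fun _ hx _ hy => (Submodule.mem_bot ℂ).2 (lie_eq_zero_of_mem_cartan Z hx hy))
      (loopCartanMap_mem_loopSub hH2 y) (loopCartanMap_mem_loopSub hH2 z)
  rw [loopSub_bot, Submodule.mem_bot] at h
  exact Subtype.ext h

theorem lie_mem_range_loopCartanLin {e f : loopKM Z n H2} (he : e ∈ loopPart n H2 (spanE Z))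
    (hf : f ∈ loopPart n H2 (spanF Z)) : ⁅e, f⁆ ∈ LinearMap.range (loopCartanLin Z n H2) := by
  obtain ⟨y, hy⟩ := loopSub_cartan'_le_range (H2 := H2)
    (lie_mem_loopSub_of_lie_mem (fun _ he _ hf => spanE_lie_spanF_mem_cartan' he hf) he hf)
  exact ⟨y, Subtype.ext hy⟩

theorem exists_degree (hH2 : IsCartanCompl Z H2) : ∃ d : LoopCartan Z n H2,
    (∀ f ∈ loopPart n H2 (spanF Z), ⁅loopCartanLin Z n H2 d, f⁆ = -f) ∧
      ∀ e ∈ loopPart n H2 (spanE Z), ⁅loopCartanLin Z n H2 d, e⁆ = e := by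
  obtain ⟨d, hd⟩ := exists_loopCartanMap_eq_one_tmul (n := n) hH2
    (Submodule.subset_span ⟨rhoCheck Z, rfl⟩ : kmH Z (rhoCheck Z) ∈ cartan Z)
  have eigen {S : Submodule ℂ (KM Z)} {c : ℂ}
      (hS : S ≤ (LieAlgebra.ad ℂ (KM Z) (kmH Z (rhoCheck Z))).eigenspace c) (x : loopKM Z n H2)
      (hx : x ∈ loopPart n H2 S) : ⁅loopCartanLin Z n H2 d, x⁆ = c • x := by
    have h := loopSub_eigenspace_le _ c (loopSub_mono hS hx)
    rw [Module.End.mem_eigenspace_iff, LieAlgebra.ad_apply, ← hd] at h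
    exact Subtype.ext h
  exact ⟨d, fun f hf => (eigen spanF_le_eigenspace f hf).trans (neg_one_smul ℂ f),
    fun e he => (eigen spanE_le_eigenspace e he).trans (one_smul ℂ e)⟩

/-- The triangular decomposition of `g_A`: the lowering and raising operators are the `a ⊗ f i`
and the `a ⊗ e i`, and the degree is given by an element of `h` with `α i = 1` for all `i`. -/
def loopTri (n : ℕ) (hH2 : IsCartanCompl Z H2) :
    TriangularData ℂ (loopKM Z n H2) (LoopCartan Z n H2) where
  lowering := loopPart n H2 (spanF Z)
  raising := loopPart n H2 (spanE Z)
  cartan := loopCartanLin Z n H2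
  deg := (exists_degree hH2).choose
  cartan_injective := fun _ _ h => loopCartanMap_injective hH2 (congrArg Subtype.val h)
  cartan_lie_cartan := loopCartanLin_lie_loopCartanLin hH2
  cartan_lie_lowering y _ hf := lie_mem_loopSub_of_lie_mem (isTriangular_km Z).cartan_lie_neg
    (loopCartanMap_mem_loopSub hH2 y) hf
  cartan_lie_raising y _ he := lie_mem_loopSub_of_lie_mem (isTriangular_km Z).cartan_lie_pos
    (loopCartanMap_mem_loopSub hH2 y) he
  raising_lie_lowering _ he _ hf := lie_mem_range_loopCartanLin he hf
  deg_lie_lowering := (exists_degree hH2).choose_spec.1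
  deg_lie_raising := (exists_degree hH2).choose_spec.2
  span_eq_top := loopKM_span_eq_top

end LoopTriangular

/-! ### Verma modules and their quotients -/

section LieModuleHom

variable {R L P Q M : Type*} [CommRing R] [LieRing L] [LieAlgebra R L]
  [AddCommGroup P] [Module R P] [LieRingModule L P] [LieModule R L P]
  [AddCommGroup Q] [Module R Q] [LieRingModule L Q] [LieModule R L Q]
  [AddCommGroup M] [Module R M] [LieRingModule L M] [LieModule R L M]

omit [LieAlgebra R L] [LieModule R L P] [LieModule R L Q] [LieModule R L M] in
theorem nonempty_equiv_of_ker_eq_ker {f : P →ₗ⁅R,L⁆ Q} {g : P →ₗ⁅R,L⁆ M}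
    (hf : Function.Surjective f) (hg : Function.Surjective g)
    (h : LinearMap.ker (f : P →ₗ[R] Q) = LinearMap.ker (g : P →ₗ[R] M)) :
    Nonempty (Q ≃ₗ⁅R,L⁆ M) := by
  let e : Q ≃ₗ[R] M := ((f : P →ₗ[R] Q).quotKerEquivOfSurjective hf).symm.trans
    ((Submodule.quotEquivOfEq _ _ h).trans ((g : P →ₗ[R] M).quotKerEquivOfSurjective hg))
  have he (p : P) : e (f p) = g p := by
    have hp : f p = (f : P →ₗ[R] Q).quotKerEquivOfSurjective hf (Submodule.Quotient.mk p) := rfl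
    simp only [e, hp, LinearEquiv.trans_apply, LinearEquiv.symm_apply_apply]
    rfl
  exact ⟨{ e with
    map_lie' := fun {x q} => by
      obtain ⟨p, rfl⟩ := hf q
      change e ⁅x, f p⁆ = ⁅x, e (f p)⁆
      rw [← LieModuleHom.map_lie, he, he, LieModuleHom.map_lie] }⟩

end LieModuleHom

section HighestWeightHom

variable {K L 𝔥 P M : Type*} [Field K] [LieRing L] [LieAlgebra K L] [AddCommGroup 𝔥] [Module K 𝔥]
  [AddCommGroup P] [Module K P] [LieRingModule L P] [LieModule K L P]
  [AddCommGroup M] [Module K M] [LieRingModule L M] [LieModule K L M]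
  {τ : TriangularData K L 𝔥} {ψ : Module.Dual K 𝔥}

omit [LieModule K L P] [LieModule K L M] in
theorem IsHighestWeight.of_lieSpan_eq_top {v : M} {top : Module.Dual K M}
    (h : IsHighestWeight τ ψ v top) (φ : P →ₗ⁅K,L⁆ M) {p : P} (hp : φ p = v)
    (hraise : ∀ e ∈ τ.raising, ⁅e, p⁆ = 0) (hcartan : ∀ y, ⁅τ.cartan y, p⁆ = ψ y • p)
    (hspan : LieSubmodule.lieSpan K L {p} = ⊤) :
    IsHighestWeight τ ψ p (top ∘ₗ (φ : P →ₗ[K] M)) where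
  top_self := by simp [hp, h.top_self]
  raising_lie := hraise
  cartan_lie := hcartan
  top_lowering_lie f hf w := by simp [h.top_lowering_lie f hf]
  top_cartan_lie y w := by simp [h.top_cartan_lie]
  lieSpan_eq_top := hspan

omit [LieModule K L P] [LieModule K L M] in
theorem IsHighestWeight.map {p : P} {top : Module.Dual K M} (φ : P →ₗ⁅K,L⁆ M)
    (h : IsHighestWeight τ ψ p (top ∘ₗ (φ : P →ₗ[K] M))) (hφ : Function.Surjective φ) :
    IsHighestWeight τ ψ (φ p) top where
  top_self := h.top_self
  raising_lie e he := by rw [← LieModuleHom.map_lie, h.raising_lie e he, map_zero]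
  cartan_lie y := by rw [← LieModuleHom.map_lie, h.cartan_lie, map_smul]
  top_lowering_lie f hf w := by
    obtain ⟨w, rfl⟩ := hφ w
    simpa using h.top_lowering_lie f hf w
  top_cartan_lie y w := by
    obtain ⟨w, rfl⟩ := hφ w
    simpa using h.top_cartan_lie y w
  lieSpan_eq_top := by
    have hle : LieSubmodule.lieSpan K L {p} ≤ (LieSubmodule.lieSpan K L {φ p}).comap φ :=
      LieSubmodule.lieSpan_le.2 (Set.singleton_subset_iff.2 (LieSubmodule.subset_lieSpan rfl))
    refine eq_top_iff.2 fun w _ => ?_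
    obtain ⟨w, rfl⟩ := hφ w
    exact hle (h.lieSpan_eq_top ▸ LieSubmodule.mem_top w)

omit [LieModule K L P] [LieModule K L M] in
theorem IsHighestWeight.surjective {v : M} {top : Module.Dual K M}
    (h : IsHighestWeight τ ψ v top) (φ : P →ₗ⁅K,L⁆ M) {p : P} (hp : φ p = v) :
    Function.Surjective φ := by
  rw [← LieModuleHom.range_eq_top, eq_top_iff, ← h.lieSpan_eq_top, LieSubmodule.lieSpan_le,
    Set.singleton_subset_iff]
  exact ⟨p, hp⟩

end HighestWeightHom

section Verma

attribute [local instance] LieRing.ofAssociativeRing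

theorem smul_mem_of_ι_smul_mem {R L M : Type*} [CommRing R] [LieRing L] [LieAlgebra R L]
    [AddCommGroup M] [Module R M] [Module (UniversalEnvelopingAlgebra R L) M]
    [IsScalarTower R (UniversalEnvelopingAlgebra R L) M] {N : Submodule R M}
    (hN : ∀ x : L, ∀ w ∈ N, UniversalEnvelopingAlgebra.ι R x • w ∈ N)
    (u : UniversalEnvelopingAlgebra R L) : ∀ w ∈ N, u • w ∈ N := by
  let A : Subalgebra R (UniversalEnvelopingAlgebra R L) :=
    { carrier := {u | ∀ w ∈ N, u • w ∈ N}
      mul_mem' := fun ha hb w hw => by rw [mul_smul]; exact ha _ (hb w hw)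
      add_mem' := fun ha hb w hw => by rw [add_smul]; exact N.add_mem (ha w hw) (hb w hw)
      algebraMap_mem' := fun c w hw => by rw [algebraMap_smul]; exact N.smul_mem c hw }
  let g : L →ₗ⁅R⁆ A :=
    { toFun := fun x => ⟨UniversalEnvelopingAlgebra.ι R x, hN x⟩
      map_add' := fun x y => Subtype.ext (map_add (UniversalEnvelopingAlgebra.ι R) x y)
      map_smul' := fun c x => Subtype.ext (map_smul (UniversalEnvelopingAlgebra.ι R) c x)
      map_lie' := fun {x y} => Subtype.ext (LieHom.map_lie (UniversalEnvelopingAlgebra.ι R) x y) }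
  have hid : A.val.comp (UniversalEnvelopingAlgebra.lift R g) = AlgHom.id R _ :=
    UniversalEnvelopingAlgebra.hom_ext R (LieHom.ext fun x =>
      congrArg Subtype.val (UniversalEnvelopingAlgebra.lift_ι_apply R g x))
  have hu : (UniversalEnvelopingAlgebra.lift R g u : UniversalEnvelopingAlgebra R L) = u :=
    AlgHom.congr_fun hid u
  exact hu ▸ (UniversalEnvelopingAlgebra.lift R g u).2

variable {ι : Type*} [Fintype ι] {C : Matrix ι ι ℤ} {H : Type*} [AddCommGroup H] [Module ℂ H]
  {Z : Realization C H} {n : ℕ} {H2 : Submodule ℂ (KM Z)}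
  {ψ : Module.Dual ℂ (LoopCartan Z n H2)}

instance : LieRingModule (loopKM Z n H2) (Verma ψ) :=
  let _ : LieRingModule (UEA Z n H2) (Verma ψ) := LieRingModule.ofAssociativeModule
  LieRingModule.compLieHom (Verma ψ) (UniversalEnvelopingAlgebra.ι ℂ)

instance : LieModule ℂ (loopKM Z n H2) (Verma ψ) :=
  let _ : LieRingModule (UEA Z n H2) (Verma ψ) := LieRingModule.ofAssociativeModule
  let _ : LieModule ℂ (UEA Z n H2) (Verma ψ) := LieModule.ofAssociativeModule
  LieModule.compLieHom (Verma ψ) (UniversalEnvelopingAlgebra.ι ℂ)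

/-- A `g_A`-submodule of `M(ψ)`, as a module over the enveloping algebra. -/
def envSubmodule (N : LieSubmodule ℂ (loopKM Z n H2) (Verma ψ)) :
    Submodule (UEA Z n H2) (Verma ψ) :=
  { N with
    smul_mem' := fun u _ hw =>
      smul_mem_of_ι_smul_mem (N := N.toSubmodule) (fun _ _ hw => N.lie_mem hw) u _ hw }

/-- A submodule of `M(ψ)` over the enveloping algebra, as a `g_A`-submodule. -/
def lieSubmodule (N : Submodule (UEA Z n H2) (Verma ψ)) :
    LieSubmodule ℂ (loopKM Z n H2) (Verma ψ) :=
  { N.restrictScalars ℂ with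
    lie_mem := fun {x} _ hw => N.smul_mem (UniversalEnvelopingAlgebra.ι ℂ x) hw }

/-- The highest weight vector of `M(ψ)`. -/
def vermaVec (ψ : Module.Dual ℂ (LoopCartan Z n H2)) : Verma ψ := Submodule.Quotient.mk 1

theorem lieSpan_vermaVec_eq_top :
    LieSubmodule.lieSpan ℂ (loopKM Z n H2) {vermaVec ψ} = ⊤ := by
  refine eq_top_iff.2 fun w _ => ?_
  obtain ⟨u, rfl⟩ := Submodule.Quotient.mk_surjective _ w
  have := (envSubmodule (LieSubmodule.lieSpan ℂ (loopKM Z n H2) {vermaVec ψ})).smul_mem u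
    (LieSubmodule.subset_lieSpan rfl)
  rwa [vermaVec, ← Submodule.Quotient.mk_smul, smul_eq_mul, mul_one] at this

theorem raising_lie_vermaVec {x : loopKM Z n H2} (hx : x ∈ loopPart n H2 (nPos Z).toSubmodule) :
    ⁅x, vermaVec ψ⁆ = 0 := by
  change Submodule.Quotient.mk (UniversalEnvelopingAlgebra.ι ℂ x * 1) = 0
  rw [mul_one, Submodule.Quotient.mk_eq_zero]
  exact Submodule.subset_span (Or.inl ⟨x, hx, rfl⟩)

theorem cartan_lie_vermaVec (y : LoopCartan Z n H2) :
    ⁅loopCartanLin Z n H2 y, vermaVec ψ⁆ = ψ y • vermaVec ψ := by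
  change (Submodule.Quotient.mk (UniversalEnvelopingAlgebra.ι ℂ (loopCartanIncl Z n H2 y) * 1) :
    Verma ψ) = Submodule.Quotient.mk (ψ y • (1 : UEA Z n H2))
  rw [mul_one, ← Algebra.algebraMap_eq_smul_one, Submodule.Quotient.eq]
  exact Submodule.subset_span (Or.inr ⟨y, rfl⟩)

variable {M : Type*} [AddCommGroup M] [Module ℂ M] [LieRingModule (loopKM Z n H2) M]
  [LieModule ℂ (loopKM Z n H2) M] {hH2 : IsCartanCompl Z H2} {v : M} {top : Module.Dual ℂ M}

theorem IsHighestWeight.nPos_lie (h : IsHighestWeight (loopTri n hH2) ψ v top)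
    {x : loopKM Z n H2} (hx : x ∈ loopPart n H2 (nPos Z).toSubmodule) : ⁅x, v⁆ = 0 := by
  change (x : Laurent n ⊗[ℂ] KM Z) ∈ loopSub n
    (LieSubalgebra.lieSpan ℂ (KM Z) (Set.range (kmE Z))).toSubmodule at hx
  rw [← lieSpan_span] at hx
  obtain ⟨x', hx', heq⟩ := loopSub_lieSpan_le_map_lieSpan (H2 := H2) spanE_le_derived hx
  obtain rfl : x' = x := Subtype.ext heq
  exact lie_eq_zero_of_mem_lieSpan h.raising_lie hx'

theorem IsHighestWeight.exists_vermaHom (h : IsHighestWeight (loopTri n hH2) ψ v top) :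
    ∃ φ : Verma ψ →ₗ⁅ℂ,loopKM Z n H2⁆ M, φ (vermaVec ψ) = v := by
  let ρ : UEA Z n H2 →ₐ[ℂ] Module.End ℂ M :=
    UniversalEnvelopingAlgebra.lift ℂ (LieModule.toEnd ℂ (loopKM Z n H2) M)
  let _ : Module (UEA Z n H2) M := Module.compHom M ρ.toRingHom
  have hsmul (u : UEA Z n H2) (w : M) : u • w = ρ u w := rfl
  have hι (x : loopKM Z n H2) (w : M) : UniversalEnvelopingAlgebra.ι ℂ x • w = ⁅x, w⁆ := by
    rw [hsmul, UniversalEnvelopingAlgebra.lift_ι_apply, LieModule.toEnd_apply_apply]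
  have hker : vermaIdeal ψ ≤ LinearMap.ker (LinearMap.toSpanSingleton (UEA Z n H2) M v) := by
    refine Submodule.span_le.2 ?_
    rintro _ (⟨x, hx, rfl⟩ | ⟨y, rfl⟩)
    · exact (hι x v).trans (h.nPos_lie hx)
    · refine (sub_smul _ _ v).trans (sub_eq_zero.2 ((hι _ v).trans ((h.cartan_lie y).trans ?_)))
      rw [hsmul, AlgHom.commutes, Module.algebraMap_end_apply]
  let φ : Verma ψ →ₗ[UEA Z n H2] M := (vermaIdeal ψ).liftQ _ hker
  refine ⟨{ toFun := φ
            map_add' := map_add φ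
            map_smul' := fun c w => ?_
            map_lie' := fun {x w} => (map_smul φ _ w).trans (hι x _) }, one_smul (UEA Z n H2) v⟩
  rw [RingHom.id_apply, ← algebraMap_smul (UEA Z n H2) c w, map_smul, hsmul, AlgHom.commutes,
    Module.algebraMap_end_apply]

omit [LieModule ℂ (loopKM Z n H2) M] in
theorem IsHighestWeight.comp_vermaHom (h : IsHighestWeight (loopTri n hH2) ψ v top)
    {φ : Verma ψ →ₗ⁅ℂ,loopKM Z n H2⁆ M} (hφ : φ (vermaVec ψ) = v) :
    IsHighestWeight (loopTri n hH2) ψ (vermaVec ψ) (top ∘ₗ (φ : Verma ψ →ₗ[ℂ] M)) :=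
  h.of_lieSpan_eq_top φ hφ
    (fun _ he => raising_lie_vermaVec (loopSub_mono
      (Submodule.span_le.2 LieSubalgebra.subset_lieSpan) he))
    cartan_lie_vermaVec lieSpan_vermaVec_eq_top

theorem IsHighestWeight.vermaMax_le_ker {t : Module.Dual ℂ (Verma ψ)}
    (h : IsHighestWeight (loopTri n hH2) ψ (vermaVec ψ) t) :
    (lieSubmodule (vermaMax ψ)).toSubmodule ≤ LinearMap.ker t := by
  intro w hw
  change w ∈ vermaMax ψ at hw
  rw [vermaMax, sSup_eq_iSup'] at hw
  induction hw using Submodule.iSup_induction' with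
  | mem N w hw =>
    have hN : lieSubmodule N.1 ≠ ⊤ := fun hN => N.2 (eq_top_iff.2 fun w _ =>
      (hN ▸ LieSubmodule.mem_top w : w ∈ lieSubmodule N.1))
    exact h.le_ker_top hN hw
  | zero => exact zero_mem _
  | add _ _ _ _ hw hw' => exact add_mem hw hw'

theorem le_vermaMax {N : LieSubmodule ℂ (loopKM Z n H2) (Verma ψ)} (hN : vermaVec ψ ∉ N) :
    N ≤ lieSubmodule (vermaMax ψ) :=
  have hle : envSubmodule N ≤ vermaMax ψ := le_sSup fun h : envSubmodule N = ⊤ =>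
    hN (h ▸ Submodule.mem_top : vermaVec ψ ∈ envSubmodule N)
  hle

/-- The projection of `M(ψ)` onto `V(ψ)`. -/
def vermaProj (ψ : Module.Dual ℂ (LoopCartan Z n H2)) : Verma ψ →ₗ⁅ℂ,loopKM Z n H2⁆ V ψ :=
  { (vermaMax ψ).mkQ.restrictScalars ℂ with map_lie' := rfl }

theorem vermaProj_surjective : Function.Surjective (vermaProj ψ) :=
  (vermaMax ψ).mkQ_surjective

theorem vermaProj_eq_zero_iff {w : Verma ψ} : vermaProj ψ w = 0 ↔ w ∈ vermaMax ψ :=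
  Submodule.Quotient.mk_eq_zero _

theorem exists_isHighestWeight_V (hH2 : IsCartanCompl Z H2)
    (ψ : Module.Dual ℂ (LoopCartan Z n H2)) : ∃ top : Module.Dual ℂ (V ψ),
      IsHighestWeight (loopTri n hH2) ψ (vermaProj ψ (vermaVec ψ)) top ∧
      IsNondegenerate (loopKM Z n H2) top := by
  obtain ⟨M, _, _, _, _, v, top, h⟩ := (loopTri n hH2).exists_isHighestWeight ψ
  obtain ⟨φ, hφ⟩ := h.exists_vermaHom
  have hVerma := h.comp_vermaHom hφ
  let t : Module.Dual ℂ (V ψ) :=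
    (((vermaMax ψ).restrictScalars ℂ).liftQ _ hVerma.vermaMax_le_ker) ∘ₗ
      (Submodule.Quotient.restrictScalarsEquiv ℂ (vermaMax ψ)).symm.toLinearMap
  have hV : IsHighestWeight (loopTri n hH2) ψ (vermaProj ψ (vermaVec ψ)) t :=
    IsHighestWeight.map (vermaProj ψ) hVerma vermaProj_surjective
  refine ⟨t, hV, fun N hN => (LieSubmodule.eq_bot_iff N).2 fun w hw => ?_⟩
  obtain ⟨w, rfl⟩ := vermaProj_surjective w
  have htop : vermaVec ψ ∉ N.comap (vermaProj ψ) := fun hv =>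
    one_ne_zero (hV.top_self.symm.trans (hN hv))
  exact vermaProj_eq_zero_iff.2 (le_vermaMax htop hw)

theorem isIrreducible_V (hH2 : IsCartanCompl Z H2) (ψ : Module.Dual ℂ (LoopCartan Z n H2)) :
    LieModule.IsIrreducible ℂ (loopKM Z n H2) (V ψ) := by
  obtain ⟨_, h, hnd⟩ := exists_isHighestWeight_V hH2 ψ
  exact h.isIrreducible hnd

theorem IsHighestWeight.nonempty_equiv (h : IsHighestWeight (loopTri n hH2) ψ v top)
    (hnd : IsNondegenerate (loopKM Z n H2) top) :
    Nonempty (V ψ ≃ₗ⁅ℂ,loopKM Z n H2⁆ M) := by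
  obtain ⟨φ, hφ⟩ := h.exists_vermaHom
  have htop : vermaVec ψ ∉ φ.ker := fun hv => by
    have := h.top_self
    rw [← hφ, LieModuleHom.mem_ker.1 hv, map_zero] at this
    exact zero_ne_one this
  have hmap : (lieSubmodule (vermaMax ψ)).map φ = ⊥ := hnd _ fun w hw => by
    obtain ⟨w, hw, rfl⟩ := hw
    exact (h.comp_vermaHom hφ).vermaMax_le_ker hw
  refine nonempty_equiv_of_ker_eq_ker vermaProj_surjective (h.surjective φ hφ)
    (Submodule.ext fun w => vermaProj_eq_zero_iff.trans ⟨fun hw => ?_, fun hw => ?_⟩)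
  · have : φ w ∈ (lieSubmodule (vermaMax ψ)).map φ := LieSubmodule.mem_map_of_mem hw
    rwa [hmap] at this
  · exact le_vermaMax htop hw

end Verma

/-! ### Tensor products of the modules `V(ψ)` -/

section LoopIdeal

variable {ι : Type*} [Fintype ι] {C : Matrix ι ι ℤ} {H : Type*} [AddCommGroup H] [Module ℂ H]
  {Z : Realization C H} {n : ℕ} {H2 : Submodule ℂ (KM Z)}

/-- The subspace `g' ⊗ I` of `g ⊗ A`. -/
def loopIdealSpan (Z : Realization C H) {n : ℕ} (I : Ideal (Laurent n)) :
    Submodule ℂ (Laurent n ⊗[ℂ] KM Z) :=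
  Submodule.map₂ (TensorProduct.mk ℂ (Laurent n) (KM Z)) (I.restrictScalars ℂ)
    (derived Z).toSubmodule

theorem lie_mem_loopIdealSpan {I : Ideal (Laurent n)} (x : Laurent n ⊗[ℂ] KM Z) :
    loopIdealSpan Z I ≤ (loopIdealSpan Z I).comap (LieAlgebra.ad ℂ _ x) := by
  refine Submodule.map₂_le.2 fun a ha y _ => ?_
  rw [Submodule.mem_comap, LieAlgebra.ad_apply, TensorProduct.mk_apply]
  induction x using TensorProduct.induction_on with
  | zero => rw [zero_lie]; exact zero_mem _
  | add x x' hx hx' => rw [add_lie]; exact add_mem hx hx'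
  | tmul b x =>
    exact Submodule.apply_mem_map₂ _ (I.mul_mem_left b ha) (lie_mem_derived Z x y)

/-- The ideal `g' ⊗ I` of `g_A`. -/
def loopIdeal (H2 : Submodule ℂ (KM Z)) (I : Ideal (Laurent n)) : LieIdeal ℂ (loopKM Z n H2) :=
  { (loopIdealSpan Z I).comap (loopKM Z n H2).toSubmodule.subtype with
    lie_mem := fun {x} _ hy => lie_mem_loopIdealSpan (x : Laurent n ⊗[ℂ] KM Z) hy }

theorem loopIdealSpan_le_loopSub (I : Ideal (Laurent n)) :
    loopIdealSpan Z I ≤ loopSub n (derived Z).toSubmodule :=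
  Submodule.map₂_le.2 fun a _ _ hy => tmul_mem_loopSub a hy

theorem loopIdealSpan_top :
    loopIdealSpan Z (⊤ : Ideal (Laurent n)) = loopSub n (derived Z).toSubmodule :=
  (loopIdealSpan_le_loopSub ⊤).antisymm
    (loopSub_le fun _ _ hy => Submodule.apply_mem_map₂ _ Submodule.mem_top hy)

theorem smul_mem_loopIdealSpan {I : Ideal (Laurent n)} {r : Laurent n} (hr : r ∈ I) :
    loopIdealSpan Z (⊤ : Ideal (Laurent n)) ≤
      (loopIdealSpan Z I).comap (Algebra.lsmul ℂ ℂ (Laurent n ⊗[ℂ] KM Z) r) :=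
  Submodule.map₂_le.2 fun a _ _ hy =>
    Submodule.apply_mem_map₂ _ (I.mul_mem_right a hr) hy

theorem loopIdeal_top_sup_range :
    (loopIdeal H2 (⊤ : Ideal (Laurent n))).toSubmodule ⊔ LinearMap.range (loopCartanLin Z n H2) =
      ⊤ := by
  refine eq_top_iff.2 fun ⟨x, hx⟩ _ => ?_
  obtain ⟨a, ha, _, ⟨b, hb, rfl⟩, rfl⟩ := Submodule.mem_sup.1 hx
  exact Submodule.mem_sup.2 ⟨⟨a, loopSub_derived_le ha⟩, loopIdealSpan_top.symm.le ha,
    loopCartanLin Z n H2 (0, ⟨b, hb⟩), ⟨_, rfl⟩,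
    Subtype.ext (congrArg (a + ·) (loopCartanMap_zero_right ⟨b, hb⟩))⟩

end LoopIdeal

section IdealCore

variable {K A : Type*} [CommRing K] [CommRing A] [Algebra K A] {φ : Module.Dual K A}

/-- The largest ideal contained in the kernel of the functional `φ`. -/
def idealCore (φ : Module.Dual K A) : Ideal A where
  carrier := {a | ∀ b, φ (a * b) = 0}
  add_mem' ha ha' b := by rw [add_mul, map_add, ha, ha', add_zero]
  zero_mem' b := by rw [zero_mul, map_zero]
  smul_mem' c a ha b := by rw [smul_eq_mul, mul_comm c, mul_assoc]; exact ha _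

theorem apply_eq_zero_of_mem_idealCore {a : A} (ha : a ∈ idealCore φ) : φ a = 0 :=
  mul_one a ▸ ha 1

end IdealCore

section TensorDecomposition

variable {ι : Type*} [Fintype ι] {C : Matrix ι ι ℤ} {H : Type*} [AddCommGroup H] [Module ℂ H]
  {Z : Realization C H} {n : ℕ} {H2 : Submodule ℂ (KM Z)}

/-- The functional `a ↦ ψ(h ⊗ a)` on `A`, the linear extension of `component ψ h`. -/
def componentLin (ψ : Module.Dual ℂ (LoopCartan Z n H2)) :
    cartan' Z →ₗ[ℂ] Module.Dual ℂ (Laurent n) :=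
  (TensorProduct.curry (ψ ∘ₗ LinearMap.inl ℂ _ _)).flip

/-- The largest ideal `I` of `A` such that `ψ` vanishes on `h' ⊗ I`. -/
def weightIdeal (ψ : Module.Dual ℂ (LoopCartan Z n H2)) : Ideal (Laurent n) :=
  ⨅ h, idealCore (componentLin ψ h)

theorem apply_tmul_eq_zero_of_mem_weightIdeal {ψ : Module.Dual ℂ (LoopCartan Z n H2)}
    {a : Laurent n} (ha : a ∈ weightIdeal ψ) (h : cartan' Z) : ψ (a ⊗ₜ[ℂ] h, 0) = 0 :=
  apply_eq_zero_of_mem_idealCore ((Submodule.mem_iInf _).1 ha h)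

theorem lie_eq_zero_of_mem_loopIdeal (hH2 : IsCartanCompl Z H2)
    {ψ : Module.Dual ℂ (LoopCartan Z n H2)} {x : loopKM Z n H2}
    (hx : x ∈ loopIdeal H2 (weightIdeal ψ)) (w : V ψ) : ⁅x, w⁆ = 0 := by
  obtain ⟨_, h, hnd⟩ := exists_isHighestWeight_V hH2 ψ
  refine h.lie_eq_zero_of_mem_ideal hnd (fun y hy => ?_) hx w
  have hle : loopIdealSpan Z (weightIdeal ψ) ≤ _ := Submodule.map₂_le.2 fun a ha y hy =>
    tmul_mem_map_triangular (P := LinearMap.ker ψ)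
      (apply_tmul_eq_zero_of_mem_weightIdeal ha) hy
  obtain ⟨y', hy', heq⟩ := hle hy
  exact (Subtype.ext heq : y' = y) ▸ hy'

variable {κ : Type*} {Ψ : κ → Module.Dual ℂ (LoopCartan Z n H2)}

-- By the Chinese remainder theorem there is `r` congruent to `1` modulo the weight ideal of `Ψ k`
-- and to `0` modulo the others; then `r • x` acts like `x` on `V (Ψ k)` and by `0` elsewhere.
theorem separatesFactors_loopIdeal_top [Finite κ] (hH2 : IsCartanCompl Z H2)
    (hΨ : Pairwise (Function.onFun IsCoprime fun k => weightIdeal (Ψ k))) :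
    SeparatesFactors (fun k => V (Ψ k)) (loopIdeal H2 (⊤ : Ideal (Laurent n))) := by
  classical
  intro k x hx
  obtain ⟨r, hr⟩ := Ideal.exists_forall_sub_mem_ideal hΨ (Pi.single k 1)
  have hrx : r • (x : Laurent n ⊗[ℂ] KM Z) ∈ loopKM Z n H2 := loopSub_derived_le
    (loopIdealSpan_top.le (smul_mem_loopIdealSpan (Submodule.mem_top (x := r)) hx))
  refine ⟨⟨r • x, hrx⟩, fun w => ?_, fun l hl w => lie_eq_zero_of_mem_loopIdeal hH2 ?_ w⟩
  · have hk := hr k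
    rw [Pi.single_eq_same] at hk
    rw [← sub_eq_zero, ← sub_lie]
    refine lie_eq_zero_of_mem_loopIdeal hH2 ?_ w
    have hmem : (r - 1) • (x : Laurent n ⊗[ℂ] KM Z) ∈ loopIdealSpan Z (weightIdeal (Ψ k)) :=
      smul_mem_loopIdealSpan hk hx
    rwa [sub_smul, one_smul] at hmem
  · have hl' := hr l
    rw [Pi.single_eq_of_ne hl, sub_zero] at hl'
    exact smul_mem_loopIdealSpan hl' hx

theorem nonempty_equiv_tensor [Fintype κ] [DecidableEq κ] (hH2 : IsCartanCompl Z H2)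
    (hΨ : Pairwise (Function.onFun IsCoprime fun k => weightIdeal (Ψ k))) :
    Nonempty (V (∑ k, Ψ k) ≃ₗ⁅ℂ,loopKM Z n H2⁆ ⨂[ℂ] k, V (Ψ k)) := by
  choose top htop hnd using fun k => exists_isHighestWeight_V hH2 (Ψ k)
  have hsep := separatesFactors_loopIdeal_top hH2 hΨ
  have hlow : ∀ f ∈ (loopTri n hH2).lowering, f ∈ loopIdeal H2 (⊤ : Ideal (Laurent n)) :=
    fun _ hf => loopIdealSpan_top.symm.le (loopSub_mono spanF_le_derived hf)
  exact (isHighestWeight_tensor htop hlow hsep).nonempty_equiv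
    (isNondegenerate_tensor htop hnd loopIdeal_top_sup_range hsep)

end TensorDecomposition

/-! ### Exp-polynomial maps -/

section ExpFunctional

variable {n : ℕ}

/-- The character `m ↦ λ₁^{m₁} ⋯ λₙ^{mₙ}` of `ℤⁿ`. -/
def expChar (l : Fin n → ℂˣ) (m : Fin n → ℤ) : ℂ :=
  ∏ i, (l i : ℂ) ^ m i

theorem expChar_zero_right (l : Fin n → ℂˣ) : expChar l 0 = 1 :=
  Finset.prod_eq_one fun _ _ => zpow_zero _

theorem expChar_add_right (l : Fin n → ℂˣ) (m m' : Fin n → ℤ) :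
    expChar l (m + m') = expChar l m * expChar l m' := by
  rw [expChar, expChar, expChar, ← Finset.prod_mul_distrib]
  exact Finset.prod_congr rfl fun i _ => zpow_add₀ (l i).ne_zero _ _

theorem expChar_mul_left (l l' : Fin n → ℂˣ) (m : Fin n → ℤ) :
    expChar (l * l') m = expChar l m * expChar l' m := by
  rw [expChar, expChar, expChar, ← Finset.prod_mul_distrib]
  refine Finset.prod_congr rfl fun i _ => ?_
  rw [Pi.mul_apply, Units.val_mul, mul_zpow]

theorem expChar_single (l : Fin n → ℂˣ) (i : Fin n) (k : ℤ) :
    expChar l (Pi.single i k) = (l i : ℂ) ^ k := by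
  rw [expChar, Finset.prod_eq_single_of_mem i (Finset.mem_univ i), Pi.single_eq_same]
  intro j _ hj
  rw [Pi.single_eq_of_ne hj, zpow_zero]

/-- The automorphism `tᵢ ↦ λᵢ tᵢ` of `A`. -/
def scaleVars (l : Fin n → ℂˣ) : Laurent n →ₐ[ℂ] Laurent n :=
  AddMonoidAlgebra.lift ℂ (Laurent n) (Fin n → ℤ)
    { toFun := fun m => expChar l m.toAdd • mono m.toAdd
      map_one' := by rw [toAdd_one, expChar_zero_right, one_smul, mono_zero]
      map_mul' := fun m m' => by
        rw [toAdd_mul, expChar_add_right, smul_mul_smul_comm, mono_mul] }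

theorem scaleVars_mono (l : Fin n → ℂˣ) (m : Fin n → ℤ) :
    scaleVars l (mono m) = expChar l m • mono m :=
  (AddMonoidAlgebra.lift_single _ m 1).trans (one_smul ℂ _)

/-- The functional `t^m ↦ m₁^{ℓ₁} ⋯ mₙ^{ℓₙ} λ₁^{m₁} ⋯ λₙ^{mₙ}` on `A`, where `p = (ℓ, λ)`. -/
def expFunctional (p : (Fin n → ℕ) × (Fin n → ℂˣ)) : Module.Dual ℂ (Laurent n) :=
  (monoBasis n).constr ℂ fun m => (∏ i, (m i : ℂ) ^ p.1 i) * expChar p.2 m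

theorem expFunctional_mono (p : (Fin n → ℕ) × (Fin n → ℂˣ)) (m : Fin n → ℤ) :
    expFunctional p (mono m) = (∏ i, (m i : ℂ) ^ p.1 i) * expChar p.2 m := by
  rw [expFunctional, ← monoBasis_apply, Module.Basis.constr_basis]

theorem expFunctional_comp_scaleVars (p : (Fin n → ℕ) × (Fin n → ℂˣ)) (l : Fin n → ℂˣ) :
    expFunctional p ∘ₗ (scaleVars l).toLinearMap = expFunctional (p.1, l * p.2) := by
  refine (monoBasis n).ext fun m => ?_
  rw [monoBasis_apply, LinearMap.comp_apply, AlgHom.toLinearMap_apply, scaleVars_mono, map_smul,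
    expFunctional_mono, expFunctional_mono, expChar_mul_left, smul_eq_mul]
  exact mul_left_comm _ _ _

theorem expFunctional_sub_pow_mul (p : (Fin n → ℕ) × (Fin n → ℂˣ)) (i : Fin n) (N : ℕ)
    (m : Fin n → ℤ) :
    expFunctional p ((mono (Pi.single i 1) - algebraMap ℂ (Laurent n) (p.2 i)) ^ N * mono m) =
      (p.2 i : ℂ) ^ N * expChar p.2 m * (∏ j ∈ Finset.univ.erase i, (m j : ℂ) ^ p.1 j) *
        ((fwdDiff (1 : ℂ))^[N] fun x => x ^ p.1 i) (m i) := by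
  induction N generalizing m with
  | zero =>
    rw [pow_zero, one_mul, expFunctional_mono, pow_zero, one_mul, Function.iterate_zero, id,
      ← Finset.mul_prod_erase _ _ (Finset.mem_univ i)]
    ring
  | succ N ih =>
    have hsplit : (mono (Pi.single i 1) - algebraMap ℂ (Laurent n) (p.2 i)) ^ (N + 1) * mono m =
        (mono (Pi.single i 1) - algebraMap ℂ (Laurent n) (p.2 i)) ^ N * mono (m + Pi.single i 1) -
          (p.2 i : ℂ) • ((mono (Pi.single i 1) - algebraMap ℂ (Laurent n) (p.2 i)) ^ N *
            mono m) := by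
      rw [← mono_mul, Algebra.smul_def]; ring
    have herase : ∏ j ∈ Finset.univ.erase i, ((m + Pi.single i 1 : Fin n → ℤ) j : ℂ) ^ p.1 j =
        ∏ j ∈ Finset.univ.erase i, (m j : ℂ) ^ p.1 j := by
      refine Finset.prod_congr rfl fun j hj => ?_
      rw [Pi.add_apply, Pi.single_eq_of_ne (Finset.ne_of_mem_erase hj), add_zero]
    rw [hsplit, map_sub, map_smul, ih, ih, herase, expChar_add_right, expChar_single, zpow_one,
      Function.iterate_succ_apply', fwdDiff, Pi.add_apply, Pi.single_eq_same, Int.cast_add,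
      Int.cast_one, smul_eq_mul]
    ring

-- `tᵢ - λᵢ` acts on the polynomial factor `mᵢ^{ℓᵢ}` as a forward difference.
theorem sub_pow_mem_idealCore (p : (Fin n → ℕ) × (Fin n → ℂˣ)) (i : Fin n) :
    (mono (Pi.single i 1) - algebraMap ℂ (Laurent n) (p.2 i)) ^ (p.1 i + 1) ∈
      idealCore (expFunctional p) := by
  suffices h : expFunctional p ∘ₗ LinearMap.mulLeft ℂ
      ((mono (Pi.single i 1) - algebraMap ℂ (Laurent n) (p.2 i)) ^ (p.1 i + 1)) = 0 from
    fun b => LinearMap.congr_fun h b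
  refine (monoBasis n).ext fun m => ?_
  rw [monoBasis_apply, LinearMap.comp_apply, LinearMap.mulLeft_apply, expFunctional_sub_pow_mul,
    fwdDiff_iter_pow_eq_zero_of_lt (Nat.lt_succ_self _)]
  exact mul_zero _

theorem isCoprime_idealCore_expFunctional {p q : (Fin n → ℕ) × (Fin n → ℂˣ)} (h : p.2 ≠ q.2) :
    IsCoprime (idealCore (expFunctional p)) (idealCore (expFunctional q)) := by
  obtain ⟨i, hi⟩ := Function.ne_iff.1 h
  have hne : (q.2 i : ℂ) - p.2 i ≠ 0 := sub_ne_zero.2 fun h => hi (Units.ext h.symm)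
  have hc : IsCoprime ((mono (Pi.single i 1) : Laurent n) - algebraMap ℂ (Laurent n) (p.2 i))
      (mono (Pi.single i 1) - algebraMap ℂ (Laurent n) (q.2 i)) := by
    refine ⟨algebraMap ℂ _ ((q.2 i : ℂ) - p.2 i)⁻¹, -algebraMap ℂ _ ((q.2 i : ℂ) - p.2 i)⁻¹, ?_⟩
    calc _ = algebraMap ℂ (Laurent n) ((q.2 i : ℂ) - p.2 i)⁻¹ *
        (algebraMap ℂ _ (q.2 i : ℂ) - algebraMap ℂ _ (p.2 i : ℂ)) := by ring
      _ = 1 := by rw [← map_sub, ← map_mul, inv_mul_cancel₀ hne, map_one]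
  obtain ⟨a, b, hab⟩ := hc.pow (m := p.1 i + 1) (n := q.1 i + 1)
  exact Ideal.isCoprime_iff_exists.2 ⟨_, Ideal.mul_mem_left _ a (sub_pow_mem_idealCore p i), _,
    Ideal.mul_mem_left _ b (sub_pow_mem_idealCore q i), hab⟩

end ExpFunctional

section ExpPolySpan

variable {n : ℕ} {S T : Set (Fin n → ℂˣ)}

theorem isCoprime_idealCore_of_mem_span {K A : Type*} [CommRing K] [CommRing A] [Algebra K A]
    {s : Set (Module.Dual K A)} {J : Ideal A} (hs : ∀ φ ∈ s, IsCoprime (idealCore φ) J)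
    {φ : Module.Dual K A} (hφ : φ ∈ Submodule.span K s) : IsCoprime (idealCore φ) J := by
  have hmono {I I' : Ideal A} (hle : I ≤ I') (h : IsCoprime I J) : IsCoprime I' J :=
    Ideal.isCoprime_iff_codisjoint.2 (h.codisjoint.mono_left hle)
  induction hφ using Submodule.span_induction with
  | mem φ hφ => exact hs φ hφ
  | zero => exact hmono (fun _ _ _ => rfl) (isCoprime_one_left (x := J))
  | add φ φ' _ _ h h' =>
    refine hmono (fun a ha b => ?_) (h.mul_left h')
    rw [LinearMap.add_apply, Ideal.mul_le_inf.trans inf_le_left ha b,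
      Ideal.mul_le_inf.trans inf_le_right ha b, add_zero]
  | smul c φ _ h =>
    refine hmono (fun a ha b => ?_) h
    rw [LinearMap.smul_apply, ha b, smul_zero]

/-- The functionals on `A` whose values on the monomials form an exp-polynomial function with
exponents in `S`. -/
def expPolySpan (S : Set (Fin n → ℂˣ)) : Submodule ℂ (Module.Dual ℂ (Laurent n)) :=
  Submodule.span ℂ (expFunctional '' {p | p.2 ∈ S})

theorem isExpPolyOn_iff_mem_expPolySpan {φ : Module.Dual ℂ (Laurent n)} :
    IsExpPolyOn S (fun m => φ (mono m)) ↔ φ ∈ expPolySpan S := by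
  rw [expPolySpan, Finsupp.mem_span_image_iff_linearCombination]
  refine exists_congr fun c => and_congr Iff.rfl ?_
  have hsum (m : Fin n → ℤ) : Finsupp.linearCombination ℂ expFunctional c (mono m) =
      c.sum fun p z => z * (∏ i, (m i : ℂ) ^ p.1 i) * ∏ i, (p.2 i : ℂ) ^ m i := by
    rw [Finsupp.linearCombination_apply, Finsupp.sum, LinearMap.sum_apply]
    refine Finset.sum_congr rfl fun p _ => ?_
    rw [LinearMap.smul_apply, expFunctional_mono, smul_eq_mul, ← mul_assoc, expChar]
  refine ⟨fun h => (monoBasis n).ext fun m => ?_, fun h m => ?_⟩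
  · rw [monoBasis_apply, hsum, ← h]
  · rw [← hsum, h]

theorem isCoprime_idealCore_of_mem_expPolySpan (hST : Disjoint S T)
    {φ φ' : Module.Dual ℂ (Laurent n)} (hφ : φ ∈ expPolySpan S) (hφ' : φ' ∈ expPolySpan T) :
    IsCoprime (idealCore φ) (idealCore φ') := by
  refine isCoprime_idealCore_of_mem_span ?_ hφ
  rintro _ ⟨p, hp, rfl⟩
  refine IsCoprime.symm (isCoprime_idealCore_of_mem_span ?_ hφ')
  rintro _ ⟨q, hq, rfl⟩
  exact isCoprime_idealCore_expFunctional (hST.ne_of_mem hp hq).symm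

end ExpPolySpan

/-! ### Twists -/

section RootVector

variable {n : ℕ} {r : Fin n → ℕ} {ξ : Fin n → ℂˣ}

/-- The vector `(ξ₁^{k₁}, …, ξₙ^{kₙ})`, through which `k` acts on `(ℂ*)ⁿ` and on `A`. -/
def rootVector (ξ : Fin n → ℂˣ) (k : ∀ i, ZMod (r i)) : Fin n → ℂˣ :=
  fun i => ξ i ^ (k i).val

theorem laurentTwist_eq_scaleVars (k : ∀ i, ZMod (r i)) :
    laurentTwist ξ k = (scaleVars (rootVector ξ k)).toLinearMap := by
  refine (monoBasis n).ext fun m => ?_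
  rw [laurentTwist, Module.Basis.constr_basis, monoBasis_apply, AlgHom.toLinearMap_apply,
    scaleVars_mono]
  rfl

theorem rootVector_add [∀ i, NeZero (r i)] (hξ : ∀ i, IsPrimitiveRoot (ξ i) (r i))
    (k k' : ∀ i, ZMod (r i)) : rootVector ξ (k + k') = rootVector ξ k * rootVector ξ k' := by
  funext i
  rw [Pi.mul_apply, rootVector, rootVector, rootVector, Pi.add_apply, ZMod.val_add, ← pow_add]
  exact (pow_eq_pow_mod _ (hξ i).pow_eq_one).symm

theorem rootVector_injective [∀ i, NeZero (r i)] (hξ : ∀ i, IsPrimitiveRoot (ξ i) (r i)) :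
    Function.Injective (rootVector (r := r) ξ) := fun _ _ h => funext fun i =>
  ZMod.val_injective _ ((hξ i).pow_inj (ZMod.val_lt _) (ZMod.val_lt _) (congrFun h i))

theorem expChar_rootVector_single (hξ : ∀ i, IsPrimitiveRoot (ξ i) (r i)) (k : ∀ i, ZMod (r i))
    (i : Fin n) : expChar (rootVector ξ k) (Pi.single i (r i : ℤ)) = 1 := by
  rw [expChar_single, zpow_natCast, ← Units.val_pow_eq_pow_val, rootVector, pow_right_comm,
    (hξ i).pow_eq_one, one_pow, Units.val_one]

theorem powerSubalgebra_le_equalizer (hξ : ∀ i, IsPrimitiveRoot (ξ i) (r i))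
    (k : ∀ i, ZMod (r i)) :
    powerSubalgebra r ≤ AlgHom.equalizer (scaleVars (rootVector ξ k)) (AlgHom.id ℂ _) := by
  refine Algebra.adjoin_le (Set.union_subset ?_ ?_)
  · rintro _ ⟨i, rfl⟩
    exact (scaleVars_mono _ _).trans
      ((congrArg (· • _) (expChar_rootVector_single hξ k i)).trans (one_smul ℂ _))
  · rintro _ ⟨i, rfl⟩
    have hneg : expChar (rootVector ξ k) (Pi.single i (-(r i : ℤ))) = 1 := by
      rw [expChar_single, zpow_neg, ← expChar_single, expChar_rootVector_single hξ, inv_one]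
    exact (scaleVars_mono _ _).trans ((congrArg (· • _) hneg).trans (one_smul ℂ _))

theorem disjoint_rotate_image [∀ i, NeZero (r i)] (hξ : ∀ i, IsPrimitiveRoot (ξ i) (r i))
    {B : Set (Fin n → ℂˣ)} (hB : IsTransversal r ξ B) {k k' : ∀ i, ZMod (r i)} (hk : k ≠ k') :
    Disjoint (rotate ξ k '' B) (rotate ξ k' '' B) := by
  rw [Set.disjoint_left]
  rintro _ ⟨b, hb, rfl⟩ ⟨b', hb', h⟩
  have hbb : b = b' := (hB (rotate ξ k b)).unique ⟨hb, k, rfl⟩ ⟨hb', k', h.symm⟩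
  subst hbb
  exact hk (rootVector_injective hξ (mul_right_cancel h.symm))

end RootVector

section OrbitSum

variable {n : ℕ} {r : Fin n → ℕ} {ξ : Fin n → ℂˣ} {B : Set (Fin n → ℂˣ)}

theorem expFunctional_comp_laurentTwist (p : (Fin n → ℕ) × (Fin n → ℂˣ)) (k : ∀ i, ZMod (r i)) :
    expFunctional p ∘ₗ laurentTwist ξ k = expFunctional (p.1, rotate ξ k p.2) := by
  rw [laurentTwist_eq_scaleVars, expFunctional_comp_scaleVars]
  rfl

theorem comp_laurentTwist_mem_expPolySpan {φ : Module.Dual ℂ (Laurent n)}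
    (hφ : φ ∈ expPolySpan B) (k : ∀ i, ZMod (r i)) :
    φ ∘ₗ laurentTwist ξ k ∈ expPolySpan (rotate ξ k '' B) := by
  suffices h : expPolySpan B ≤
      (expPolySpan (rotate ξ k '' B)).comap (laurentTwist ξ k).dualMap from h hφ
  refine Submodule.span_le.2 ?_
  rintro _ ⟨p, hp, rfl⟩
  exact Submodule.subset_span ⟨_, ⟨p.2, hp, rfl⟩, (expFunctional_comp_laurentTwist p k).symm⟩

variable [∀ i, NeZero (r i)]

/-- The operator `φ ↦ ∑_k ξ^k φ` on the functionals on `A`. -/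
def orbitSum (r : Fin n → ℕ) [∀ i, NeZero (r i)] (ξ : Fin n → ℂˣ) :
    Module.Dual ℂ (Laurent n) →ₗ[ℂ] Module.Dual ℂ (Laurent n) :=
  ∑ k : (∀ i, ZMod (r i)), (laurentTwist ξ k).dualMap

theorem orbitSum_apply (φ : Module.Dual ℂ (Laurent n)) :
    orbitSum r ξ φ = ∑ k : (∀ i, ZMod (r i)), φ ∘ₗ laurentTwist ξ k :=
  LinearMap.sum_apply _ _ _

theorem orbitSum_expFunctional_rotate (hξ : ∀ i, IsPrimitiveRoot (ξ i) (r i))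
    (p : (Fin n → ℕ) × (Fin n → ℂˣ)) (k : ∀ i, ZMod (r i)) :
    orbitSum r ξ (expFunctional (p.1, rotate ξ k p.2)) = orbitSum r ξ (expFunctional p) := by
  rw [orbitSum_apply, orbitSum_apply]
  refine (Finset.sum_congr rfl fun k' _ => ?_).trans (Equiv.sum_comp (Equiv.addRight k) _)
  rw [expFunctional_comp_laurentTwist, expFunctional_comp_laurentTwist, Equiv.coe_addRight]
  change expFunctional (p.1, rootVector ξ k' * (rootVector ξ k * p.2)) =
    expFunctional (p.1, rootVector ξ (k' + k) * p.2)
  rw [rootVector_add hξ, mul_assoc]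

theorem map_orbitSum_expPolySpan_le (hξ : ∀ i, IsPrimitiveRoot (ξ i) (r i))
    (hB : IsTransversal r ξ B) :
    (expPolySpan Set.univ).map (orbitSum r ξ) ≤ (expPolySpan B).map (orbitSum r ξ) := by
  refine Submodule.map_le_iff_le_comap.2 (Submodule.span_le.2 ?_)
  rintro _ ⟨⟨e, l⟩, -, rfl⟩
  obtain ⟨b, hb, k, rfl⟩ := (hB l).exists
  exact ⟨expFunctional (e, b), Submodule.subset_span ⟨_, hb, rfl⟩,
    (orbitSum_expFunctional_rotate hξ (e, b) k).symm⟩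

end OrbitSum

section Decomposition

variable {ι : Type*} [Fintype ι] {C : Matrix ι ι ℤ} {H : Type*} [AddCommGroup H] [Module ℂ H]
  {Z : Realization C H} {n : ℕ} {H2 : Submodule ℂ (KM Z)}

theorem expPolyOn_iff {S : Set (Fin n → ℂˣ)} {ψ : Module.Dual ℂ (LoopCartan Z n H2)} :
    ExpPolyOn S ψ ↔ ∀ h, componentLin ψ h ∈ expPolySpan S :=
  forall_congr' fun h => isExpPolyOn_iff_mem_expPolySpan (φ := componentLin ψ h)

theorem finite_cartan' (Z : Realization C H) : Module.Finite ℂ (cartan' Z) := by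
  have := Z.finiteDimensional
  have h : FiniteDimensional ℂ (cartan Z) := by
    rw [cartan_eq]; infer_instance
  exact Submodule.finiteDimensional_of_le (inf_le_left : cartan' Z ≤ cartan Z)

theorem isCoprime_weightIdeal_left {ψ : Module.Dual ℂ (LoopCartan Z n H2)} {J : Ideal (Laurent n)}
    (hJ : ∀ h, IsCoprime (idealCore (componentLin ψ h)) J) : IsCoprime (weightIdeal ψ) J := by
  have := finite_cartan' Z
  let β := Module.finBasis ℂ (cartan' Z)
  have hle : ⨅ j ∈ Finset.univ, idealCore (componentLin ψ (β j)) ≤ weightIdeal ψ := by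
    refine fun a ha => (Submodule.mem_iInf _).2 fun h b => ?_
    have hzero : (componentLin ψ).flip (a * b) = 0 := β.ext fun j =>
      (Submodule.mem_iInf _).1 ((Submodule.mem_iInf _).1 ha j) (Finset.mem_univ j) b
    exact LinearMap.congr_fun hzero h
  have hcop := Ideal.isCoprime_biInf (s := Finset.univ) fun j _ => (hJ (β j)).symm
  exact Ideal.isCoprime_iff_codisjoint.2 (hcop.symm.codisjoint.mono_left hle)

theorem isCoprime_weightIdeal {S T : Set (Fin n → ℂˣ)} {ψ φ : Module.Dual ℂ (LoopCartan Z n H2)}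
    (hψ : ExpPolyOn S ψ) (hφ : ExpPolyOn T φ) (hST : Disjoint S T) :
    IsCoprime (weightIdeal ψ) (weightIdeal φ) :=
  isCoprime_weightIdeal_left fun h => (isCoprime_weightIdeal_left fun h' =>
    (isCoprime_idealCore_of_mem_expPolySpan hST (expPolyOn_iff.1 hψ h)
      (expPolyOn_iff.1 hφ h')).symm).symm

variable {r : Fin n → ℕ} {ξ : Fin n → ℂˣ} {B : Set (Fin n → ℂˣ)}

theorem twist_inr (k : ∀ i, ZMod (r i)) (Φ : Module.Dual ℂ (LoopCartan Z n H2)) (y : H2) :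
    twist ξ k Φ (0, y) = Φ (0, y) :=
  congrArg (fun t => Φ (t, y)) (map_zero (LinearMap.rTensor (cartan' Z) (laurentTwist ξ k)))

theorem ExpPolyOn.twist {Φ : Module.Dual ℂ (LoopCartan Z n H2)} (hΦ : ExpPolyOn B Φ)
    (k : ∀ i, ZMod (r i)) : ExpPolyOn (rotate ξ k '' B) (twist ξ k Φ) :=
  expPolyOn_iff.2 fun h => comp_laurentTwist_mem_expPolySpan (expPolyOn_iff.1 hΦ h) k

theorem dual_ext {φ ψ : Module.Dual ℂ (LoopCartan Z n H2)} (h₁ : componentLin φ = componentLin ψ)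
    (h₂ : ∀ y, φ (0, y) = ψ (0, y)) : φ = ψ :=
  LinearMap.prod_ext
    (TensorProduct.ext' fun a h => LinearMap.congr_fun (LinearMap.congr_fun h₁ h) a)
    (LinearMap.ext h₂)

theorem exists_dual (G : cartan' Z →ₗ[ℂ] Module.Dual ℂ (Laurent n)) (γ : Module.Dual ℂ H2) :
    ∃ Φ : Module.Dual ℂ (LoopCartan Z n H2), componentLin Φ = G ∧ ∀ y, Φ (0, y) = γ y := by
  refine ⟨(TensorProduct.lift G.flip).coprod γ, ?_, fun y => ?_⟩
  · refine LinearMap.ext fun h => LinearMap.ext fun a => ?_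
    change TensorProduct.lift G.flip (a ⊗ₜ[ℂ] h) + γ 0 = G h a
    rw [map_zero, add_zero, TensorProduct.lift.tmul, LinearMap.flip_apply]
  · rw [LinearMap.coprod_apply, map_zero, zero_add]

theorem componentLin_comp_laurentTwist (hξ : ∀ i, IsPrimitiveRoot (ξ i) (r i))
    {ψ : Module.Dual ℂ (LoopCartan Z n H2)} (hA : imageAlgebra ψ ≤ powerSubalgebra r)
    (k : ∀ i, ZMod (r i)) (h : cartan' Z) :
    componentLin ψ h ∘ₗ laurentTwist ξ k = componentLin ψ h := by
  refine (monoBasis n).ext fun m => ?_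
  have hfix : scaleVars (rootVector ξ k) (component ψ h m • mono m) = component ψ h m • mono m :=
    powerSubalgebra_le_equalizer hξ k (hA (Algebra.subset_adjoin ⟨(h, m), rfl⟩))
  rw [map_smul, scaleVars_mono, smul_smul, ← monoBasis_apply] at hfix
  rw [LinearMap.comp_apply, laurentTwist_eq_scaleVars, AlgHom.toLinearMap_apply, monoBasis_apply,
    scaleVars_mono, map_smul, smul_eq_mul, mul_comm]
  exact smul_left_injective ℂ ((monoBasis n).ne_zero m) hfix

variable [∀ i, NeZero (r i)]

theorem componentLin_sum_twist (Φ : Module.Dual ℂ (LoopCartan Z n H2)) (h : cartan' Z) :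
    componentLin (∑ k : (∀ i, ZMod (r i)), twist ξ k Φ) h = orbitSum r ξ (componentLin Φ h) := by
  refine LinearMap.ext fun a => ?_
  rw [orbitSum_apply, LinearMap.sum_apply]
  exact LinearMap.sum_apply _ _ _

-- The orbit sum multiplies the components of `ψ` by `R`, as they are supported on `rℤⁿ`, and it
-- does not distinguish an exponential from its representative in `B`.
theorem exists_isDecomposition (hξ : ∀ i, IsPrimitiveRoot (ξ i) (r i))
    (hB : IsTransversal r ξ B) {ψ : Module.Dual ℂ (LoopCartan Z n H2)}
    (hψ : ExpPoly ψ) (hA : imageAlgebra ψ ≤ powerSubalgebra r) :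
    ∃ Φ, IsDecomposition r ξ B ψ Φ := by
  let R : ℂ := Fintype.card (∀ i, ZMod (r i))
  have hR : R ≠ 0 := Nat.cast_ne_zero.2 Fintype.card_ne_zero
  have hsum (h : cartan' Z) : orbitSum r ξ (componentLin ψ h) = R • componentLin ψ h := by
    rw [orbitSum_apply, Finset.sum_congr rfl fun k _ => componentLin_comp_laurentTwist hξ hA k h,
      Finset.sum_const, Finset.card_univ, Nat.cast_smul_eq_nsmul]
  obtain ⟨G, hG⟩ := Module.projective_lifting_property
    ((orbitSum r ξ).submoduleMap (expPolySpan B))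
    ((orbitSum r ξ ∘ₗ componentLin ψ).codRestrict _ fun h => map_orbitSum_expPolySpan_le hξ hB
      (Submodule.mem_map_of_mem (expPolyOn_iff.1 hψ h)))
    ((orbitSum r ξ).submoduleMap_surjective _)
  have hG' (h : cartan' Z) : orbitSum r ξ (G h) = orbitSum r ξ (componentLin ψ h) :=
    congrArg Subtype.val (LinearMap.congr_fun hG h)
  obtain ⟨Φ, hΦ, hΦH⟩ := exists_dual (R⁻¹ • (expPolySpan B).subtype ∘ₗ G)
    (R⁻¹ • ψ ∘ₗ LinearMap.inr ℂ _ _)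
  refine ⟨Φ, expPolyOn_iff.2 fun h => ?_, dual_ext (LinearMap.ext fun h => ?_) fun y => ?_⟩
  · rw [hΦ]
    exact Submodule.smul_mem _ _ (G h).2
  · rw [componentLin_sum_twist, hΦ]
    change _ = orbitSum r ξ (R⁻¹ • (G h : Module.Dual ℂ (Laurent n)))
    rw [map_smul, hG', hsum, inv_smul_smul₀ hR]
  · rw [LinearMap.sum_apply, Finset.sum_congr rfl fun k _ => (twist_inr k Φ y).trans (hΦH y),
      Finset.sum_const, Finset.card_univ, ← Nat.cast_smul_eq_nsmul ℂ]
    exact (smul_inv_smul₀ hR _).symm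

end Decomposition

end LoopKM

end

theorem corollary3p9_general {ι : Type*} [Fintype ι] {C : Matrix ι ι ℤ}
    {H : Type*} [AddCommGroup H] [Module ℂ H] (Z : LoopKM.Realization C H)
    (H2 : Submodule ℂ (LoopKM.KM Z)) (hH2 : LoopKM.IsCartanCompl Z H2)
    (n : ℕ) (r : Fin n → ℕ) [∀ i, NeZero (r i)]
    (ξ : Fin n → ℂˣ) (hξ : ∀ i, IsPrimitiveRoot (ξ i) (r i))
    (B : Set (Fin n → ℂˣ)) (hB : LoopKM.IsTransversal r ξ B)
    (ψ : Module.Dual ℂ (LoopKM.LoopCartan Z n H2)) (hψ : LoopKM.ExpPoly ψ)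
    (hA : LoopKM.imageAlgebra ψ ≤ LoopKM.powerSubalgebra r) :
    (∃ Φ, LoopKM.IsDecomposition r ξ B ψ Φ) ∧
    ∀ Φ, LoopKM.IsDecomposition r ξ B ψ Φ →
      (∀ k : (∀ i, ZMod (r i)),
        LieModule.IsIrreducible ℂ (LoopKM.loopKM Z n H2) (LoopKM.V (LoopKM.twist ξ k Φ))) ∧
      Nonempty (LoopKM.V ψ ≃ₗ⁅ℂ, LoopKM.loopKM Z n H2⁆
        ⨂[ℂ] k : (∀ i, ZMod (r i)), LoopKM.V (LoopKM.twist ξ k Φ)) := by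
  refine ⟨LoopKM.exists_isDecomposition hξ hB hψ hA,
    fun Φ hΦ => ⟨fun k => LoopKM.isIrreducible_V hH2 _, ?_⟩⟩
  obtain ⟨hΦB, rfl⟩ := hΦ
  exact LoopKM.nonempty_equiv_tensor hH2 fun k k' hk => LoopKM.isCoprime_weightIdeal
    (hΦB.twist k) (hΦB.twist k') (LoopKM.disjoint_rotate_image hξ hB hk)

theorem corollary3p9 {ι : Type*} [Fintype ι] {C : Matrix ι ι ℤ} (hC : LoopKM.IsGCM C)
    {H : Type*} [AddCommGroup H] [Module ℂ H] (Z : LoopKM.Realization C H)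
    (H2 : Submodule ℂ (LoopKM.KM Z)) (hH2 : LoopKM.IsCartanCompl Z H2)
    (n : ℕ) (r : Fin n → ℕ) [∀ i, NeZero (r i)]
    (ξ : Fin n → ℂˣ) (hξ : ∀ i, IsPrimitiveRoot (ξ i) (r i))
    (B : Set (Fin n → ℂˣ)) (hB : LoopKM.IsTransversal r ξ B)
    (ψ : Module.Dual ℂ (LoopKM.LoopCartan Z n H2)) (hψ : LoopKM.ExpPoly ψ)
    (hA : LoopKM.imageAlgebra ψ = LoopKM.powerSubalgebra r) :
    (∃ Φ, LoopKM.IsDecomposition r ξ B ψ Φ) ∧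
    ∀ Φ, LoopKM.IsDecomposition r ξ B ψ Φ →
      (∀ k : (∀ i, ZMod (r i)),
        LieModule.IsIrreducible ℂ (LoopKM.loopKM Z n H2) (LoopKM.V (LoopKM.twist ξ k Φ))) ∧
      Nonempty (LoopKM.V ψ ≃ₗ⁅ℂ, LoopKM.loopKM Z n H2⁆
        ⨂[ℂ] k : (∀ i, ZMod (r i)), LoopKM.V (LoopKM.twist ξ k Φ)) :=
  corollary3p9_general Z H2 hH2 n r ξ hξ B hB ψ hψ hA.le
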